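/- Let $(\Omega,\mathcal F,P)$ be a probability space that carries a $[0,1]$-valued, uniformly distributed random variable, let $X$ be a Banach space over $\mathbb K\in\{\mathbb R,\mathbb C\}$ with dual $X^*$, let $p\in[1,\infty)$ and $q\in(1,\infty]$ with $1/p+1/q=1$, and let $\sigma:[0,1)\to[0,\infty)$ be nondecreasing and left-continuous with $\int_0^1\sigma(u)\,du=1$. Random variables that coincide $P$-almost everywhere are identified. For a Banach space $E$, $r\in[1,\infty)$ and a strongly measurable $Y:\Omega\to E$ put $\|Y\|_{\sigma,r}^r:=\sup_U\mathbb E\,\sigma(U)\|Y\|^r$, the supremum being over all $[0,1]$-valued uniformly distributed random variables $U$ on $(\Omega,\mathcal F,P)$, and let $L^p_\sigma(P,X)$ be the space of all strongly measurable $Y:\Omega\to X$ with $\|Y\|_{\sigma,p}<\infty$, normed by $\|\cdot\|_{\sigma,p}$. For a nonnegative random variable $Y$ let $F_Y^{-1}(\alpha):=\inf\{t: P(Y\le t)\ge\alpha\}$ and $\mathsf{AV@R}_\alpha(Y):=\frac1{1-\alpha}\int_\alpha^1F_Y^{-1}(u)\,du$ for $\alpha\in[0,1)$. For a scalar random variable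 $Z$ put $$|Z|^*_{\sigma,\infty}:=\sup_{\alpha\in[0,1)}\frac{\mathsf{AV@R}_\alpha(|Z|)}{\frac1{1-\alpha}\int_\alpha^1\sigma(u)\,du},\qquad |Z|^*_{\sigma,q}:=\inf\|Z'\|_{\sigma,q}\quad(q<\infty),$$ where the infimum (with $\inf\emptyset=\infty$) is over all scalar random variables $Z'$ for which there is a $[0,1]$-valued uniformly distributed $U$ with $\mathsf{AV@R}_\alpha(\sigma(U)|Z'|)\ge\mathsf{AV@R}_\alpha(|Z|)$ for all $\alpha\in[0,1)$. Let $L^{q*}_\sigma(P,X^*)$ be the set of all strongly measurable $Z:\Omega\to X^*$ with $|Z|^{q,*}_\sigma:=\big|\,\|Z\|\,\big|^*_{\sigma,q}<\infty$. Then $L^{q*}_\sigma(P,X^*)$ is a vector space; for $Z\in L^{q*}_\sigma(P,X^*)$ and $Y\in L^p_\sigma(P,X)$ the function $\langle Z,Y\rangle$ is integrable; and $$\iota:\ L^{q*}_\sigma(P,X^*)\to L^p_\sigma(P,X)^*,\qquad \iota(Z)(Y)=\mathbb E\langle Z,Y\rangle,$$ is a well-defined injective linear map with $\|\iota(Z)\|=|Z|^{q,*}_\sigma$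 for all $Z$. This isometry is an isomorphism (that is, bijective) if and only if $X^*$ has the Radon–Nikodým property with respect to $(\Omega,\mathcal F,P)$: for every $\sigma$-additive vector measure $\mu:\mathcal F\to X^*$ of bounded variation with $\mu(A)=0$ whenever $P(A)=0$ there is a Bochner integrable $Z:\Omega\to X^*$ such that $\mu(A)=\int_AZ\,dP$ for all $A\in\mathcal F$. -/

import Mathlib

open MeasureTheory Set
open scoped ENNReal

/-- A distortion function: a nondecreasing, nonnegative, left-continuous function on `[0,1)` with
integral one. It is stored as a function on `ℝ`; its values outside `[0,1)` are irrelevant. -/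
structure DistortionFunction where
  toFun : ℝ → ℝ
  nonneg : ∀ u ∈ Ico (0 : ℝ) 1, 0 ≤ toFun u
  mono : MonotoneOn toFun (Ico 0 1)
  left_cont : ∀ u ∈ Ioo (0 : ℝ) 1, ContinuousWithinAt toFun (Iic u) u
  lintegral_eq_one : ∫⁻ u in Ico (0 : ℝ) 1, ENNReal.ofReal (toFun u) = 1

instance : CoeFun DistortionFunction (fun _ => ℝ → ℝ) := ⟨DistortionFunction.toFun⟩

/-- `U` is a `[0,1]`-valued, uniformly distributed random variable on `(Ω, P)`. -/
structure IsUniform01 {Ω : Type*} [MeasurableSpace Ω] (P : Measure Ω) (U : Ω → ℝ) : Prop where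
  measurable : Measurable U
  mem_Icc : ∀ ω, U ω ∈ Icc (0 : ℝ) 1
  map_eq : P.map U = volume.restrict (Icc (0 : ℝ) 1)

noncomputable section

/-! ### The spaces `L_σ^p(P, X)` -/

/-- `‖Y‖_{σ,p}`, with values in `[0,∞]`:
the `p`-th root of the supremum of `E σ(U) ‖Y‖^p` over all `[0,1]`-valued uniform `U`. -/
def sigmaNorm {Ω : Type*} [MeasurableSpace Ω] (σ : DistortionFunction) (p : ℝ) (P : Measure Ω)
    {E : Type*} [NormedAddCommGroup E] (Y : Ω → E) : ℝ≥0∞ :=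
  (⨆ (U : Ω → ℝ) (_ : IsUniform01 P U),
    ∫⁻ ω, ENNReal.ofReal (σ (U ω)) * ‖Y ω‖ₑ ^ p ∂P) ^ (1 / p)

section sigmaNorm

variable {Ω : Type*} [MeasurableSpace Ω] {σ : DistortionFunction} {p : ℝ} {P : Measure Ω}
  {E : Type*} [NormedAddCommGroup E]

theorem IsUniform01.aemeasurable_weight {U : Ω → ℝ} (hU : IsUniform01 P U)
    (σ : DistortionFunction) :
    AEMeasurable (fun ω => ENNReal.ofReal (σ (U ω))) P := by
  have h : AEMeasurable σ.toFun (P.map U) := by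
    rw [hU.map_eq, ← restrict_Ico_eq_restrict_Icc]
    exact aemeasurable_restrict_of_monotoneOn measurableSet_Ico σ.mono
  exact (h.comp_measurable hU.measurable).ennreal_ofReal

theorem sigmaNorm_congr {Y Y' : Ω → E} (h : Y =ᵐ[P] Y') :
    sigmaNorm σ p P Y = sigmaNorm σ p P Y' := by
  unfold sigmaNorm
  congr 1
  refine iSup_congr fun U => iSup_congr fun _ => lintegral_congr_ae ?_
  filter_upwards [h] with ω hω
  rw [hω]

theorem sigmaNorm_zero (hp : 1 ≤ p) : sigmaNorm σ p P (fun _ => (0 : E)) = 0 := by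
  have hp0 : 0 < p := by linarith
  simp [sigmaNorm, ENNReal.zero_rpow_of_pos hp0, hp0]

theorem sigmaNorm_add_le (hp : 1 ≤ p) {Y Y' : Ω → E} (hY : AEStronglyMeasurable Y P)
    (hY' : AEStronglyMeasurable Y' P) :
    sigmaNorm σ p P (fun ω => Y ω + Y' ω) ≤ sigmaNorm σ p P Y + sigmaNorm σ p P Y' := by
  have hp0 : 0 < p := by linarith
  have key : ∀ U : Ω → ℝ, IsUniform01 P U → ∀ Z : Ω → E,
      (∫⁻ ω, ENNReal.ofReal (σ (U ω)) * ‖Z ω‖ₑ ^ p ∂P) ^ (1 / p) ≤ sigmaNorm σ p P Z :=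
    fun U hU Z => ENNReal.rpow_le_rpow
      (le_iSup₂ (f := fun (U : Ω → ℝ) (_ : IsUniform01 P U) =>
        ∫⁻ ω, ENNReal.ofReal (σ (U ω)) * ‖Z ω‖ₑ ^ p ∂P) U hU) (by positivity)
  have root : ∀ (w x : ℝ≥0∞), w * x ^ p = (w ^ (1 / p) * x) ^ p := fun w x => by
    rw [ENNReal.mul_rpow_of_nonneg _ _ hp0.le, ← ENNReal.rpow_mul, one_div_mul_cancel hp0.ne',
      ENNReal.rpow_one]
  conv_lhs => rw [sigmaNorm]
  rw [one_div, ENNReal.rpow_inv_le_iff hp0]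
  refine iSup₂_le fun U hU => ?_
  rw [← ENNReal.rpow_inv_le_iff hp0, ← one_div]
  have hw := (hU.aemeasurable_weight σ).pow_const (1 / p)
  calc (∫⁻ ω, ENNReal.ofReal (σ (U ω)) * ‖Y ω + Y' ω‖ₑ ^ p ∂P) ^ (1 / p)
      ≤ (∫⁻ ω, ((fun ω => ENNReal.ofReal (σ (U ω)) ^ (1 / p) * ‖Y ω‖ₑ)
          + (fun ω => ENNReal.ofReal (σ (U ω)) ^ (1 / p) * ‖Y' ω‖ₑ)) ω ^ p ∂P) ^ (1 / p) := by
        refine ENNReal.rpow_le_rpow (lintegral_mono fun ω => ?_) (by positivity)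
        rw [root, Pi.add_apply, ← mul_add]
        exact ENNReal.rpow_le_rpow (by gcongr; exact enorm_add_le _ _) hp0.le
    _ ≤ _ := ENNReal.lintegral_Lp_add_le (hw.mul hY.enorm) (hw.mul hY'.enorm) hp
    _ ≤ sigmaNorm σ p P Y + sigmaNorm σ p P Y' := by
        simp only [← root]
        exact add_le_add (key U hU Y) (key U hU Y')

theorem sigmaNorm_smul {𝕜 : Type*} [RCLike 𝕜] [NormedSpace 𝕜 E] (hp : 1 ≤ p) (c : 𝕜)
    (Y : Ω → E) : sigmaNorm σ p P (fun ω => c • Y ω) = ‖c‖ₑ * sigmaNorm σ p P Y := by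
  have hp0 : 0 < p := by linarith
  have h : ∀ U : Ω → ℝ, ∫⁻ ω, ENNReal.ofReal (σ (U ω)) * ‖c • Y ω‖ₑ ^ p ∂P
      = ‖c‖ₑ ^ p * ∫⁻ ω, ENNReal.ofReal (σ (U ω)) * ‖Y ω‖ₑ ^ p ∂P := fun U => by
    rw [← lintegral_const_mul' _ _ (ENNReal.rpow_ne_top_of_nonneg hp0.le enorm_ne_top)]
    refine lintegral_congr fun ω => ?_
    rw [enorm_smul, ENNReal.mul_rpow_of_nonneg _ _ hp0.le, mul_left_comm]
  simp only [sigmaNorm, h, ← ENNReal.mul_iSup]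
  rw [ENNReal.mul_rpow_of_nonneg _ _ (by positivity), ← ENNReal.rpow_mul,
    mul_one_div_cancel hp0.ne', ENNReal.rpow_one]

end sigmaNorm

/-- `L_σ^p(P, X)` as a subspace of the space of strongly measurable functions modulo almost
everywhere equality. -/
def sigmaSubmodule (𝕜 : Type*) [RCLike 𝕜] {Ω : Type*} [MeasurableSpace Ω]
    (σ : DistortionFunction) (p : ℝ) [hp : Fact (1 ≤ p)] (P : Measure Ω)
    (X : Type*) [NormedAddCommGroup X] [NormedSpace 𝕜 X] : Submodule 𝕜 (Ω →ₘ[P] X) where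
  carrier := {Y | sigmaNorm σ p P Y < ∞}
  zero_mem' := by
    rw [mem_ofPred_eq, sigmaNorm_congr AEEqFun.coeFn_zero]
    exact (sigmaNorm_zero hp.out).trans_lt ENNReal.zero_lt_top
  add_mem' := fun {Y Y'} h h' => by
    rw [mem_ofPred_eq, sigmaNorm_congr (AEEqFun.coeFn_add Y Y')]
    exact (sigmaNorm_add_le hp.out Y.aestronglyMeasurable Y'.aestronglyMeasurable).trans_lt
      (ENNReal.add_lt_top.2 ⟨h, h'⟩)
  smul_mem' := fun c Y h => by
    rw [mem_ofPred_eq, sigmaNorm_congr (AEEqFun.coeFn_smul c Y)]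
    exact (sigmaNorm_smul hp.out c Y).trans_lt (ENNReal.mul_lt_top enorm_lt_top h)

/-- The space `L_σ^p(P, X)`, to be normed by `‖·‖_{σ,p}`. -/
def LSigma (𝕜 : Type*) [RCLike 𝕜] {Ω : Type*} [MeasurableSpace Ω]
    (σ : DistortionFunction) (p : ℝ) [Fact (1 ≤ p)] (P : Measure Ω)
    (X : Type*) [NormedAddCommGroup X] [NormedSpace 𝕜 X] : Type _ :=
  ↥(sigmaSubmodule 𝕜 σ p P X)

namespace LSigma

variable {𝕜 : Type*} [RCLike 𝕜] {Ω : Type*} [MeasurableSpace Ω]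
  {σ : DistortionFunction} {p : ℝ} [hp : Fact (1 ≤ p)] {P : Measure Ω}
  {X : Type*} [NormedAddCommGroup X] [NormedSpace 𝕜 X]

instance : AddCommGroup (LSigma 𝕜 σ p P X) :=
  inferInstanceAs (AddCommGroup ↥(sigmaSubmodule 𝕜 σ p P X))

instance : Module 𝕜 (LSigma 𝕜 σ p P X) :=
  inferInstanceAs (Module 𝕜 ↥(sigmaSubmodule 𝕜 σ p P X))

/-- The underlying class of random variables. -/
def toAEEqFun (Y : LSigma 𝕜 σ p P X) : Ω →ₘ[P] X := Y.1

instance : CoeFun (LSigma 𝕜 σ p P X) (fun _ => Ω → X) := ⟨fun Y => Y.toAEEqFun⟩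

theorem sigmaNorm_ne_top (Y : LSigma 𝕜 σ p P X) : sigmaNorm σ p P Y ≠ ∞ := ne_of_lt Y.2

theorem coeFn_zero : ((0 : LSigma 𝕜 σ p P X) : Ω → X) =ᵐ[P] fun _ => 0 := AEEqFun.coeFn_zero

theorem coeFn_add (Y Y' : LSigma 𝕜 σ p P X) :
    ((Y + Y' : LSigma 𝕜 σ p P X) : Ω → X) =ᵐ[P] fun ω => Y ω + Y' ω :=
  AEEqFun.coeFn_add Y.toAEEqFun Y'.toAEEqFun

theorem coeFn_smul (c : 𝕜) (Y : LSigma 𝕜 σ p P X) :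
    ((c • Y : LSigma 𝕜 σ p P X) : Ω → X) =ᵐ[P] fun ω => c • Y ω :=
  AEEqFun.coeFn_smul c Y.toAEEqFun

/-- The norm of `L_σ^p(P, X)`. That nonzero elements have nonzero norm rests on the existence of a
uniform random variable, so that only the seminormed structure is recorded here; the dual space and
its norm do not depend on it. -/
instance : Norm (LSigma 𝕜 σ p P X) := ⟨fun Y => (sigmaNorm σ p P Y).toReal⟩

theorem norm_def (Y : LSigma 𝕜 σ p P X) : ‖Y‖ = (sigmaNorm σ p P Y).toReal := rfl

theorem norm_smul_eq (c : 𝕜) (Y : LSigma 𝕜 σ p P X) : ‖c • Y‖ = ‖c‖ * ‖Y‖ := by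
  rw [norm_def, norm_def, sigmaNorm_congr (coeFn_smul c Y), sigmaNorm_smul hp.out,
    ENNReal.toReal_mul, toReal_enorm]

theorem norm_add_le_add (Y Y' : LSigma 𝕜 σ p P X) : ‖Y + Y'‖ ≤ ‖Y‖ + ‖Y'‖ := by
  rw [norm_def, norm_def, norm_def, sigmaNorm_congr (coeFn_add Y Y'),
    ← ENNReal.toReal_add Y.sigmaNorm_ne_top Y'.sigmaNorm_ne_top]
  exact ENNReal.toReal_mono (ENNReal.add_ne_top.2 ⟨Y.sigmaNorm_ne_top, Y'.sigmaNorm_ne_top⟩)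
    (sigmaNorm_add_le hp.out Y.toAEEqFun.aestronglyMeasurable Y'.toAEEqFun.aestronglyMeasurable)

theorem core : SeminormedSpace.Core 𝕜 (LSigma 𝕜 σ p P X) where
  norm_nonneg _ := ENNReal.toReal_nonneg
  norm_smul := norm_smul_eq
  norm_triangle := norm_add_le_add

instance : SeminormedAddCommGroup (LSigma 𝕜 σ p P X) :=
  SeminormedAddCommGroup.ofCore (core (𝕜 := 𝕜))

instance : NormedSpace 𝕜 (LSigma 𝕜 σ p P X) where
  norm_smul_le c Y := (norm_smul_eq c Y).le

end LSigma

/-! ### The spaces `L_σ^{q*}(P, X)` -/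

/-- The generalized inverse `F_Y⁻¹(α) = inf {t | P(Y ≤ t) ≥ α}`. -/
def quantileFn {Ω : Type*} [MeasurableSpace Ω] (P : Measure Ω) (Y : Ω → ℝ) (α : ℝ) : ℝ :=
  sInf {t : ℝ | ENNReal.ofReal α ≤ P {ω | Y ω ≤ t}}

/-- The average value-at-risk `(1-α)⁻¹ ∫_α^1 F_Y⁻¹(u) du` of level `α ∈ [0,1)` of an (almost surely)
nonnegative random variable `Y`, with values in `[0,∞]`. -/
def avar {Ω : Type*} [MeasurableSpace Ω] (P : Measure Ω) (Y : Ω → ℝ) (α : ℝ) : ℝ≥0∞ :=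
  (∫⁻ u in Ioo α 1, ENNReal.ofReal (quantileFn P Y u)) / ENNReal.ofReal (1 - α)

/-- `S_σ(α) = ∫_α^1 σ(u) du`. -/
def DistortionFunction.S (σ : DistortionFunction) (α : ℝ) : ℝ≥0∞ :=
  ∫⁻ u in Ioo α 1, ENNReal.ofReal (σ u)

/-- `Z'` `σ`-dominates `Z`: for some uniform `U`, `AV@R_α(σ(U)|Z'|) ≥ AV@R_α(|Z|)` for all
`α ∈ [0,1)`. -/
def SigmaDominates {Ω : Type*} [MeasurableSpace Ω] (σ : DistortionFunction) (P : Measure Ω)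
    (Z' Z : Ω → ℝ) : Prop :=
  ∃ U : Ω → ℝ, IsUniform01 P U ∧ ∀ α ∈ Ico (0 : ℝ) 1,
    avar P (fun ω => |Z ω|) α ≤ avar P (fun ω => σ (U ω) * |Z' ω|) α

open Classical in
/-- `|Z|_{σ,q}^*` for a scalar random variable, with values in `[0,∞]`. As only absolute values of
random variables enter, real-valued ones are enough. -/
def sigmaStarNorm {Ω : Type*} [MeasurableSpace Ω] (σ : DistortionFunction) (q : ℝ≥0∞)
    (P : Measure Ω) (Z : Ω → ℝ) : ℝ≥0∞ :=
  if q = ∞ then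
    ⨆ α ∈ Ico (0 : ℝ) 1, avar P (fun ω => |Z ω|) α / (σ.S α / ENNReal.ofReal (1 - α))
  else
    ⨅ (Z' : Ω →ₘ[P] ℝ) (_ : SigmaDominates σ P Z' Z), sigmaNorm σ q.toReal P Z'

/-- `|Z|_σ^{q,*} = |‖Z‖|_{σ,q}^*` for a vector-valued random variable. -/
def vectorStarNorm {Ω : Type*} [MeasurableSpace Ω] (σ : DistortionFunction) (q : ℝ≥0∞)
    (P : Measure Ω) {E : Type*} [NormedAddCommGroup E] (Z : Ω → E) : ℝ≥0∞ :=
  sigmaStarNorm σ q P (fun ω => ‖Z ω‖)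

/-- `L_σ^{q*}(P, E)`, as a set of strongly measurable functions modulo almost everywhere equality. -/
def LSigmaStar {Ω : Type*} [MeasurableSpace Ω] (σ : DistortionFunction) (q : ℝ≥0∞)
    (P : Measure Ω) (E : Type*) [NormedAddCommGroup E] : Set (Ω →ₘ[P] E) :=
  {Z | vectorStarNorm σ q P Z < ∞}

/-! ### The Radon–Nikodým property -/

/-- `E` has the Radon–Nikodým property with respect to `(Ω, P)`: every `P`-continuous `E`-valued
vector measure of bounded variation has a Bochner integrable density. -/
def HasRadonNikodymProperty {Ω : Type*} [MeasurableSpace Ω] (P : Measure Ω)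
    (E : Type*) [NormedAddCommGroup E] [NormedSpace ℝ E] : Prop :=
  ∀ μ : VectorMeasure Ω E, μ.variation univ < ∞ →
    (∀ A, MeasurableSet A → P A = 0 → μ A = 0) →
    ∃ Z : Ω → E, Integrable Z P ∧ ∀ A, MeasurableSet A → μ A = ∫ ω in A, Z ω ∂P

end

/-! ### Monotone functions and layer cakes -/

/-! The norm identity is a scalar rearrangement statement. If `V` is uniform and `‖Y‖ = h(V)` with
`h` nondecreasing, then the Hardy–Littlewood inequality shows that the supremum defining the norm of
`Y` is attained at `V`, with `p`-th power `∫ σ h^p` (`sigmaNorm_eq_of_comonotone`). Ranks with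
randomized ties provide such a `V` for every `Y` (`IsUniform01.exists_eq_quantileFn`). Since
measures are compared on half-lines only, all comparisons reduce to integrals of nondecreasing
functions (`lintegral_mono_of_Ioi_le`).

Hölder's inequality (`lintegral_mul_le_sigmaStarNorm_mul`) replaces the tails of `|g|` by those of
`σ(U)|Z'|` (of a multiple of `σ` if `q = ∞`), undoes the rearrangement, and applies the usual Hölder
inequality with weight `σ(U)`. For the converse (`sigmaStarNorm_le_of_forall_lintegral_le`), write
`|g| = γ(V)` and test with `k(V)`, `k` nondecreasing. For `q = ∞` the indicators of `(a,∞)` suffice.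
For `q < ∞` a dominating `Z'` of norm at most `C` is needed; it comes from Halperin's level function
(`exists_level`). A maximizer `H` of the concave functional `∫ h γ - p⁻¹ ∫ h^p σ` over nondecreasing
`h` is found from modularity on the lattice of such functions. Variation by multiples of `H` bounds
its norm, variation by steps on half-lines gives the tail domination, and `Z' = H^{p-1}(U)` works.
Measurably selected almost norming vectors carry the duality over to `Z` with values in `X^*`, which
makes `ι` an isometry; the same duality proves the triangle inequality for the star norm.

If `X^*` has the Radon–Nikodým property, a functional `φ` induces the measure `A ↦ φ(1_A ·)` of
variation at most `‖φ‖`. Its density represents `φ` on bounded functions, lies in the star space by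
the converse Hölder inequality, and represents `φ` everywhere because bounded functions are dense
(`p < ∞`).

Conversely, let `μ` have variation `m ≪ P`, and put `G = 1 + dm/dP`. Then `Y ↦ ∫ G⁻¹ Y dμ` is
continuous already for the `L¹(P)`-norm, which the norm of `L_σ^p` dominates. If `W` represents this
functional, then `G W` is the density of `μ` (`exists_density_of_dualPairing_surjective`). -/

theorem IsUpperSet.exists_Ioi_subset_subset_Ici {T : Set ℝ} (hT : IsUpperSet T) (h0 : T.Nonempty)
    (h1 : T ≠ univ) : ∃ a, Ioi a ⊆ T ∧ T ⊆ Ici a := by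
  obtain ⟨b, hb⟩ := (ne_univ_iff_exists_notMem T).1 h1
  have hbdd : BddBelow T := ⟨b, fun x hx => by
    by_contra! h
    exact hb (hT h.le hx)⟩
  refine ⟨sInf T, fun x hx => ?_, fun x hx => csInf_le hbdd hx⟩
  obtain ⟨y, hy, hyx⟩ := exists_lt_of_csInf_lt h0 hx
  exact hT hyx.le hy

/-- An upper set is empty, the whole line, or a half-line up to its endpoint. Only `ν₁` must be free
of atoms, since the endpoint is added on its side alone. -/
theorem measure_upperSet_le {ν₁ ν₂ : Measure ℝ} [NullSingletonClass ν₁]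
    (h : ∀ a, ν₁ (Ioi a) ≤ ν₂ (Ioi a)) {T : Set ℝ} (hT : IsUpperSet T) : ν₁ T ≤ ν₂ T := by
  rcases T.eq_empty_or_nonempty with rfl | h0
  · simp
  by_cases h1 : T = univ
  · have hu : (univ : Set ℝ) = ⋃ n : ℕ, Ioi (-(n : ℝ)) := by
      refine (eq_univ_of_forall fun x => mem_iUnion.2 ?_).symm
      obtain ⟨n, hn⟩ := exists_nat_gt (-x)
      exact ⟨n, by simp only [mem_Ioi]; linarith⟩
    have hm : Monotone fun n : ℕ => Ioi (-(n : ℝ)) := fun a b hab =>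
      Ioi_subset_Ioi (neg_le_neg (by exact_mod_cast hab))
    rw [h1, hu, hm.measure_iUnion]
    exact iSup_le fun n =>
      (h _).trans (measure_mono (subset_iUnion (fun n : ℕ => Ioi (-(n : ℝ))) n))
  obtain ⟨a, ha, ha'⟩ := hT.exists_Ioi_subset_subset_Ici h0 h1
  calc ν₁ T ≤ ν₁ (Ici a) := measure_mono ha'
    _ = ν₁ (Ioi a) := measure_congr Ioi_ae_eq_Ici.symm
    _ ≤ ν₂ (Ioi a) := h a
    _ ≤ ν₂ T := measure_mono ha

/-- Layer cake: the superlevel sets of a monotone function are upper sets. -/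
theorem lintegral_mono_of_Ioi_le {ν₁ ν₂ : Measure ℝ} [NullSingletonClass ν₁]
    (h : ∀ a, ν₁ (Ioi a) ≤ ν₂ (Ioi a)) {f : ℝ → ℝ≥0∞} (hf : Monotone f) :
    ∫⁻ x, f x ∂ν₁ ≤ ∫⁻ x, f x ∂ν₂ := by
  -- The layer cake formula is applied to real-valued functions, hence the truncation.
  have hsup : ∀ x, f x = ⨆ n : ℕ, min (f x) n := fun x => by
    refine le_antisymm ?_ (iSup_le fun n => min_le_left _ _)
    rw [← inf_iSup_eq, ENNReal.iSup_natCast, inf_top_eq]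
  have hmeas : ∀ n : ℕ, Measurable fun x => min (f x) (n : ℝ≥0∞) :=
    fun n => hf.measurable.min measurable_const
  have hmono : Monotone fun (n : ℕ) x => min (f x) (n : ℝ≥0∞) := fun a b hab x =>
    min_le_min le_rfl (by exact_mod_cast hab)
  have e : ∀ (n : ℕ) (x : ℝ), min (f x) (n : ℝ≥0∞) = ENNReal.ofReal (min (f x) (n : ℝ≥0∞)).toReal :=
    fun n x => (ENNReal.ofReal_toReal (ne_top_of_le_ne_top (ENNReal.natCast_ne_top n)
      (min_le_right _ _))).symm
  rw [lintegral_congr hsup, lintegral_congr (μ := ν₂) hsup, lintegral_iSup hmeas hmono,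
    lintegral_iSup hmeas hmono]
  refine iSup_mono fun n => ?_
  rw [lintegral_congr (e n), lintegral_congr (μ := ν₂) (e n),
    lintegral_eq_lintegral_meas_lt ν₁ (.of_forall fun _ => ENNReal.toReal_nonneg)
      (hmeas n).ennreal_toReal.aemeasurable,
    lintegral_eq_lintegral_meas_lt ν₂ (.of_forall fun _ => ENNReal.toReal_nonneg)
      (hmeas n).ennreal_toReal.aemeasurable]
  refine lintegral_mono fun t => measure_upperSet_le h fun x y hxy hx => ?_
  exact lt_of_lt_of_le hx (ENNReal.toReal_mono (ne_top_of_le_ne_top (ENNReal.natCast_ne_top n)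
      (min_le_right _ _)) (min_le_min (hf hxy) le_rfl))

/-- As `ν₁` lives on `(0,1)`, half-lines starting outside `[0,1)` impose no further condition. -/
theorem lintegral_mono_of_Ioi_le_of_mem_Ico {ν₁ ν₂ : Measure ℝ} [NullSingletonClass ν₁]
    (h0 : ν₁ (Ioo 0 1)ᶜ = 0) (h : ∀ a ∈ Ico (0 : ℝ) 1, ν₁ (Ioi a) ≤ ν₂ (Ioi a)) {f : ℝ → ℝ≥0∞}
    (hf : Monotone f) : ∫⁻ x, f x ∂ν₁ ≤ ∫⁻ x, f x ∂ν₂ := by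
  refine lintegral_mono_of_Ioi_le (fun a => ?_) hf
  rcases lt_or_ge a 0 with ha | ha
  · calc ν₁ (Ioi a) ≤ ν₁ (Ioi 0 ∪ (Ioo 0 1)ᶜ) := measure_mono fun x _ => by
          by_cases hx : 0 < x
          · exact Or.inl hx
          · exact Or.inr fun h => hx h.1
      _ ≤ ν₁ (Ioi 0) + ν₁ (Ioo 0 1)ᶜ := measure_union_le _ _
      _ = ν₁ (Ioi 0) := by rw [h0, add_zero]
      _ ≤ ν₂ (Ioi 0) := h 0 (by simp)
      _ ≤ ν₂ (Ioi a) := measure_mono (Ioi_subset_Ioi ha.le)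
  rcases lt_or_ge a 1 with ha1 | ha1
  · exact h a ⟨ha, ha1⟩
  · refine (measure_mono_null (fun x hx hx' => ?_) h0).le.trans zero_le
    exact absurd hx'.2 (not_lt.2 (ha1.trans (le_of_lt hx)))

/-! ### Uniform random variables and the Hardy–Littlewood inequality -/

section Uniform

variable {Ω : Type*} [MeasurableSpace Ω] {P : Measure Ω}

theorem IsUniform01.map_eq_Ioo {U : Ω → ℝ} (hU : IsUniform01 P U) :
    P.map U = volume.restrict (Ioo (0 : ℝ) 1) := by
  rw [hU.map_eq, restrict_Ioo_eq_restrict_Icc]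

theorem IsUniform01.lintegral_comp {U : Ω → ℝ} (hU : IsUniform01 P U) {f : ℝ → ℝ≥0∞}
    (hf : Measurable f) : ∫⁻ ω, f (U ω) ∂P = ∫⁻ u in Ioo 0 1, f u := by
  rw [← hU.map_eq_Ioo, lintegral_map hf hU.measurable]

theorem IsUniform01.ae_mem_Ioo {U : Ω → ℝ} (hU : IsUniform01 P U) :
    ∀ᵐ ω ∂P, U ω ∈ Ioo (0 : ℝ) 1 := by
  have : ∀ᵐ u ∂(P.map U), u ∈ Ioo (0 : ℝ) 1 := by
    rw [hU.map_eq_Ioo]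
    exact ae_restrict_mem measurableSet_Ioo
  exact ae_of_ae_map hU.measurable.aemeasurable this

theorem IsUniform01.setLIntegral_comp {U : Ω → ℝ} (hU : IsUniform01 P U) {f : ℝ → ℝ≥0∞}
    (hf : Measurable f) {a : ℝ} (ha : 0 ≤ a) :
    ∫⁻ ω in {ω | a < U ω}, f (U ω) ∂P = ∫⁻ u in Ioo a 1, f u := by
  have : {ω | a < U ω} = U ⁻¹' (Ioi a) := rfl
  rw [this, ← setLIntegral_map measurableSet_Ioi hf hU.measurable, hU.map_eq_Ioo,
    Measure.restrict_restrict measurableSet_Ioi]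
  congr 2
  ext x; simp only [mem_inter_iff, mem_Ioi, mem_Ioo]
  exact ⟨fun h => ⟨h.1, h.2.2⟩, fun h => ⟨h.1, ha.trans_lt h.1, h.2⟩⟩

theorem IsUniform01.measure_tail {U : Ω → ℝ} (hU : IsUniform01 P U) {a : ℝ} (ha : 0 ≤ a) :
    P {ω | a < U ω} = ENNReal.ofReal (1 - a) := by
  have := hU.setLIntegral_comp (f := fun _ => 1) measurable_const ha
  simpa using this

theorem IsUniform01.measurableSet_tail {U : Ω → ℝ} (hU : IsUniform01 P U) (a : ℝ) :
    MeasurableSet {ω | a < U ω} := measurableSet_lt measurable_const hU.measurable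

/-- Push the measure `k dP` forward along `W` and compare its tails with those of `γ(u) du`;
absolute continuity of the push-forward excludes atoms. -/
theorem IsUniform01.lintegral_mul_comp_le {W : Ω → ℝ} (hW : IsUniform01 P W) {k : Ω → ℝ≥0∞}
    (hk : AEMeasurable k P) {γ : ℝ → ℝ≥0∞} (hγ : Measurable γ)
    (h : ∀ a ∈ Ico (0 : ℝ) 1, ∫⁻ ω in {ω | a < W ω}, k ω ∂P ≤ ∫⁻ u in Ioo a 1, γ u)
    {f : ℝ → ℝ≥0∞} (hf : Monotone f) :
    ∫⁻ ω, k ω * f (W ω) ∂P ≤ ∫⁻ u in Ioo 0 1, γ u * f u := by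
  have hac : (P.withDensity k).map W ≪ volume.restrict (Ioo (0 : ℝ) 1) := by
    rw [← hW.map_eq_Ioo]
    exact (withDensity_absolutelyContinuous _ _).map hW.measurable
  have : NullSingletonClass ((P.withDensity k).map W) := ⟨fun x => hac (measure_singleton x)⟩
  have := lintegral_mono_of_Ioi_le_of_mem_Ico (ν₁ := (P.withDensity k).map W)
    (ν₂ := (volume.restrict (Ioo (0 : ℝ) 1)).withDensity γ)
    (hac (by rw [Measure.restrict_apply measurableSet_Ioo.compl, compl_inter_self, measure_empty]))
    (fun a ha => by
      rw [Measure.map_apply hW.measurable measurableSet_Ioi,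
        withDensity_apply _ (hW.measurable measurableSet_Ioi),
        withDensity_apply _ measurableSet_Ioi, Measure.restrict_restrict measurableSet_Ioi]
      refine (h a ha).trans (le_of_eq ?_)
      congr 2
      ext x; simp only [mem_inter_iff, mem_Ioi, mem_Ioo]
      exact ⟨fun h => ⟨h.1, ha.1.trans_lt h.1, h.2⟩, fun h => ⟨h.1, h.2.2⟩⟩) hf
  rwa [lintegral_map hf.measurable hW.measurable,
    lintegral_withDensity_eq_lintegral_mul₀ hk
      (g := fun ω => f (W ω)) (hf.measurable.comp hW.measurable).aemeasurable,
    lintegral_withDensity_eq_lintegral_mul _ hγ hf.measurable] at this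

/-- Among all sets of measure at most `1 - a`, the integral of a nondecreasing function of a uniform
random variable `V` is largest on `{a < V}`. -/
theorem IsUniform01.setLIntegral_le [IsFiniteMeasure P] {V : Ω → ℝ} (hV : IsUniform01 P V)
    {f : ℝ → ℝ≥0∞} (hf : Monotone f) {A : Set Ω} (hA : MeasurableSet A) {a : ℝ} (ha : 0 ≤ a)
    (hPA : P A ≤ ENNReal.ofReal (1 - a)) :
    ∫⁻ ω in A, f (V ω) ∂P ≤ ∫⁻ u in Ioo a 1, f u := by
  rw [← hV.setLIntegral_comp hf.measurable ha]
  set B := {ω | a < V ω} with hBdef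
  have hB : MeasurableSet B := hV.measurableSet_tail a
  have hPAB : P (A \ B) ≤ P (B \ A) := by
    rw [← hV.measure_tail ha] at hPA
    have h1 := measure_inter_add_sdiff (μ := P) A hB
    have h2 := measure_inter_add_sdiff (μ := P) B hA
    rw [← h1, ← hBdef, ← h2, inter_comm B A] at hPA
    exact (ENNReal.add_le_add_iff_left (measure_ne_top _ _)).1 hPA
  rw [← lintegral_inter_add_sdiff _ A hB, ← lintegral_inter_add_sdiff _ B hA, inter_comm B A]
  -- The common part cancels. On `A \ B` the integrand is at most `f a`, on the at least as large
  -- set `B \ A` it is at least `f a`.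
  gcongr 1
  calc ∫⁻ ω in A \ B, f (V ω) ∂P ≤ ∫⁻ _ in A \ B, f a ∂P :=
        setLIntegral_mono' (hA.diff hB) fun ω hω => hf (not_lt.1 hω.2)
    _ = f a * P (A \ B) := by simp
    _ ≤ f a * P (B \ A) := by gcongr
    _ = ∫⁻ _ in B \ A, f a ∂P := by simp
    _ ≤ ∫⁻ ω in B \ A, f (V ω) ∂P :=
        setLIntegral_mono' (hB.diff hA) fun ω hω => hf (le_of_lt hω.1)

/-- Hardy–Littlewood: among all couplings of two uniform variables the comonotone one maximizes the
expected product of nondecreasing functions. -/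
theorem IsUniform01.lintegral_mul_le [IsFiniteMeasure P] {V W : Ω → ℝ} (hV : IsUniform01 P V)
    (hW : IsUniform01 P W) {f g : ℝ → ℝ≥0∞} (hf : Monotone f) (hg : Monotone g) :
    ∫⁻ ω, f (V ω) * g (W ω) ∂P ≤ ∫⁻ u in Ioo 0 1, f u * g u :=
  hW.lintegral_mul_comp_le (hf.measurable.comp hV.measurable).aemeasurable hf.measurable
    (fun a ha => hV.setLIntegral_le hf (hW.measurableSet_tail a) ha.1 (hW.measure_tail ha.1).le) hg

end Uniform

/-! ### Quantile functions -/

theorem volume_Iic_inter_Icc {t : ℝ} (ht : t ≤ 1) :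
    volume (Iic t ∩ Icc 0 1) = ENNReal.ofReal t := by
  have : Iic t ∩ Icc 0 1 = Icc 0 t := by
    ext x; simp only [mem_inter_iff, mem_Iic, mem_Icc]
    exact ⟨fun h => ⟨h.2.1, h.1⟩, fun h => ⟨h.2, h.1, h.2.trans ht⟩⟩
  rw [this, Real.volume_Icc, sub_zero]

theorem quantileFn_congr {Ω : Type*} [MeasurableSpace Ω] {P : Measure Ω} {f g : Ω → ℝ}
    (h : f =ᵐ[P] g) : quantileFn P f = quantileFn P g := by
  ext t
  unfold quantileFn
  congr 1
  ext x
  have : P {ω | f ω ≤ x} = P {ω | g ω ≤ x} := measure_congr (by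
    filter_upwards [h] with ω hω
    exact propext (by change f ω ≤ x ↔ g ω ≤ x; rw [hω]))
  simp only [mem_ofPred_eq, this]

section Quantile

variable {Ω : Type*} [MeasurableSpace Ω] {P : Measure Ω} [IsProbabilityMeasure P]

theorem measure_le_eq_ofReal_cdf {f : Ω → ℝ} (hf : Measurable f) (x : ℝ) :
    P {ω | f ω ≤ x} = ENNReal.ofReal (ProbabilityTheory.cdf (P.map f) x) := by
  have := Measure.isProbabilityMeasure_map (μ := P) hf.aemeasurable
  rw [ProbabilityTheory.ofReal_cdf, Measure.map_apply hf measurableSet_Iic]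
  rfl

theorem cdf_map_eq_real {f : Ω → ℝ} (hf : Measurable f) (x : ℝ) :
    ProbabilityTheory.cdf (P.map f) x = P.real {ω | f ω ≤ x} := by
  rw [Measure.real, measure_le_eq_ofReal_cdf hf,
    ENNReal.toReal_ofReal (ProbabilityTheory.cdf_nonneg _ _)]

theorem quantileFn_eq {f : Ω → ℝ} (hf : Measurable f) (t : ℝ) :
    quantileFn P f t = sInf {x | t ≤ ProbabilityTheory.cdf (P.map f) x} := by
  unfold quantileFn
  congr 1
  ext x
  simp only [mem_ofPred_eq]
  rw [measure_le_eq_ofReal_cdf hf, ENNReal.ofReal_le_ofReal_iff (ProbabilityTheory.cdf_nonneg _ _)]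

/-- The infimum is attained because the distribution function is right-continuous; `0 < t < 1` makes
the set bounded below and nonempty. -/
theorem quantileFn_le_iff {f : Ω → ℝ} (hf : Measurable f) {t : ℝ} (ht : t ∈ Ioo (0 : ℝ) 1) (x : ℝ) :
    quantileFn P f t ≤ x ↔ t ≤ ProbabilityTheory.cdf (P.map f) x := by
  rw [quantileFn_eq hf]
  set F := ProbabilityTheory.cdf (P.map f)
  set T := {x | t ≤ F x} with hT
  have hne : T.Nonempty :=
    ((ProbabilityTheory.tendsto_cdf_atTop (P.map f)).eventually (le_mem_nhds ht.2)).exists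
  have hbdd : BddBelow T := by
    obtain ⟨b, hb⟩ := ((ProbabilityTheory.tendsto_cdf_atBot (P.map f)).eventually
      (gt_mem_nhds ht.1)).exists
    refine ⟨b, fun y hy => ?_⟩
    by_contra! h
    exact absurd (F.mono h.le) (not_le.2 (lt_of_lt_of_le hb hy))
  have hmem : sInf T ∈ T := by
    have hcont := F.right_continuous (sInf T)
    have h2 : ∀ᶠ y in nhdsWithin (sInf T) (Ioi (sInf T)), t ≤ F y := by
      filter_upwards [self_mem_nhdsWithin] with y hy
      obtain ⟨z, hz, hzy⟩ := exists_lt_of_csInf_lt hne hy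
      exact le_trans hz (F.mono hzy.le)
    exact ge_of_tendsto (hcont.mono_left (nhdsWithin_mono _ Ioi_subset_Ici_self)) h2
  exact ⟨fun h => le_trans hmem (F.mono h), fun h => csInf_le hbdd h⟩

theorem quantileFn_mono {f : Ω → ℝ} (hf : Measurable f) :
    MonotoneOn (quantileFn P f) (Ioo 0 1) := fun _ hs _ ht hst =>
  (quantileFn_le_iff hf hs _).2 (hst.trans ((quantileFn_le_iff hf ht _).1 le_rfl))

/-- An event can be cut to any prescribed smaller probability along a uniform random variable. -/
theorem IsUniform01.exists_measureReal_inter_le_eq {U : Ω → ℝ} (hU : IsUniform01 P U) (A : Set Ω)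
    {s : ℝ} (hs : s ∈ Icc 0 (P.real A)) : ∃ x, P.real (A ∩ {ω | U ω ≤ x}) = s := by
  -- Uniformity of `U` makes the cut probability Lipschitz in the level, so that the intermediate
  -- value theorem applies.
  have hlip : LipschitzWith 1 fun x => P.real (A ∩ {ω | U ω ≤ x}) := by
    refine LipschitzWith.of_le_add fun x y => ?_
    have hsub : A ∩ {ω | U ω ≤ x} ⊆ (A ∩ {ω | U ω ≤ y}) ∪ U ⁻¹' (Ioc y x) := fun ω hω => by
      by_cases h : U ω ≤ y
      · exact Or.inl ⟨hω.1, h⟩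
      · exact Or.inr ⟨not_le.1 h, hω.2⟩
    refine (measureReal_mono hsub).trans ((measureReal_union_le _ _).trans ?_)
    gcongr
    have h1 : P (U ⁻¹' (Ioc y x)) ≤ ENNReal.ofReal (dist x y) := by
      rw [← Measure.map_apply hU.measurable measurableSet_Ioc, hU.map_eq]
      refine (Measure.restrict_apply_le _ _).trans ?_
      rw [Real.volume_Ioc]
      exact ENNReal.ofReal_le_ofReal (le_abs_self _)
    exact ENNReal.toReal_le_of_le_ofReal dist_nonneg h1
  have h0 : P.real (A ∩ {ω | U ω ≤ 0}) = 0 := by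
    rw [measureReal_eq_zero_iff]
    refine measure_mono_null inter_subset_right ?_
    have := hU.ae_mem_Ioo
    rw [ae_iff] at this
    refine measure_mono_null (fun ω hω => ?_) this
    simp only [mem_ofPred_eq, mem_Ioo] at hω ⊢
    exact fun h => absurd h.1 (not_lt.2 hω)
  have h1 : P.real (A ∩ {ω | U ω ≤ 1}) = P.real A := by
    rw [show {ω | U ω ≤ 1} = univ from eq_univ_of_forall fun ω => (hU.mem_Icc ω).2, inter_univ]
  have := intermediate_value_Icc zero_le_one (hlip.continuous.continuousOn (s := Icc 0 1))
  rw [h0, h1] at this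
  obtain ⟨x, -, hx⟩ := this hs
  exact ⟨x, hx⟩

/-- Every real random variable is the quantile transform of a uniform random variable. -/
theorem IsUniform01.exists_eq_quantileFn {U₀ : Ω → ℝ} (hU₀ : IsUniform01 P U₀) {f : Ω → ℝ}
    (hf : Measurable f) :
    ∃ U : Ω → ℝ, IsUniform01 P U ∧ f =ᵐ[P] fun ω => quantileFn P f (U ω) := by
  have hUm := hU₀.measurable
  -- `R ω` below is the rank of `ω` in the lexicographic order of `(f, U₀)`: the variable `U₀`
  -- breaks the ties of `f`, and this makes the rank uniform even if `f` has atoms.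
  set E : Ω → Set Ω := fun ω => {ω' | f ω' < f ω ∨ (f ω' = f ω ∧ U₀ ω' ≤ U₀ ω)} with hE
  have hEm : MeasurableSet {x : Ω × Ω | f x.2 < f x.1 ∨ (f x.2 = f x.1 ∧ U₀ x.2 ≤ U₀ x.1)} := by
    have h1 : Measurable fun x : Ω × Ω => f x.1 := hf.comp measurable_fst
    have h2 : Measurable fun x : Ω × Ω => f x.2 := hf.comp measurable_snd
    refine (measurableSet_lt h2 h1).union (MeasurableSet.inter (measurableSet_eq_fun h2 h1)
      (measurableSet_le (hUm.comp measurable_snd) (hUm.comp measurable_fst)))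
  set R : Ω → ℝ := fun ω => P.real (E ω) with hR
  have hRm : Measurable R := (measurable_measure_prodMk_left hEm).ennreal_toReal
  have hRadd : ∀ ω, R ω = P.real {ω' | f ω' < f ω} +
      P.real ({ω' | f ω' = f ω} ∩ {ω' | U₀ ω' ≤ U₀ ω}) := fun ω => by
    have : E ω = {ω' | f ω' < f ω} ∪ ({ω' | f ω' = f ω} ∩ {ω' | U₀ ω' ≤ U₀ ω}) := rfl
    rw [hR]
    simp only [this]
    refine measureReal_union ?_ ((measurableSet_eq_fun hf measurable_const).inter
      (measurableSet_le hUm measurable_const))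
    exact disjoint_left.2 fun ω' h1 h2 => absurd h2.1 (ne_of_lt h1)
  set F := ProbabilityTheory.cdf (P.map f) with hF
  have hFreal : ∀ x, F x = P.real {ω | f ω ≤ x} := cdf_map_eq_real hf
  have hRle : ∀ ω, R ω ≤ F (f ω) := fun ω => by
    rw [hFreal]
    exact measureReal_mono fun ω' h => h.elim le_of_lt fun h => h.1.le
  -- the rank cuts at every level
  have cut : ∀ t ∈ Ioo (0 : ℝ) 1, P.real {ω | R ω < t} ≤ t ∧ t ≤ P.real {ω | R ω ≤ t} := by
    intro t ht
    set c := quantileFn P f t with hc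
    have hcF : t ≤ F c := (quantileFn_le_iff hf ht _).1 le_rfl
    have hlt : ∀ x < c, F x < t := fun x hx => by
      by_contra! h
      exact absurd ((quantileFn_le_iff hf ht _).2 h) (not_le.2 hx)
    have hsplit : F c = P.real {ω | f ω < c} + P.real {ω | f ω = c} := by
      have hd : Disjoint {ω | f ω < c} {ω | f ω = c} :=
        disjoint_left.2 fun ω' h1 h2 => absurd h2 (ne_of_lt h1)
      rw [hFreal, ← measureReal_union hd (measurableSet_eq_fun hf measurable_const)]
      congr 1; ext ω; simp [le_iff_lt_or_eq]
    have hclt : P.real {ω | f ω < c} ≤ t := by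
      have : P {ω | f ω < c} ≤ ENNReal.ofReal t := by
        have hu : {ω | f ω < c} = ⋃ n : ℕ, {ω | f ω ≤ c - 1 / ((n : ℝ) + 1)} := by
          ext ω
          simp only [mem_ofPred_eq, mem_iUnion]
          constructor
          · intro h
            obtain ⟨n, hn⟩ := exists_nat_one_div_lt (sub_pos.2 h)
            exact ⟨n, by linarith⟩
          · rintro ⟨n, hn⟩
            have : (0 : ℝ) < 1 / ((n : ℝ) + 1) := by positivity
            linarith
        have hm : Monotone fun n : ℕ => {ω | f ω ≤ c - 1 / ((n : ℝ) + 1)} := fun a b hab ω h => by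
          have : 1 / ((b : ℝ) + 1) ≤ 1 / ((a : ℝ) + 1) := by gcongr
          simp only [mem_ofPred_eq] at h ⊢
          linarith
        rw [hu, hm.measure_iUnion]
        refine iSup_le fun n => ?_
        rw [measure_le_eq_ofReal_cdf hf]
        refine ENNReal.ofReal_le_ofReal (hlt _ ?_).le
        have : (0 : ℝ) < 1 / ((n : ℝ) + 1) := by positivity
        linarith
      exact ENNReal.toReal_le_of_le_ofReal ht.1.le this
    -- If `f` has an atom at the quantile `c`, it is cut along `U₀` so that the lexicographic lower
    -- set has probability exactly `t`.
    obtain ⟨x₀, hx₀⟩ := hU₀.exists_measureReal_inter_le_eq {ω | f ω = c}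
      (s := t - P.real {ω | f ω < c}) ⟨by linarith, by linarith⟩
    have hLm : P.real ({ω | f ω < c} ∪ ({ω | f ω = c} ∩ {ω | U₀ ω ≤ x₀})) = t := by
      have hd : Disjoint {ω | f ω < c} ({ω | f ω = c} ∩ {ω | U₀ ω ≤ x₀}) :=
        disjoint_left.2 fun ω' h1 h2 => absurd h2.1 (ne_of_lt h1)
      rw [measureReal_union hd ((measurableSet_eq_fun hf measurable_const).inter
        (measurableSet_le hUm measurable_const)), hx₀]
      ring
    have hReq : ∀ ω, f ω = c → R ω = P.real {ω' | f ω' < c} +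
      P.real ({ω' | f ω' = c} ∩ {ω' | U₀ ω' ≤ U₀ ω}) := fun ω h => by rw [hRadd, h]
    constructor
    · refine (measureReal_mono fun ω hω => ?_).trans hLm.le
      rcases lt_trichotomy (f ω) c with h | h | h
      · exact Or.inl h
      · refine Or.inr ⟨h, ?_⟩
        by_contra! hlt'
        have : P.real ({ω' | f ω' = c} ∩ {ω' | U₀ ω' ≤ x₀}) ≤
            P.real ({ω' | f ω' = c} ∩ {ω' | U₀ ω' ≤ U₀ ω}) :=
          measureReal_mono fun ω' h' =>
            ⟨h'.1, (show U₀ ω' ≤ x₀ from h'.2).trans (le_of_lt (not_le.1 hlt'))⟩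
        have h3 : R ω < t := hω
        rw [hReq ω h] at h3
        linarith
      · exfalso
        have h1 : F c ≤ R ω := by
          rw [hFreal]
          exact measureReal_mono fun ω' h' => Or.inl (lt_of_le_of_lt h' h)
        have h3 : R ω < t := hω
        linarith
    · refine hLm.ge.trans (measureReal_mono fun ω hω => ?_)
      rcases hω with h | h
      · exact (hRle ω).trans (hlt _ h).le
      · change R ω ≤ t
        rw [hReq ω h.1]
        have : P.real ({ω' | f ω' = c} ∩ {ω' | U₀ ω' ≤ U₀ ω}) ≤
            P.real ({ω' | f ω' = c} ∩ {ω' | U₀ ω' ≤ x₀}) :=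
          measureReal_mono fun ω' h' =>
            ⟨h'.1, (show U₀ ω' ≤ U₀ ω from h'.2).trans h.2⟩
        linarith
  have hR01 : ∀ ω, R ω ∈ Icc (0 : ℝ) 1 := fun ω => ⟨measureReal_nonneg, measureReal_le_one⟩
  have hRcdf : ∀ t ∈ Ioo (0 : ℝ) 1, P.real {ω | R ω ≤ t} = t := fun t ht => by
    -- The upper half of `cut` concerns strict inequality, so it is used at levels `s > t`.
    refine le_antisymm (le_of_forall_gt_imp_ge_of_dense fun s hs => ?_) (cut t ht).2
    rcases lt_or_ge s 1 with h | h
    · exact (measureReal_mono fun ω (hω : R ω ≤ t) => hω.trans_lt hs).trans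
        (cut s ⟨ht.1.trans hs, h⟩).1
    · exact measureReal_le_one.trans h
  have hU : IsUniform01 P R := by
    refine ⟨hRm, hR01, ?_⟩
    have := Measure.isProbabilityMeasure_map (μ := P) hRm.aemeasurable
    have : IsFiniteMeasure (volume.restrict (Icc (0 : ℝ) 1)) := inferInstance
    refine Measure.ext_of_Iic _ _ fun t => ?_
    rw [Measure.map_apply hRm measurableSet_Iic, Measure.restrict_apply measurableSet_Iic]
    change P {ω | R ω ≤ t} = _
    have hmid : ∀ t ∈ Ioo (0 : ℝ) 1, P {ω | R ω ≤ t} = ENNReal.ofReal t := fun t ht => by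
      rw [← ofReal_measureReal, hRcdf t ht]
    rcases lt_or_ge t 1 with h1 | h1
    · rcases lt_or_ge 0 t with h0 | h0
      · rw [hmid t ⟨h0, h1⟩, volume_Iic_inter_Icc h1.le]
      · rw [volume_Iic_inter_Icc h1.le,
          ENNReal.ofReal_of_nonpos h0]
        refine le_antisymm (le_of_forall_gt_imp_ge_of_dense fun s hs => ?_) zero_le
        rcases eq_or_ne s ∞ with rfl | hs'
        · exact le_top
        have hs0 : 0 < min s.toReal (1 / 2) :=
          lt_min (ENNReal.toReal_pos hs.ne' hs') (by norm_num)
        calc P {ω | R ω ≤ t} ≤ P {ω | R ω ≤ min s.toReal (1 / 2)} :=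
              measure_mono fun ω (hω : R ω ≤ t) => hω.trans (h0.trans hs0.le)
          _ = ENNReal.ofReal (min s.toReal (1 / 2)) :=
              hmid _ ⟨hs0, (min_le_right _ _).trans_lt (by norm_num)⟩
          _ ≤ ENNReal.ofReal s.toReal := ENNReal.ofReal_le_ofReal (min_le_left _ _)
          _ = s := ENNReal.ofReal_toReal hs'
    · rw [show {ω | R ω ≤ t} = univ from eq_univ_of_forall fun ω => (hR01 ω).2.trans h1,
        measure_univ, inter_eq_right.2 fun x hx => hx.2.trans h1]
      simp
  refine ⟨R, hU, ?_⟩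
  have hq : ∀ᵐ ω ∂P, quantileFn P f (R ω) ≤ f ω := by
    filter_upwards [hU.ae_mem_Ioo] with ω hω
    exact (quantileFn_le_iff hf hω _).2 (hRle ω)
  have hrat : ∀ᵐ ω ∂P, ∀ r : ℚ, quantileFn P f (R ω) ≤ r → f ω ≤ r := by
    rw [ae_all_iff]
    intro r
    -- One of the two events contains the other and both have probability `F r`. Restricting to
    -- rational `r` keeps the exceptional set null.
    have hset : {ω | R ω ≤ F r} =ᵐ[P] {ω | f ω ≤ r} := by
      refine (ae_eq_of_ae_subset_of_measure_ge (?_ : {ω | f ω ≤ r} ≤ᵐ[P] {ω | R ω ≤ F r}) ?_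
        (measurableSet_le hf measurable_const).nullMeasurableSet (measure_ne_top _ _)).symm
      · exact .of_forall fun ω (hω : f ω ≤ r) => (hRle ω).trans (F.mono hω)
      · have hFr0 : 0 ≤ F r := ProbabilityTheory.cdf_nonneg _ _
        have hFr1 : F r ≤ 1 := ProbabilityTheory.cdf_le_one _ _
        rw [measure_le_eq_ofReal_cdf hf]
        change P (R ⁻¹' (Iic (F r))) ≤ ENNReal.ofReal (F r)
        rw [← Measure.map_apply hRm measurableSet_Iic, hU.map_eq,
          Measure.restrict_apply measurableSet_Iic, volume_Iic_inter_Icc hFr1]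
    filter_upwards [hset, hU.ae_mem_Ioo] with ω hω h01 hr
    have h1 : R ω ≤ F r := (quantileFn_le_iff hf h01 _).1 hr
    exact hω.mp h1
  filter_upwards [hq, hrat] with ω h1 h2
  refine le_antisymm (le_of_forall_gt_imp_ge_of_dense fun s hs => ?_) h1
  obtain ⟨r, hr, hrs⟩ := exists_rat_btwn hs
  exact (h2 r hr.le).trans hrs.le

end Quantile

/-! ### A variational construction of level functions -/

section Level

open Filter Topology

variable {m ν : Measure ℝ} {p : ℝ}

/-- The concave functional `h ↦ ∫ h dν - p⁻¹ ∫ h^p dm` whose maximizer is a power of the level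
function of `ν` with respect to `m`. -/
noncomputable def levelFunctional (m ν : Measure ℝ) (p : ℝ) (h : ℝ → ℝ≥0∞) : ℝ :=
  (∫⁻ x, h x ∂ν).toReal - (∫⁻ x, h x ^ p ∂m).toReal / p

/-- The nondecreasing functions with finite `p`-th moment. -/
def LevelClass (m : Measure ℝ) (p : ℝ) (h : ℝ → ℝ≥0∞) : Prop :=
  Monotone h ∧ ∫⁻ x, h x ^ p ∂m ≠ ∞

theorem LevelClass.mono {h k : ℝ → ℝ≥0∞} (hp : 0 ≤ p) (hk : LevelClass m p k) (hh : Monotone h)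
    (hle : h ≤ k) : LevelClass m p h :=
  ⟨hh, ne_top_of_le_ne_top hk.2 (lintegral_mono fun x => ENNReal.rpow_le_rpow (hle x) hp)⟩

theorem LevelClass.inf {h k : ℝ → ℝ≥0∞} (hp : 0 ≤ p) (hh : LevelClass m p h)
    (hk : LevelClass m p k) : LevelClass m p (h ⊓ k) :=
  hh.mono hp (hh.1.inf hk.1) inf_le_left

theorem ENNReal.max_rpow_add_min_rpow (a b : ℝ≥0∞) (p : ℝ) :
    max a b ^ p + min a b ^ p = a ^ p + b ^ p := by
  rcases le_total a b with h | h
  · rw [max_eq_right h, min_eq_left h, add_comm]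
  · rw [max_eq_left h, min_eq_right h]

theorem lintegral_max_rpow_add (p : ℝ) (μ : Measure ℝ) {h k : ℝ → ℝ≥0∞} (hh : Monotone h)
    (hk : Monotone k) : ∫⁻ x, (h ⊔ k) x ^ p ∂μ + ∫⁻ x, (h ⊓ k) x ^ p ∂μ
      = ∫⁻ x, h x ^ p ∂μ + ∫⁻ x, k x ^ p ∂μ := by
  rw [← lintegral_add_left ((hh.sup hk).measurable.pow_const p),
    ← lintegral_add_left (hh.measurable.pow_const p)]
  exact lintegral_congr fun x => ENNReal.max_rpow_add_min_rpow _ _ _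

theorem LevelClass.sup {h k : ℝ → ℝ≥0∞} (hh : LevelClass m p h)
    (hk : LevelClass m p k) : LevelClass m p (h ⊔ k) := by
  refine ⟨hh.1.sup hk.1, ne_top_of_le_ne_top (ENNReal.add_ne_top.2 ⟨hh.2, hk.2⟩) ?_⟩
  rw [← lintegral_max_rpow_add p m hh.1 hk.1]
  exact le_self_add

/-- Pointwise, maximum and minimum merely permute the two values, so both integrals are modular;
finiteness allows the subtraction. -/
theorem levelFunctional_sup_add_inf (hp : 0 ≤ p)
    (hν : ∀ h, LevelClass m p h → ∫⁻ x, h x ∂ν ≠ ∞) {h k : ℝ → ℝ≥0∞} (hh : LevelClass m p h)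
    (hk : LevelClass m p k) :
    levelFunctional m ν p (h ⊔ k) + levelFunctional m ν p (h ⊓ k)
      = levelFunctional m ν p h + levelFunctional m ν p k := by
  have e1 := lintegral_max_rpow_add p m hh.1 hk.1
  have e2 := lintegral_max_rpow_add 1 ν hh.1 hk.1
  simp only [ENNReal.rpow_one] at e2
  have e1' := congrArg ENNReal.toReal e1
  have e2' := congrArg ENNReal.toReal e2
  rw [ENNReal.toReal_add (hh.sup hk).2 (hh.inf hp hk).2, ENNReal.toReal_add hh.2 hk.2] at e1'
  rw [ENNReal.toReal_add (hν _ (hh.sup hk)) (hν _ (hh.inf hp hk)),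
    ENNReal.toReal_add (hν _ hh) (hν _ hk)] at e2'
  unfold levelFunctional
  have : ∀ a b c d : ℝ, a - b / p + (c - d / p) = (a + c) - (b + d) / p := fun a b c d => by ring
  rw [this, this, e1', e2']

/-- Coercivity of the level functional. -/
theorem exists_levelFunctional_le (hp : 1 < p) {C : ℝ≥0∞} (hC : C ≠ ∞)
    (hν : ∀ h, Monotone h → ∫⁻ x, h x ∂ν ≤ C * (∫⁻ x, h x ^ p ∂m) ^ (1 / p)) :
    ∃ D : ℝ, ∀ h, LevelClass m p h →
      levelFunctional m ν p h ≤ D - (∫⁻ x, h x ^ p ∂m).toReal / (2 * p) := by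
  have hp0 : 0 < p := by linarith
  obtain ⟨q, hq⟩ : ∃ q, p.HolderConjugate q := ⟨_, Real.HolderConjugate.conjExponent hp⟩
  -- With `l ^ p = 1 / 2`, Young's inequality spends only half of the term `b / p` and leaves the
  -- other half for coercivity.
  set l : ℝ := (1 / 2) ^ (1 / p) with hl
  have hl0 : 0 < l := by positivity
  have hlp : l ^ p = 1 / 2 := by
    rw [hl, ← Real.rpow_mul (by norm_num), one_div_mul_cancel hp0.ne', Real.rpow_one]
  refine ⟨(C.toReal / l) ^ q / q, fun h hh => ?_⟩
  set b := (∫⁻ x, h x ^ p ∂m).toReal with hb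
  have hb0 : 0 ≤ b := ENNReal.toReal_nonneg
  have h1 : (∫⁻ x, h x ∂ν).toReal ≤ C.toReal * b ^ (1 / p) := by
    rw [hb, ENNReal.toReal_rpow, ← ENNReal.toReal_mul]
    exact ENNReal.toReal_mono (ENNReal.mul_ne_top hC
      (ENNReal.rpow_ne_top_of_nonneg (by positivity) hh.2)) (hν h hh.1)
  have h2 := Real.young_inequality_of_nonneg (a := l * b ^ (1 / p)) (b := C.toReal / l)
    (by positivity) (by positivity) hq
  have h3 : (l * b ^ (1 / p)) ^ p = b / 2 := by
    rw [Real.mul_rpow hl0.le (by positivity), hlp, ← Real.rpow_mul hb0, one_div_mul_cancel hp0.ne',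
      Real.rpow_one]
    ring
  have h4 : l * b ^ (1 / p) * (C.toReal / l) = C.toReal * b ^ (1 / p) := by
    field_simp
  rw [h3, h4] at h2
  have h5 : levelFunctional m ν p h = (∫⁻ x, h x ∂ν).toReal - b / p := rfl
  have h6 : b / p = b / 2 / p + b / (2 * p) := by field_simp; ring
  rw [h5]
  linarith

theorem levelFunctional_tendsto {G : ℕ → ℝ → ℝ≥0∞} {g : ℝ → ℝ≥0∞}
    (h1 : Tendsto (fun n => ∫⁻ x, G n x ∂ν) atTop (𝓝 (∫⁻ x, g x ∂ν)))
    (h2 : Tendsto (fun n => ∫⁻ x, G n x ^ p ∂m) atTop (𝓝 (∫⁻ x, g x ^ p ∂m)))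
    (hg1 : ∫⁻ x, g x ∂ν ≠ ∞) (hg2 : ∫⁻ x, g x ^ p ∂m ≠ ∞) :
    Tendsto (fun n => levelFunctional m ν p (G n)) atTop (𝓝 (levelFunctional m ν p g)) :=
  ((ENNReal.tendsto_toReal hg1).comp h1).sub (((ENNReal.tendsto_toReal hg2).comp h2).div_const p)

/-- The level functional attains its maximum: it is modular on the lattice of nondecreasing
functions, so that the upper limit of a rapidly maximizing sequence is a maximizer. -/
theorem exists_isMax_levelFunctional (hp : 1 < p) {C : ℝ≥0∞} (hC : C ≠ ∞)
    (hν : ∀ h, Monotone h → ∫⁻ x, h x ∂ν ≤ C * (∫⁻ x, h x ^ p ∂m) ^ (1 / p)) :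
    ∃ H, LevelClass m p H ∧
      ∀ h, LevelClass m p h → levelFunctional m ν p h ≤ levelFunctional m ν p H := by
  have hp0 : 0 < p := by linarith
  have hfin : ∀ h, LevelClass m p h → ∫⁻ x, h x ∂ν ≠ ∞ := fun h hh =>
    ne_top_of_le_ne_top (ENNReal.mul_ne_top hC
      (ENNReal.rpow_ne_top_of_nonneg (by positivity) hh.2)) (hν h hh.1)
  obtain ⟨D, hD⟩ := exists_levelFunctional_le hp hC hν
  set J := levelFunctional m ν p with hJ
  set T := J '' {h | LevelClass m p h} with hT
  have hTne : T.Nonempty := ⟨_, mem_image_of_mem J (show LevelClass m p (fun _ => 0) from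
    ⟨monotone_const, by simp [ENNReal.zero_rpow_of_pos hp0]⟩)⟩
  have hTb : BddAbove T := by
    refine ⟨D, ?_⟩
    rintro _ ⟨h, hh, rfl⟩
    have := hD h hh
    have h2 : 0 ≤ (∫⁻ x, h x ^ p ∂m).toReal / (2 * p) := by positivity
    linarith
  set M := sSup T with hM
  have hleM : ∀ h, LevelClass m p h → J h ≤ M := fun h hh => le_csSup hTb (mem_image_of_mem J hh)
  -- The geometric rate makes the losses of all later joins summable.
  have hex : ∀ n : ℕ, ∃ h, LevelClass m p h ∧ M - (1 / 2) ^ n ≤ J h := fun n => by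
    obtain ⟨_, ⟨h, hh, rfl⟩, hlt⟩ := exists_lt_of_lt_csSup hTne
      (show M - (1 / 2) ^ n < M by linarith [show (0 : ℝ) < (1 / 2) ^ n by positivity])
    exact ⟨h, hh, hlt.le⟩
  choose h hK hJh using hex
  -- `G n k` is the join of `h n, …, h (n + k)`.
  let G : ℕ → ℕ → ℝ → ℝ≥0∞ := fun n k => Nat.rec (h n) (fun k g => g ⊔ h (n + k + 1)) k
  have G0 : ∀ n, G n 0 = h n := fun n => rfl
  have Gs : ∀ n k, G n (k + 1) = G n k ⊔ h (n + k + 1) := fun n k => rfl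
  have GK : ∀ n k, LevelClass m p (G n k) := fun n k => by
    induction k with
    | zero => exact hK n
    | succ k ih => exact ih.sup (hK _)
  -- By modularity, and since the meet has value at most `M`, joining `h (n + k + 1)` costs at most
  -- `(1/2)^(n+k+1)`. The extra term on the left makes the induction telescope.
  have GJ : ∀ n k, M - 2 * (1 / 2) ^ n + (1 / 2) ^ (n + k) ≤ J (G n k) := fun n k => by
    induction k with
    | zero => rw [G0, add_zero]; linarith [hJh n]
    | succ k ih =>
      have h1 := levelFunctional_sup_add_inf hp0.le hfin (GK n k) (hK (n + k + 1))
      have h2 := hleM _ ((GK n k).inf hp0.le (hK (n + k + 1)))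
      have h3 := hJh (n + k + 1)
      rw [Gs]
      have h4 : ((1 : ℝ) / 2) ^ (n + k) = 2 * (1 / 2) ^ (n + k + 1) := by rw [pow_succ]; ring
      rw [← add_assoc]
      change J _ + J _ = J _ + J _ at h1
      linarith
  have Gmono : ∀ n, Monotone (G n) := fun n => monotone_nat_of_le_succ fun k => by
    rw [Gs]; exact le_sup_left
  have Gshift : ∀ n k, G (n + 1) k ≤ G n (k + 1) := fun n k => by
    induction k with
    | zero => rw [Gs, G0]; exact le_sup_right
    | succ k ih =>
      rw [Gs, Gs n (k + 1)]
      refine sup_le_sup ih (le_of_eq ?_)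
      congr 1; ring
  let H : ℕ → ℝ → ℝ≥0∞ := fun n x => ⨆ k, G n k x
  have Hm : ∀ n, Monotone (H n) := fun n x y hxy => iSup_mono fun k => (GK n k).1 hxy
  have Hanti : Antitone H := antitone_nat_of_succ_le fun n x =>
    iSup_le fun k => (Gshift n k x).trans (le_iSup (fun k => G n k x) (k + 1))
  have GH : ∀ n x, Tendsto (fun k => G n k x) atTop (𝓝 (H n x)) := fun n x =>
    tendsto_atTop_iSup fun a b hab => Gmono n hab x
  have Gν : ∀ n, Tendsto (fun k => ∫⁻ x, G n k x ∂ν) atTop (𝓝 (∫⁻ x, H n x ∂ν)) := fun n =>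
    lintegral_tendsto_of_tendsto_of_monotone (fun k => (GK n k).1.measurable.aemeasurable)
      (.of_forall fun x a b hab => Gmono n hab x) (.of_forall (GH n))
  have Gm : ∀ n, Tendsto (fun k => ∫⁻ x, G n k x ^ p ∂m) atTop (𝓝 (∫⁻ x, H n x ^ p ∂m)) :=
    fun n => lintegral_tendsto_of_tendsto_of_monotone
      (fun k => ((GK n k).1.measurable.pow_const p).aemeasurable)
      (.of_forall fun x a b hab => ENNReal.rpow_le_rpow (Gmono n hab x) hp0.le)
      (.of_forall fun x => (ENNReal.continuous_rpow_const.tendsto _).comp (GH n x))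
  -- Coercivity bounds the `p`-th moments of `G n k` uniformly in `k`.
  have HK : ∀ n, LevelClass m p (H n) := fun n => by
    refine ⟨Hm n, ne_top_of_le_ne_top
      (ENNReal.ofReal_ne_top (r := 2 * p * (D - (M - 2 * (1 / 2) ^ n)))) ?_⟩
    refine le_of_tendsto' (Gm n) fun k => ?_
    rw [← ENNReal.ofReal_toReal (GK n k).2]
    refine ENNReal.ofReal_le_ofReal ?_
    have h1 := hD _ (GK n k)
    have h2 := GJ n k
    have h3 : (0 : ℝ) < (1 / 2) ^ (n + k) := by positivity
    have h4 : (∫⁻ x, G n k x ^ p ∂m).toReal / (2 * p) ≤ D - (M - 2 * (1 / 2) ^ n) := by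
      change J _ ≤ _ at h1
      linarith
    rw [div_le_iff₀ (by positivity)] at h4
    linarith
  have HJ : ∀ n, M - 2 * (1 / 2) ^ n ≤ J (H n) := fun n => by
    refine ge_of_tendsto' (levelFunctional_tendsto (Gν n) (Gm n) (hfin _ (HK n)) (HK n).2)
      fun k => ?_
    have h3 : (0 : ℝ) < (1 / 2) ^ (n + k) := by positivity
    have := GJ n k
    change _ ≤ J _
    linarith
  -- The upper limit of the sequence `h`; the functional passes to it by monotone convergence, first
  -- upwards in `k`, then downwards in `n`.
  let L : ℝ → ℝ≥0∞ := fun x => ⨅ n, H n x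
  have HL : ∀ x, Tendsto (fun n => H n x) atTop (𝓝 (L x)) := fun x =>
    tendsto_atTop_iInf fun a b hab => Hanti hab x
  have LK : LevelClass m p L :=
    (HK 0).mono hp0.le (fun x y hxy => iInf_mono fun n => Hm n hxy) fun x => iInf_le _ 0
  have Lν : Tendsto (fun n => ∫⁻ x, H n x ∂ν) atTop (𝓝 (∫⁻ x, L x ∂ν)) :=
    lintegral_tendsto_of_tendsto_of_antitone (fun n => (Hm n).measurable.aemeasurable)
      (.of_forall fun x a b hab => Hanti hab x) (hfin _ (HK 0)) (.of_forall HL)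
  have Lm : Tendsto (fun n => ∫⁻ x, H n x ^ p ∂m) atTop (𝓝 (∫⁻ x, L x ^ p ∂m)) :=
    lintegral_tendsto_of_tendsto_of_antitone
      (fun n => ((Hm n).measurable.pow_const p).aemeasurable)
      (.of_forall fun x a b hab => ENNReal.rpow_le_rpow (Hanti hab x) hp0.le) (HK 0).2
      (.of_forall fun x => (ENNReal.continuous_rpow_const.tendsto _).comp (HL x))
  refine ⟨L, LK, fun k hk => (hleM k hk).trans ?_⟩
  have hlim : Tendsto (fun n : ℕ => M - 2 * (1 / 2 : ℝ) ^ n) atTop (𝓝 (M - 2 * 0)) :=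
    tendsto_const_nhds.sub ((tendsto_pow_atTop_nhds_zero_of_lt_one (by norm_num)
      (by norm_num)).const_mul 2)
  rw [mul_zero, sub_zero] at hlim
  exact le_of_tendsto_of_tendsto' hlim
    (levelFunctional_tendsto Lν Lm (hfin _ LK) LK.2) HJ

/-- Convexity: the graph of `x ^ p` lies above its tangent at `a + t`. This is Bernoulli's
inequality for `-t / (a + t)`. -/
theorem Real.add_rpow_le (hp : 1 ≤ p) {a t : ℝ} (ha : 0 ≤ a) (ht : 0 < t) :
    (a + t) ^ p ≤ a ^ p + p * t * (a + t) ^ (p - 1) := by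
  have hat : 0 < a + t := by linarith
  have h := one_add_mul_self_le_rpow_one_add (s := -(t / (a + t)))
    (by rw [neg_le_neg_iff, div_le_one hat]; linarith) hp
  have h1 : 1 + -(t / (a + t)) = a / (a + t) := by field_simp; ring
  rw [h1, Real.div_rpow ha hat.le, le_div_iff₀ (by positivity)] at h
  have h2 : (a + t) ^ p = (a + t) ^ (p - 1) * (a + t) := by
    rw [← Real.rpow_add_one hat.ne', sub_add_cancel]
  have h3 : (1 + p * -(t / (a + t))) * (a + t) ^ p = (a + t) ^ p - p * t * (a + t) ^ (p - 1) := by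
    rw [h2]; field_simp; ring
  linarith

theorem ENNReal.add_rpow_le (hp : 1 ≤ p) (a : ℝ≥0∞) {t : ℝ} (ht : 0 < t) :
    (a + ENNReal.ofReal t) ^ p
      ≤ a ^ p + ENNReal.ofReal (p * t) * (a + ENNReal.ofReal t) ^ (p - 1) := by
  have hp0 : 0 < p := by linarith
  rcases eq_or_ne a ∞ with rfl | ha
  · simp [ENNReal.top_rpow_of_pos hp0]
  have h := Real.add_rpow_le hp (a := a.toReal) ENNReal.toReal_nonneg ht
  have ha0 : 0 ≤ a.toReal := ENNReal.toReal_nonneg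
  have e : a + ENNReal.ofReal t = ENNReal.ofReal (a.toReal + t) := by
    rw [ENNReal.ofReal_add ha0 ht.le, ENNReal.ofReal_toReal ha]
  rw [e, ENNReal.ofReal_rpow_of_pos (by positivity), ENNReal.ofReal_rpow_of_pos (by positivity),
    ← ENNReal.ofReal_mul (by positivity)]
  nth_rw 2 [← ENNReal.ofReal_toReal ha]
  rw [ENNReal.ofReal_rpow_of_nonneg ha0 hp0.le,
    ← ENNReal.ofReal_add (by positivity) (by positivity)]
  exact ENNReal.ofReal_le_ofReal h

theorem LevelClass.add_const [IsFiniteMeasure m] {h : ℝ → ℝ≥0∞} (hp : 1 ≤ p)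
    (hh : LevelClass m p h) {t : ℝ≥0∞} (ht : t ≠ ∞) : LevelClass m p fun x => h x + t := by
  have hp0 : 0 < p := by linarith
  refine ⟨fun x y hxy => by simpa using add_le_add_left (hh.1 hxy) t, ?_⟩
  have h1 : ∫⁻ x, (h x + t) ^ p ∂m
      ≤ ∫⁻ x, 2 ^ (p - 1) * (h x ^ p + t ^ p) ∂m :=
    lintegral_mono fun x => ENNReal.rpow_add_le_mul_rpow_add_rpow _ _ hp
  refine ne_top_of_le_ne_top ?_ h1
  rw [lintegral_const_mul' _ _ (ENNReal.rpow_ne_top_of_nonneg (by linarith) (by simp)),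
    lintegral_add_right _ measurable_const, lintegral_const]
  exact ENNReal.mul_ne_top (ENNReal.rpow_ne_top_of_nonneg (by linarith) (by simp))
    (ENNReal.add_ne_top.2 ⟨hh.2, ENNReal.mul_ne_top (ENNReal.rpow_ne_top_of_nonneg hp0.le ht)
      (measure_ne_top _ _)⟩)

/-- **Level functions.** If `∫ h dν ≤ C (∫ h^p dm)^{1/p}` for all nondecreasing `h ≥ 0`, then the
tails of `ν` are dominated by those of a measure with nondecreasing density `H^{p-1}` with respect
to `m`, whose norm in `L^q(m)` is at most `C`. -/
theorem exists_level [IsFiniteMeasure m] {q : ℝ} (hpq : p.HolderConjugate q) {C : ℝ≥0∞}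
    (hC : C ≠ ∞) (hν : ∀ h, Monotone h → ∫⁻ x, h x ∂ν ≤ C * (∫⁻ x, h x ^ p ∂m) ^ (1 / p)) :
    ∃ H : ℝ → ℝ≥0∞, Monotone H ∧ ∫⁻ x, H x ^ p ∂m ≤ C ^ q ∧
      ∀ a, ν (Ioi a) ≤ ∫⁻ x in Ioi a, H x ^ (p - 1) ∂m := by
  have hp := hpq.lt
  have hp0 : 0 < p := by linarith
  have hfin : ∀ h, LevelClass m p h → ∫⁻ x, h x ∂ν ≠ ∞ := fun h hh =>
    ne_top_of_le_ne_top (ENNReal.mul_ne_top hC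
      (ENNReal.rpow_ne_top_of_nonneg (by positivity) hh.2)) (hν h hh.1)
  obtain ⟨H, HK, hmax⟩ := exists_isMax_levelFunctional hp hC hν
  refine ⟨H, HK.1, ?_, fun a => ?_⟩
  · set A := (∫⁻ x, H x ∂ν).toReal with hA
    set B := (∫⁻ x, H x ^ p ∂m).toReal with hB
    have hA0 : 0 ≤ A := ENNReal.toReal_nonneg
    have hB0 : 0 ≤ B := ENNReal.toReal_nonneg
    have hAB : A ≤ C.toReal * B ^ (1 / p) := by
      rw [hB, ENNReal.toReal_rpow, ← ENNReal.toReal_mul]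
      exact ENNReal.toReal_mono (ENNReal.mul_ne_top hC
        (ENNReal.rpow_ne_top_of_nonneg (by positivity) HK.2)) (hν H HK.1)
    -- Maximality against the multiple `s H`, with Bernoulli's inequality at `1 / s`. Letting `s`
    -- increase to `1` yields `∫ H^p dm ≤ ∫ H dν`.
    have hs : ∀ s ∈ Ioo (0 : ℝ) 1, s ^ (p - 1) * B ≤ A := fun s hs => by
      have hle : (fun x => ENNReal.ofReal s * H x) ≤ H := fun x =>
        mul_le_of_le_one_left zero_le (ENNReal.ofReal_le_one.2 hs.2.le)
      have h1 := hmax _ (HK.mono hp0.le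
        (fun x y hxy => mul_le_mul_right (HK.1 hxy) _) hle)
      unfold levelFunctional at h1
      have e2 : ∫⁻ x, (ENNReal.ofReal s * H x) ^ p ∂m
          = ENNReal.ofReal (s ^ p) * ∫⁻ x, H x ^ p ∂m := by
        rw [← lintegral_const_mul' _ _ ENNReal.ofReal_ne_top]
        refine lintegral_congr fun x => ?_
        rw [ENNReal.mul_rpow_of_nonneg _ _ hp0.le, ENNReal.ofReal_rpow_of_pos hs.1]
      rw [lintegral_const_mul' _ _ ENNReal.ofReal_ne_top, e2, ENNReal.toReal_mul,
        ENNReal.toReal_mul, ENNReal.toReal_ofReal hs.1.le,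
        ENNReal.toReal_ofReal (Real.rpow_nonneg hs.1.le _)] at h1
      change s * A - s ^ p * B / p ≤ A - B / p at h1
      have h2 := one_add_mul_self_le_rpow_one_add (s := 1 / s - 1)
        (by have : 0 < 1 / s := one_div_pos.2 hs.1
            linarith) hp.le
      rw [add_sub_cancel, Real.div_rpow zero_le_one hs.1.le, Real.one_rpow,
        le_div_iff₀ (Real.rpow_pos_of_pos hs.1 _)] at h2
      have h3 : s ^ p = s ^ (p - 1) * s := by
        rw [← Real.rpow_add_one hs.1.ne', sub_add_cancel]
      have h4 : (1 + p * (1 / s - 1)) * s ^ p = s ^ p + p * (1 - s) * s ^ (p - 1) := by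
        have := hs.1.ne'
        rw [h3]; field_simp
      rw [h4] at h2
      have h5 : (1 - s ^ p) * B / p ≤ (1 - s) * A := by
        have : (1 - s ^ p) * B / p = B / p - s ^ p * B / p := by ring
        linarith
      have h6 : (p * (1 - s) * s ^ (p - 1)) * B / p ≤ (1 - s ^ p) * B / p := by
        gcongr; linarith
      have h7 : (p * (1 - s) * s ^ (p - 1)) * B / p = (1 - s) * (s ^ (p - 1) * B) := by
        field_simp
      have h8 : (1 - s) * (s ^ (p - 1) * B) ≤ (1 - s) * A := by linarith
      exact le_of_mul_le_mul_left h8 (by linarith [hs.2])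
    have hBA : B ≤ A := by
      have hc : ContinuousAt (fun s : ℝ => s ^ (p - 1) * B) 1 :=
        (Real.continuousAt_rpow_const 1 (p - 1) (Or.inl one_ne_zero)).mul continuousAt_const
      have hlim : Tendsto (fun s : ℝ => s ^ (p - 1) * B) (𝓝[<] 1) (𝓝 (1 ^ (p - 1) * B)) :=
        hc.tendsto.mono_left nhdsWithin_le_nhds
      rw [Real.one_rpow, one_mul] at hlim
      refine le_of_tendsto hlim ?_
      filter_upwards [Ioo_mem_nhdsLT (zero_lt_one' ℝ)] with s h
      exact hs s h
    -- Now `B ≤ A ≤ C B^{1/p}`, and dividing by `B^{1/p}` leaves `B^{1/q} ≤ C`.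
    have hBC : B ≤ C.toReal ^ q := by
      rcases hB0.eq_or_lt with h | h
      · rw [← h]; positivity
      have h1 : B = B ^ (1 / q) * B ^ (1 / p) := by
        rw [← Real.rpow_add h, one_div, one_div, hpq.symm.inv_add_inv_eq_one, Real.rpow_one]
      have h2 : B ^ (1 / q) ≤ C.toReal := by
        have : B ^ (1 / q) * B ^ (1 / p) ≤ C.toReal * B ^ (1 / p) := by
          rw [← h1]; exact hBA.trans hAB
        exact le_of_mul_le_mul_right this (Real.rpow_pos_of_pos h _)
      calc B = (B ^ (1 / q)) ^ q := by
            rw [← Real.rpow_mul hB0, one_div_mul_cancel hpq.symm.ne_zero, Real.rpow_one]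
        _ ≤ C.toReal ^ q := Real.rpow_le_rpow (by positivity) h2 hpq.symm.nonneg
    rw [← ENNReal.ofReal_toReal HK.2, ← ENNReal.ofReal_toReal hC,
      ENNReal.ofReal_rpow_of_nonneg ENNReal.toReal_nonneg hpq.symm.nonneg]
    exact ENNReal.ofReal_le_ofReal hBC
  · have key : ∀ t : ℝ, 0 < t →
        ν (Ioi a) ≤ ∫⁻ x in Ioi a, (H x + ENNReal.ofReal t) ^ (p - 1) ∂m := fun t ht => by
      -- A step on a half-line keeps `H` nondecreasing, so it is an admissible variation.
      set k : ℝ → ℝ≥0∞ := fun x => H x + (Ioi a).indicator (fun _ => ENNReal.ofReal t) x with hk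
      have hind : Monotone ((Ioi a).indicator fun _ => ENNReal.ofReal t) := fun x y hxy => by
        by_cases hx : x ∈ Ioi a
        · rw [indicator_of_mem hx, indicator_of_mem (show y ∈ Ioi a from lt_of_lt_of_le hx hxy)]
        · rw [indicator_of_notMem hx]; exact zero_le
      have hkm : Monotone k := HK.1.add hind
      have hHt := HK.add_const hp.le (ENNReal.ofReal_ne_top (r := t))
      have hkK : LevelClass m p k := hHt.mono hp0.le hkm fun x => by
        simp only [hk]
        gcongr
        exact indicator_le_self' (fun _ _ => zero_le) x
      have h1 := hmax k hkK
      unfold levelFunctional at h1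
      have hkν : ∫⁻ x, k x ∂ν = ∫⁻ x, H x ∂ν + ENNReal.ofReal t * ν (Ioi a) := by
        simp only [hk]
        rw [lintegral_add_left HK.1.measurable, lintegral_indicator measurableSet_Ioi,
          lintegral_const, Measure.restrict_apply_univ]
      have hkm' : ∫⁻ x, k x ^ p ∂m ≤ ∫⁻ x, H x ^ p ∂m + ENNReal.ofReal (p * t) *
          ∫⁻ x in Ioi a, (H x + ENNReal.ofReal t) ^ (p - 1) ∂m := by
        rw [← lintegral_const_mul' _ _ ENNReal.ofReal_ne_top, ← lintegral_indicator measurableSet_Ioi,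
          ← lintegral_add_left (HK.1.measurable.pow_const p)]
        refine lintegral_mono fun x => ?_
        by_cases hx : x ∈ Ioi a
        · simp only [hk, indicator_of_mem hx]
          exact ENNReal.add_rpow_le hp.le _ ht
        · simp only [hk, indicator_of_notMem hx, add_zero]; exact le_rfl
      set I := ∫⁻ x in Ioi a, (H x + ENNReal.ofReal t) ^ (p - 1) ∂m with hI
      rcases eq_or_ne I ∞ with hItop | hItop
      · rw [hItop]; exact le_top
      have hνa : ν (Ioi a) ≠ ∞ := by
        intro h
        have := hfin k hkK
        rw [hkν, h, ENNReal.mul_top (by simpa using ht)] at this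
        simp at this
      have h2 := ENNReal.toReal_mono (ENNReal.add_ne_top.2 ⟨HK.2,
        ENNReal.mul_ne_top ENNReal.ofReal_ne_top hItop⟩) hkm'
      rw [ENNReal.toReal_add HK.2 (ENNReal.mul_ne_top ENNReal.ofReal_ne_top hItop),
        ENNReal.toReal_mul, ENNReal.toReal_ofReal (by positivity)] at h2
      rw [hkν, ENNReal.toReal_add (hfin H HK) (ENNReal.mul_ne_top ENNReal.ofReal_ne_top hνa),
        ENNReal.toReal_mul, ENNReal.toReal_ofReal ht.le] at h1
      rw [← ENNReal.toReal_le_toReal hνa hItop]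
      have h3 : (∫⁻ x, k x ^ p ∂m).toReal / p
          ≤ ((∫⁻ x, H x ^ p ∂m).toReal + p * t * I.toReal) / p := by gcongr
      have h4 : ((∫⁻ x, H x ^ p ∂m).toReal + p * t * I.toReal) / p
          = (∫⁻ x, H x ^ p ∂m).toReal / p + t * I.toReal := by field_simp
      have h5 : t * (ν (Ioi a)).toReal ≤ t * I.toReal := by linarith
      exact le_of_mul_le_mul_left h5 ht
    have hpos : ∀ n : ℕ, (0 : ℝ) < 1 / ((n : ℝ) + 1) := fun n => by positivity
    have hmon : ∀ x, Antitone fun n : ℕ => (H x + ENNReal.ofReal (1 / ((n : ℝ) + 1))) ^ (p - 1) :=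
      fun x b c hbc => ENNReal.rpow_le_rpow (by gcongr) (by linarith)
    have hlim : Tendsto (fun n : ℕ =>
        ∫⁻ x in Ioi a, (H x + ENNReal.ofReal (1 / ((n : ℝ) + 1))) ^ (p - 1) ∂m) atTop
        (𝓝 (∫⁻ x in Ioi a, H x ^ (p - 1) ∂m)) := by
      refine lintegral_tendsto_of_tendsto_of_antitone
        (fun n => ((HK.1.measurable.add_const _).pow_const _).aemeasurable) (.of_forall hmon) ?_
        (.of_forall fun x => ?_)
      -- At index `0` the shift is `1`; the base is then at least `1`, and the exponent may be
      -- raised from `p - 1` to `p`.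
      · have h1 := (HK.add_const hp.le ENNReal.one_ne_top).2
        refine ne_top_of_le_ne_top h1 ((setLIntegral_le_lintegral _ _).trans
          (lintegral_mono fun x => ?_))
        simp only [Nat.cast_zero, zero_add, div_one, ENNReal.ofReal_one]
        exact ENNReal.rpow_le_rpow_of_exponent_le le_add_self (by linarith)
      · have h1 : Tendsto (fun n : ℕ => ENNReal.ofReal (1 / ((n : ℝ) + 1))) atTop (𝓝 0) := by
          rw [← ENNReal.ofReal_zero]
          exact ENNReal.tendsto_ofReal tendsto_one_div_add_atTop_nhds_zero_nat
        have h2 := (tendsto_const_nhds (x := H x)).add h1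
        rw [add_zero] at h2
        exact (ENNReal.continuous_rpow_const.tendsto _).comp h2
    exact ge_of_tendsto' hlim fun n => key _ (hpos n)

end Level

/-! ### Rearrangement formulas for `‖·‖_{σ,p}` and the average value-at-risk -/

section MonoExt

/-- The extension of a nondecreasing function on `(0,1)` to a nondecreasing `[0,∞]`-valued function
on the real line. -/
noncomputable def monoExt (φ : ℝ → ℝ) (u : ℝ) : ℝ≥0∞ :=
  if u ≤ 0 then 0 else if u < 1 then ENNReal.ofReal (φ u) else ∞

theorem monoExt_of_mem (φ : ℝ → ℝ) {u : ℝ} (hu : u ∈ Ioo (0 : ℝ) 1) :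
    monoExt φ u = ENNReal.ofReal (φ u) := by
  rw [monoExt, if_neg (not_le.2 hu.1), if_pos hu.2]

theorem monotone_monoExt {φ : ℝ → ℝ} (hφ : MonotoneOn φ (Ioo 0 1)) : Monotone (monoExt φ) := by
  intro x y hxy
  rcases le_or_gt x 0 with hx | hx
  · simp [monoExt, hx]
  rcases lt_or_ge y 1 with hy | hy
  · have hx' : x ∈ Ioo (0 : ℝ) 1 := ⟨hx, hxy.trans_lt hy⟩
    have hy' : y ∈ Ioo (0 : ℝ) 1 := ⟨hx.trans_le hxy, hy⟩
    rw [monoExt_of_mem φ hx', monoExt_of_mem φ hy']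
    exact ENNReal.ofReal_le_ofReal (hφ hx' hy' hxy)
  · simp [monoExt, not_le.2 (hx.trans_le hxy), not_lt.2 hy]

theorem setLIntegral_monoExt (φ : ℝ → ℝ) {a : ℝ} (ha : 0 ≤ a) :
    ∫⁻ u in Ioo a 1, monoExt φ u = ∫⁻ u in Ioo a 1, ENNReal.ofReal (φ u) :=
  setLIntegral_congr_fun measurableSet_Ioo fun _ hu => monoExt_of_mem φ ⟨ha.trans_lt hu.1, hu.2⟩

end MonoExt

/-! ### Tail integrals of distortion functions -/

namespace DistortionFunction

variable (σ : DistortionFunction)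

/-- The extension of a distortion function to a nondecreasing function on the real line. -/
noncomputable def ext : ℝ → ℝ≥0∞ := monoExt σ

theorem ext_monotone : Monotone σ.ext := monotone_monoExt (σ.mono.mono Ioo_subset_Ico_self)

theorem S_eq {a : ℝ} (ha : 0 ≤ a) : σ.S a = ∫⁻ u in Ioo a 1, σ.ext u :=
  (setLIntegral_monoExt σ ha).symm

theorem lintegral_ext : ∫⁻ u in Ioo 0 1, σ.ext u = 1 := by
  rw [ext, setLIntegral_monoExt σ le_rfl, ← σ.lintegral_eq_one, restrict_Ioo_eq_restrict_Ico]

theorem S_le_one {a : ℝ} (ha : 0 ≤ a) : σ.S a ≤ 1 := by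
  rw [S_eq σ ha, ← σ.lintegral_ext]
  exact lintegral_mono_set (Ioo_subset_Ioo_left ha)

/-- The average of a nondecreasing function over `(a,1)` is at least its average over `(0,1)`, which
is one. If `σ` is at least `1` at `a` this is seen on `(a,1)` directly, otherwise from the
complement `(0,a]`. -/
theorem one_sub_le_S {a : ℝ} (ha : a ∈ Ico (0 : ℝ) 1) : ENNReal.ofReal (1 - a) ≤ σ.S a := by
  rw [S_eq σ ha.1]
  have hvol : ∀ c : ℝ≥0∞, ∫⁻ _ in Ioo a 1, c = c * ENNReal.ofReal (1 - a) := fun c => by simp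
  rcases le_total 1 (σ.ext a) with h | h
  · calc ENNReal.ofReal (1 - a) = ∫⁻ _ in Ioo a 1, 1 := by rw [hvol, one_mul]
      _ ≤ ∫⁻ u in Ioo a 1, σ.ext u :=
        setLIntegral_mono' measurableSet_Ioo fun u hu => h.trans (σ.ext_monotone hu.1.le)
  · have hsplit : (∫⁻ u in Ioc 0 a, σ.ext u) + ∫⁻ u in Ioo a 1, σ.ext u = 1 := by
      have hd : Disjoint (Ioc 0 a) (Ioo a 1) :=
        disjoint_left.2 fun x h1 h2 => absurd h2.1 (not_lt.2 h1.2)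
      rw [← lintegral_union measurableSet_Ioo hd, Ioc_union_Ioo_eq_Ioo ha.1 ha.2, σ.lintegral_ext]
    have hle : ∫⁻ u in Ioc 0 a, σ.ext u ≤ ENNReal.ofReal a := by
      calc ∫⁻ u in Ioc 0 a, σ.ext u ≤ ∫⁻ _ in Ioc 0 a, 1 :=
            setLIntegral_mono' measurableSet_Ioc fun u hu => (σ.ext_monotone hu.2).trans h
        _ = ENNReal.ofReal a := by simp
    have h1 : ENNReal.ofReal a + ENNReal.ofReal (1 - a)
        ≤ ENNReal.ofReal a + ∫⁻ u in Ioo a 1, σ.ext u := by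
      rw [← ENNReal.ofReal_add ha.1 (by linarith [ha.2]), add_sub_cancel, ENNReal.ofReal_one,
        ← hsplit]
      exact add_le_add_left hle _
    exact (ENNReal.add_le_add_iff_left ENNReal.ofReal_ne_top).1 h1

theorem S_pos {a : ℝ} (ha : a ∈ Ico (0 : ℝ) 1) : 0 < σ.S a :=
  (ENNReal.ofReal_pos.2 (by linarith [ha.2])).trans_le (σ.one_sub_le_S ha)

/-- The probability measure `σ(u) du` on `(0,1)`. -/
noncomputable def measure : Measure ℝ := (volume.restrict (Ioo (0 : ℝ) 1)).withDensity σ.ext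

instance : IsProbabilityMeasure σ.measure :=
  ⟨by rw [measure, withDensity_apply _ MeasurableSet.univ, setLIntegral_univ, σ.lintegral_ext]⟩

theorem lintegral_measure {f : ℝ → ℝ≥0∞} (hf : Measurable f) :
    ∫⁻ u, f u ∂σ.measure = ∫⁻ u in Ioo 0 1, σ.ext u * f u :=
  lintegral_withDensity_eq_lintegral_mul _ σ.ext_monotone.measurable hf

theorem setLIntegral_measure_Ioi {f : ℝ → ℝ≥0∞} (hf : Measurable f) {a : ℝ} (ha : 0 ≤ a) :
    ∫⁻ u in Ioi a, f u ∂σ.measure = ∫⁻ u in Ioo a 1, σ.ext u * f u := by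
  rw [measure, restrict_withDensity measurableSet_Ioi,
    lintegral_withDensity_eq_lintegral_mul _ σ.ext_monotone.measurable hf,
    Measure.restrict_restrict measurableSet_Ioi]
  have : Ioi a ∩ Ioo 0 1 = Ioo a 1 := by
    ext x; simp only [mem_inter_iff, mem_Ioi, mem_Ioo]
    exact ⟨fun h => ⟨h.1, h.2.2⟩, fun h => ⟨h.1, ha.trans_lt h.1, h.2⟩⟩
  rw [this]
  rfl

end DistortionFunction

section Rearrangement

variable {Ω : Type*} [MeasurableSpace Ω] {P : Measure Ω} {σ : DistortionFunction} {p : ℝ}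
  {E : Type*} [NormedAddCommGroup E]

theorem IsUniform01.ae_weight_eq {U : Ω → ℝ} (hU : IsUniform01 P U) (σ : DistortionFunction) :
    ∀ᵐ ω ∂P, ENNReal.ofReal (σ (U ω)) = σ.ext (U ω) := by
  filter_upwards [hU.ae_mem_Ioo] with ω hω
  exact (monoExt_of_mem σ hω).symm

theorem IsUniform01.lintegral_weight_mul {U : Ω → ℝ} (hU : IsUniform01 P U)
    (σ : DistortionFunction) (f : Ω → ℝ≥0∞) :
    ∫⁻ ω, ENNReal.ofReal (σ (U ω)) * f ω ∂P = ∫⁻ ω, σ.ext (U ω) * f ω ∂P := by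
  refine lintegral_congr_ae ?_
  filter_upwards [hU.ae_weight_eq σ] with ω hω
  rw [hω]

theorem lintegral_weight_le_sigmaNorm (hp : 0 < p) {U : Ω → ℝ} (hU : IsUniform01 P U) (Y : Ω → E) :
    (∫⁻ ω, σ.ext (U ω) * ‖Y ω‖ₑ ^ p ∂P) ^ (1 / p) ≤ sigmaNorm σ p P Y := by
  rw [← hU.lintegral_weight_mul σ]
  exact ENNReal.rpow_le_rpow
      (le_iSup₂ (f := fun (U : Ω → ℝ) (_ : IsUniform01 P U) =>
        ∫⁻ ω, ENNReal.ofReal (σ (U ω)) * ‖Y ω‖ₑ ^ p ∂P) U hU) (by positivity)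

theorem sigmaNorm_le_iff (hp : 0 < p) {Y : Ω → E} {C : ℝ≥0∞} :
    sigmaNorm σ p P Y ≤ C ↔
      ∀ U, IsUniform01 P U → ∫⁻ ω, σ.ext (U ω) * ‖Y ω‖ₑ ^ p ∂P ≤ C ^ p := by
  rw [sigmaNorm, one_div, ENNReal.rpow_inv_le_iff hp, iSup₂_le_iff]
  exact forall₂_congr fun U hU => by rw [hU.lintegral_weight_mul σ]

theorem sigmaNorm_mono {F : Type*} [NormedAddCommGroup F] (hp : 0 < p) {Y : Ω → E} {Y' : Ω → F}
    (h : ∀ᵐ ω ∂P, ‖Y ω‖ₑ ≤ ‖Y' ω‖ₑ) : sigmaNorm σ p P Y ≤ sigmaNorm σ p P Y' := by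
  refine ENNReal.rpow_le_rpow (iSup₂_mono fun U hU => lintegral_mono_ae ?_) (by positivity)
  filter_upwards [h] with ω hω
  exact mul_le_mul_right (ENNReal.rpow_le_rpow hω hp.le) _

/-- The supremum defining `‖Y‖_{σ,p}` is attained at a uniform random variable that is comonotone
with `‖Y‖`. -/
theorem sigmaNorm_eq_of_comonotone [IsFiniteMeasure P] (hp : 0 < p) {V : Ω → ℝ}
    (hV : IsUniform01 P V) {h : ℝ → ℝ≥0∞} (hh : Monotone h) {Y : Ω → E}
    (hY : ∀ᵐ ω ∂P, ‖Y ω‖ₑ = h (V ω)) :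
    sigmaNorm σ p P Y = (∫⁻ u in Ioo 0 1, σ.ext u * h u ^ p) ^ (1 / p) := by
  have hhp : Monotone fun u => h u ^ p := fun x y hxy => ENNReal.rpow_le_rpow (hh hxy) hp.le
  have e : ∀ U : Ω → ℝ, ∫⁻ ω, σ.ext (U ω) * ‖Y ω‖ₑ ^ p ∂P = ∫⁻ ω, σ.ext (U ω) * h (V ω) ^ p ∂P :=
    fun U => lintegral_congr_ae (by filter_upwards [hY] with ω hω; rw [hω])
  refine le_antisymm ?_ ?_
  · rw [sigmaNorm_le_iff hp]
    intro U hU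
    rw [e, ← ENNReal.rpow_mul, one_div_mul_cancel hp.ne', ENNReal.rpow_one]
    exact hU.lintegral_mul_le hV σ.ext_monotone hhp
  · refine le_trans (le_of_eq ?_) (lintegral_weight_le_sigmaNorm hp hV Y)
    rw [e, hV.lintegral_comp (f := fun u => σ.ext u * h u ^ p)
      (σ.ext_monotone.measurable.mul hhp.measurable)]

theorem avar_le_avar_iff {f g : Ω → ℝ} {a : ℝ} (ha : a < 1) :
    avar P f a ≤ avar P g a ↔ ∫⁻ u in Ioo a 1, ENNReal.ofReal (quantileFn P f u)
      ≤ ∫⁻ u in Ioo a 1, ENNReal.ofReal (quantileFn P g u) := by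
  have h1 : ENNReal.ofReal (1 - a) ≠ 0 := (ENNReal.ofReal_pos.2 (by linarith)).ne'
  refine ⟨fun h => ?_, fun h => ENNReal.div_le_div_right h _⟩
  have := mul_le_mul_left h (ENNReal.ofReal (1 - a))
  rwa [avar, avar, ENNReal.div_mul_cancel h1 ENNReal.ofReal_ne_top,
    ENNReal.div_mul_cancel h1 ENNReal.ofReal_ne_top] at this

variable [IsProbabilityMeasure P]

theorem monotone_monoExt_quantileFn {f : Ω → ℝ} (hf : AEMeasurable f P) :
    Monotone (monoExt (quantileFn P f)) := by
  rw [quantileFn_congr hf.ae_eq_mk]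
  exact monotone_monoExt (quantileFn_mono hf.measurable_mk)

/-- Every nonnegative random variable is comonotone with some uniform one. -/
theorem exists_comonotone (hP : ∃ U : Ω → ℝ, IsUniform01 P U) {f : Ω → ℝ} (hf : AEMeasurable f P) :
    ∃ V : Ω → ℝ, IsUniform01 P V ∧
      ∀ᵐ ω ∂P, ENNReal.ofReal (f ω) = monoExt (quantileFn P f) (V ω) := by
  obtain ⟨U₀, hU₀⟩ := hP
  obtain ⟨V, hV, h⟩ := hU₀.exists_eq_quantileFn hf.measurable_mk
  refine ⟨V, hV, ?_⟩
  filter_upwards [hV.ae_mem_Ioo, h, hf.ae_eq_mk] with ω h1 h2 h3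
  rw [quantileFn_congr hf.ae_eq_mk, monoExt_of_mem _ h1, h3, h2]

theorem exists_comonotone_enorm (hP : ∃ U : Ω → ℝ, IsUniform01 P U) {Y : Ω → E}
    (hY : AEStronglyMeasurable Y P) :
    ∃ V : Ω → ℝ, IsUniform01 P V ∧ ∃ h : ℝ → ℝ≥0∞, Monotone h ∧ ∀ᵐ ω ∂P, ‖Y ω‖ₑ = h (V ω) := by
  obtain ⟨V, hV, h⟩ := exists_comonotone hP hY.norm.aemeasurable
  refine ⟨V, hV, _, monotone_monoExt_quantileFn hY.norm.aemeasurable, ?_⟩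
  filter_upwards [h] with ω hω
  rw [← hω, ofReal_norm]

/-- The unnormalized average value-at-risk dominates integrals over small sets. -/
theorem setLIntegral_le_tail_quantileFn (hP : ∃ U : Ω → ℝ, IsUniform01 P U) {f : Ω → ℝ}
    (hf : AEMeasurable f P) {A : Set Ω} (hA : MeasurableSet A) {a : ℝ} (ha : 0 ≤ a)
    (hPA : P A ≤ ENNReal.ofReal (1 - a)) :
    ∫⁻ ω in A, ENNReal.ofReal (f ω) ∂P ≤ ∫⁻ u in Ioo a 1, ENNReal.ofReal (quantileFn P f u) := by
  obtain ⟨V, hV, h⟩ := exists_comonotone hP hf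
  rw [← setLIntegral_monoExt _ ha, lintegral_congr_ae (ae_restrict_of_ae h)]
  exact hV.setLIntegral_le (monotone_monoExt_quantileFn hf) hA ha hPA

/-- Hölder's inequality with a weight. -/
theorem lintegral_weight_mul_le {α : Type*} [MeasurableSpace α] (μ : Measure α) {p q : ℝ}
    (hpq : p.HolderConjugate q) {w f g : α → ℝ≥0∞} (hw : AEMeasurable w μ)
    (hf : AEMeasurable f μ) (hg : AEMeasurable g μ) :
    ∫⁻ x, w x * (f x * g x) ∂μ
      ≤ (∫⁻ x, w x * f x ^ p ∂μ) ^ (1 / p) * (∫⁻ x, w x * g x ^ q ∂μ) ^ (1 / q) := by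
  have root : ∀ {r : ℝ}, 0 < r → ∀ (w x : ℝ≥0∞), w * x ^ r = (w ^ (1 / r) * x) ^ r :=
    fun {r} hr w x => by
      rw [ENNReal.mul_rpow_of_nonneg _ _ hr.le, ← ENNReal.rpow_mul, one_div_mul_cancel hr.ne',
        ENNReal.rpow_one]
  have e : ∀ x, w x * (f x * g x) = (w x ^ (1 / p) * f x) * (w x ^ (1 / q) * g x) := fun x => by
    have : w x = w x ^ (1 / p) * w x ^ (1 / q) := by
      rw [← ENNReal.rpow_add_of_nonneg _ _ hpq.one_div_nonneg hpq.symm.one_div_nonneg, one_div,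
        one_div, hpq.inv_add_inv_eq_one, ENNReal.rpow_one]
    nth_rw 1 [this]
    ring
  simp_rw [e, root hpq.pos, root hpq.symm.pos]
  exact ENNReal.lintegral_mul_le_Lp_mul_Lq μ hpq ((hw.pow_const _).mul hf) ((hw.pow_const _).mul hg)

end Rearrangement

/-! ### Hölder's inequality and its converse for `|·|_{σ,q}^*` -/

section ScalarDuality

open Filter Topology

variable {Ω : Type*} [MeasurableSpace Ω] {P : Measure Ω}
  {σ : DistortionFunction} {p : ℝ} {q : ℝ≥0∞} {E : Type*} [NormedAddCommGroup E]

theorem IsUniform01.aemeasurable_distortion {U : Ω → ℝ} (hU : IsUniform01 P U)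
    (σ : DistortionFunction) : AEMeasurable (fun ω => σ (U ω)) P := by
  have h : AEMeasurable σ.toFun (P.map U) := by
    rw [hU.map_eq, ← restrict_Ico_eq_restrict_Icc]
    exact aemeasurable_restrict_of_monotoneOn measurableSet_Ico σ.mono
  exact h.comp_measurable hU.measurable

theorem IsUniform01.ae_weight_mul_eq {U : Ω → ℝ} (hU : IsUniform01 P U) (σ : DistortionFunction)
    (f : Ω → ℝ) :
    ∀ᵐ ω ∂P, ENNReal.ofReal (σ (U ω) * |f ω|) = σ.ext (U ω) * ‖f ω‖ₑ := by
  filter_upwards [hU.ae_mem_Ioo, hU.ae_weight_eq σ] with ω h1 h2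
  rw [ENNReal.ofReal_mul (σ.nonneg _ (Ioo_subset_Ico_self h1)), h2, Real.enorm_eq_ofReal_abs]

variable [IsProbabilityMeasure P]

/-- The mean is dominated by `‖·‖_{σ,p}`. -/
theorem lintegral_enorm_le_sigmaNorm (hP : ∃ U : Ω → ℝ, IsUniform01 P U) (hp : 1 ≤ p) {Y : Ω → E}
    (hY : AEStronglyMeasurable Y P) : ∫⁻ ω, ‖Y ω‖ₑ ∂P ≤ sigmaNorm σ p P Y := by
  have hp0 : 0 < p := by linarith
  obtain ⟨V, hV, h, hh, hYh⟩ := exists_comonotone_enorm hP hY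
  rw [sigmaNorm_eq_of_comonotone hp0 hV hh hYh, lintegral_congr_ae hYh]
  -- The tails of `σ(u) du` dominate those of Lebesgue measure, and `h` is nondecreasing.
  have h1 : ∫⁻ ω, h (V ω) ∂P ≤ ∫⁻ u in Ioo 0 1, σ.ext u * h u := by
    have := hV.lintegral_mul_comp_le (k := fun _ => 1) aemeasurable_const
      σ.ext_monotone.measurable (fun a ha => by
        rw [lintegral_const, one_mul, Measure.restrict_apply_univ, hV.measure_tail ha.1,
          ← σ.S_eq ha.1]
        exact σ.one_sub_le_S ha) hh
    simpa using this
  refine h1.trans ?_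
  rcases hp.eq_or_lt with rfl | hp1
  · simp
  -- Jensen's inequality for the probability density `σ`, as Hölder's inequality against the
  -- constant `1`.
  · have := lintegral_weight_mul_le (volume.restrict (Ioo (0 : ℝ) 1))
      (Real.HolderConjugate.conjExponent hp1) (w := σ.ext) (f := h) (g := fun _ => 1)
      σ.ext_monotone.measurable.aemeasurable hh.measurable.aemeasurable aemeasurable_const
    simpa [σ.lintegral_ext] using this

/-- **Hölder's inequality** for `‖·‖_{σ,p}` and `|·|_{σ,q}^*`. -/
theorem lintegral_mul_le_sigmaStarNorm_mul (hP : ∃ U : Ω → ℝ, IsUniform01 P U) (hp : 1 ≤ p)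
    (hpq : ENNReal.HolderConjugate (ENNReal.ofReal p) q) {g : Ω → ℝ} (hg : AEMeasurable g P)
    {Y : Ω → E} (hY : AEStronglyMeasurable Y P) (hY' : sigmaNorm σ p P Y ≠ ∞) :
    ∫⁻ ω, ‖g ω‖ₑ * ‖Y ω‖ₑ ∂P ≤ sigmaStarNorm σ q P g * sigmaNorm σ p P Y := by
  have hp0 : 0 < p := by linarith
  obtain ⟨W, hW, h, hh, hYh⟩ := exists_comonotone_enorm hP hY
  have hgm : AEMeasurable (fun ω => ‖g ω‖ₑ) P := hg.enorm
  have hga : AEMeasurable (fun ω => |g ω|) P := hg.norm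
  have e1 : ∫⁻ ω, ‖g ω‖ₑ * ‖Y ω‖ₑ ∂P = ∫⁻ ω, ‖g ω‖ₑ * h (W ω) ∂P :=
    lintegral_congr_ae (by filter_upwards [hYh] with ω hω; rw [hω])
  have tail : ∀ a ∈ Ico (0 : ℝ) 1, ∫⁻ ω in {ω | a < W ω}, ‖g ω‖ₑ ∂P
      ≤ ∫⁻ u in Ioo a 1, ENNReal.ofReal (quantileFn P (fun ω => |g ω|) u) := fun a ha => by
    simp only [Real.enorm_eq_ofReal_abs]
    exact setLIntegral_le_tail_quantileFn hP hga (hW.measurableSet_tail a) ha.1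
      (hW.measure_tail ha.1).le
  have hYeq := sigmaNorm_eq_of_comonotone (σ := σ) hp0 hW hh hYh
  rw [e1]
  unfold sigmaStarNorm
  split_ifs with hq
  · have hp1 : p = 1 := by
      have := (ENNReal.HolderConjugate.eq_top_iff_eq_one q (ENNReal.ofReal p)).1 hq
      simpa using this
    subst hp1
    set C := ⨆ α ∈ Ico (0 : ℝ) 1, avar P (fun ω => |g ω|) α / (σ.S α / ENNReal.ofReal (1 - α))
      with hC
    have hCa : ∀ a ∈ Ico (0 : ℝ) 1,
        ∫⁻ u in Ioo a 1, ENNReal.ofReal (quantileFn P (fun ω => |g ω|) u) ≤ C * σ.S a := by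
      intro a ha
      have hd : ENNReal.ofReal (1 - a) ≠ 0 := (ENNReal.ofReal_pos.2 (by linarith [ha.2])).ne'
      have hS0 := (σ.S_pos ha).ne'
      have hS1 : σ.S a ≠ ∞ := ne_top_of_le_ne_top ENNReal.one_ne_top (σ.S_le_one ha.1)
      have h1 : avar P (fun ω => |g ω|) a / (σ.S a / ENNReal.ofReal (1 - a)) ≤ C :=
        le_iSup₂ (f := fun α (_ : α ∈ Ico (0 : ℝ) 1) =>
          avar P (fun ω => |g ω|) α / (σ.S α / ENNReal.ofReal (1 - α))) a ha
      rw [ENNReal.div_le_iff (ENNReal.div_ne_zero.2 ⟨hS0, ENNReal.ofReal_ne_top⟩)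
        (ENNReal.div_ne_top hS1 hd), avar, ← mul_div_assoc,
        ENNReal.div_le_iff hd ENNReal.ofReal_ne_top,
        ENNReal.div_mul_cancel hd ENNReal.ofReal_ne_top] at h1
      exact h1
    -- For `q = ∞` the star norm `C` says precisely that the tails of the quantile function of `|g|`
    -- are at most those of `C σ`.
    have := hW.lintegral_mul_comp_le hgm (γ := fun u => C * σ.ext u)
      (σ.ext_monotone.measurable.const_mul C) (fun a ha => by
        rw [lintegral_const_mul _ σ.ext_monotone.measurable, ← σ.S_eq ha.1]
        exact (tail a ha).trans (hCa a ha)) hh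
    refine this.trans (le_of_eq ?_)
    rw [hYeq]
    simp only [mul_assoc, ENNReal.rpow_one, one_div_one]
    exact lintegral_const_mul _ (σ.ext_monotone.measurable.mul hh.measurable)
  · have hconj : p.HolderConjugate q.toReal := by
      have := ENNReal.HolderConjugate.toReal_of_ne_top (p := ENNReal.ofReal p) (q := q)
        ENNReal.ofReal_ne_top hq
      rwa [ENNReal.toReal_ofReal hp0.le] at this
    -- The infimum may be `∞`, and a factor is moved inside it only if it is not zero. A null norm
    -- forces `Y = 0` almost everywhere.
    rcases eq_or_ne (sigmaNorm σ p P Y) 0 with h0 | h0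
    · have h1 := lintegral_enorm_le_sigmaNorm (σ := σ) hP hp hY
      rw [h0, nonpos_iff_eq_zero, lintegral_eq_zero_iff' hY.enorm] at h1
      rw [h0, mul_zero, nonpos_iff_eq_zero, ← e1, ← lintegral_zero (μ := P)]
      refine lintegral_congr_ae ?_
      filter_upwards [h1] with ω hω
      simp only [Pi.zero_apply] at hω
      rw [hω, mul_zero]
    rw [ENNReal.iInf_mul_of_ne h0 hY']
    refine le_iInf fun Z' => ?_
    by_cases hdom : SigmaDominates σ P Z' g
    swap
    · simp [hdom, ENNReal.top_mul h0]
    simp only [hdom, iInf_pos]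
    obtain ⟨U, hU, hdom⟩ := hdom
    have hkm : AEMeasurable (fun ω => σ (U ω) * |Z' ω|) P :=
      (hU.aemeasurable_distortion σ).mul Z'.aestronglyMeasurable.norm.aemeasurable
    -- A uniform variable comonotone with `σ(U)|Z'|` turns the integral over `(0,1)` back into the
    -- expectation of `σ(U)|Z'| h(V)`, where the weighted Hölder inequality applies.
    obtain ⟨V, hV, hVk⟩ := exists_comonotone hP hkm
    have hγ := monotone_monoExt_quantileFn hkm
    have h1 := hW.lintegral_mul_comp_le hgm hγ.measurable (fun a ha => by
      rw [setLIntegral_monoExt _ ha.1]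
      exact (tail a ha).trans ((avar_le_avar_iff ha.2).1 (hdom a ha))) hh
    have h2 : ∫⁻ ω, monoExt (quantileFn P fun ω => σ (U ω) * |Z' ω|) (V ω) * h (V ω) ∂P
        = ∫⁻ u in Ioo 0 1, monoExt (quantileFn P fun ω => σ (U ω) * |Z' ω|) u * h u :=
      hV.lintegral_comp (hγ.measurable.mul hh.measurable)
    have h3 : ∫⁻ ω, monoExt (quantileFn P fun ω => σ (U ω) * |Z' ω|) (V ω) * h (V ω) ∂P
        = ∫⁻ ω, σ.ext (U ω) * (‖Z' ω‖ₑ * h (V ω)) ∂P := by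
      refine lintegral_congr_ae ?_
      filter_upwards [hVk, hU.ae_weight_mul_eq σ Z'] with ω h1 h2
      rw [← h1, h2, mul_assoc]
    have h4 := lintegral_weight_mul_le P hconj.symm
      (σ.ext_monotone.measurable.comp hU.measurable).aemeasurable
      Z'.aestronglyMeasurable.enorm (hh.measurable.comp hV.measurable).aemeasurable
    refine h1.trans ((h2.symm.trans h3).le.trans (h4.trans ?_))
    refine mul_le_mul' (lintegral_weight_le_sigmaNorm hconj.symm.pos hU Z') ?_
    rw [hYeq]
    refine ENNReal.rpow_le_rpow ?_ (by positivity)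
    -- `U` and `V` need not be comonotone; the Hardy–Littlewood inequality absorbs the difference.
    exact hU.lintegral_mul_le hV σ.ext_monotone
      (fun x y hxy => ENNReal.rpow_le_rpow (hh hxy) hp0.le)

/-- The `|·|_{σ,q}^*`-norm of `g` is the smallest constant in Hölder's inequality: it suffices to
test with bounded functions. -/
theorem sigmaStarNorm_le_of_forall_lintegral_le (hP : ∃ U : Ω → ℝ, IsUniform01 P U) (hp : 1 ≤ p)
    (hpq : ENNReal.HolderConjugate (ENNReal.ofReal p) q) {g : Ω → ℝ} (hg : AEMeasurable g P)
    {C : ℝ≥0∞} (hC : C ≠ ∞)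
    (h : ∀ (f : Ω → ℝ) (n : ℕ), Measurable f → (∀ ω, 0 ≤ f ω ∧ f ω ≤ n) →
      ∫⁻ ω, ‖g ω‖ₑ * ‖f ω‖ₑ ∂P ≤ C * sigmaNorm σ p P f) :
    sigmaStarNorm σ q P g ≤ C := by
  have hp0 : 0 < p := by linarith
  have hgm : AEMeasurable (fun ω => ‖g ω‖ₑ) P := hg.enorm
  have hga : AEMeasurable (fun ω => |g ω|) P := hg.norm
  obtain ⟨V, hV, hVg⟩ := exists_comonotone hP hga
  have hγ := monotone_monoExt_quantileFn hga
  set γ := monoExt (quantileFn P fun ω => |g ω|) with hγdef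
  have hVg' : ∀ᵐ ω ∂P, ‖g ω‖ₑ = γ (V ω) := by
    filter_upwards [hVg] with ω hω
    rw [Real.enorm_eq_ofReal_abs, hω]
  -- The test functions are truncations of `k(V)`. Being comonotone with `|g|`, they turn both sides
  -- into integrals over `(0,1)`.
  have test : ∀ k : ℝ → ℝ≥0∞, Monotone k →
      ∫⁻ u in Ioo 0 1, γ u * k u ≤ C * (∫⁻ u in Ioo 0 1, σ.ext u * k u ^ p) ^ (1 / p) := by
    intro k hk
    have hsup : ∀ u, γ u * k u = ⨆ n : ℕ, γ u * min (k u) n := fun u => by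
      rw [← ENNReal.mul_iSup, ← inf_iSup_eq, ENNReal.iSup_natCast, inf_top_eq]
    rw [lintegral_congr hsup, lintegral_iSup
      (f := fun (n : ℕ) u => γ u * min (k u) n)
      (fun n => hγ.measurable.mul (hk.measurable.min measurable_const))
      (fun a b hab u => mul_le_mul_right (min_le_min le_rfl (by exact_mod_cast hab)) _)]
    refine iSup_le fun n => ?_
    have hkn : Monotone fun u => min (k u) (n : ℝ≥0∞) := fun x y hxy => min_le_min (hk hxy) le_rfl
    have htop : ∀ u, min (k u) (n : ℝ≥0∞) ≠ ∞ := fun u =>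
      ne_top_of_le_ne_top (ENNReal.natCast_ne_top n) (min_le_right _ _)
    have h1 := h (fun ω => (min (k (V ω)) n).toReal) n
      (hkn.measurable.comp hV.measurable).ennreal_toReal (fun ω => ⟨ENNReal.toReal_nonneg,
        ENNReal.toReal_le_of_le_ofReal (by positivity) (by simp)⟩)
    have h2 : ∀ ω, ‖(min (k (V ω)) (n : ℝ≥0∞)).toReal‖ₑ = min (k (V ω)) n := fun ω => by
      rw [Real.enorm_eq_ofReal ENNReal.toReal_nonneg, ENNReal.ofReal_toReal (htop _)]
    rw [sigmaNorm_eq_of_comonotone hp0 hV hkn (.of_forall h2)] at h1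
    have h3 : ∫⁻ ω, ‖g ω‖ₑ * ‖(min (k (V ω)) (n : ℝ≥0∞)).toReal‖ₑ ∂P
        = ∫⁻ u in Ioo 0 1, γ u * min (k u) n := by
      rw [← hV.lintegral_comp (f := fun u => γ u * min (k u) n)
        (hγ.measurable.mul hkn.measurable)]
      refine lintegral_congr_ae ?_
      filter_upwards [hVg'] with ω hω
      rw [h2, hω]
    rw [h3] at h1
    refine h1.trans ?_
    gcongr
    exact min_le_left _ _
  have tailtest : ∀ a, 0 ≤ a → ∀ f : ℝ → ℝ≥0∞,
      ∫⁻ u in Ioo 0 1, (Ioi a).indicator f u = ∫⁻ u in Ioo a 1, f u := fun a ha f => by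
    rw [lintegral_indicator measurableSet_Ioi, Measure.restrict_restrict measurableSet_Ioi]
    congr 2
    ext x; simp only [mem_inter_iff, mem_Ioi, mem_Ioo]
    exact ⟨fun h => ⟨h.1, h.2.2⟩, fun h => ⟨h.1, ha.trans_lt h.1, h.2⟩⟩
  unfold sigmaStarNorm
  split_ifs with hq
  · have hp1 : p = 1 := by
      have := (ENNReal.HolderConjugate.eq_top_iff_eq_one q (ENNReal.ofReal p)).1 hq
      simpa using this
    subst hp1
    refine iSup₂_le fun a ha => ?_
    have hd : ENNReal.ofReal (1 - a) ≠ 0 := (ENNReal.ofReal_pos.2 (by linarith [ha.2])).ne'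
    -- Testing with this indicator gives the bound on the tail from `a`, which is the quotient at
    -- level `a`.
    have hmono : Monotone ((Ioi a).indicator (fun _ => (1 : ℝ≥0∞))) := fun x y hxy => by
      by_cases hx : x ∈ Ioi a
      · rw [indicator_of_mem hx, indicator_of_mem (show y ∈ Ioi a from lt_of_lt_of_le hx hxy)]
      · rw [indicator_of_notMem hx]; exact zero_le
    have h1 := test _ hmono
    have e : ∀ f : ℝ → ℝ≥0∞, (fun u => f u * (Ioi a).indicator (fun _ => (1 : ℝ≥0∞)) u)
        = (Ioi a).indicator f := fun f => by
      ext u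
      by_cases hu : u ∈ Ioi a
      · rw [indicator_of_mem hu, indicator_of_mem hu, mul_one]
      · rw [indicator_of_notMem hu, indicator_of_notMem hu, mul_zero]
    simp only [ENNReal.rpow_one, one_div_one] at h1
    rw [e γ, e σ.ext, tailtest a ha.1, tailtest a ha.1, ← σ.S_eq ha.1, hγdef,
      setLIntegral_monoExt _ ha.1] at h1
    refine ENNReal.div_le_of_le_mul ?_
    rw [avar, ← mul_div_assoc]
    exact ENNReal.div_le_div_right h1 _
  · have hconj : p.HolderConjugate q.toReal := by
      have := ENNReal.HolderConjugate.toReal_of_ne_top (p := ENNReal.ofReal p) (q := q)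
        ENNReal.ofReal_ne_top hq
      rwa [ENNReal.toReal_ofReal hp0.le] at this
    have hwd : ∀ k : ℝ → ℝ≥0∞, Measurable k →
        ∫⁻ u, k u ∂((volume.restrict (Ioo (0 : ℝ) 1)).withDensity γ)
          = ∫⁻ u in Ioo 0 1, γ u * k u := fun k hk =>
      lintegral_withDensity_eq_lintegral_mul _ hγ.measurable hk
    -- The level function of `γ(u) du` with respect to `σ(u) du`.
    obtain ⟨H, hH, hHC, hHtail⟩ := exists_level (m := σ.measure)
      (ν := (volume.restrict (Ioo (0 : ℝ) 1)).withDensity γ) hconj hC (fun k hk => by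
        rw [hwd k hk.measurable, σ.lintegral_measure (hk.measurable.pow_const p)]
        exact test k hk)
    rw [σ.lintegral_measure (hH.measurable.pow_const p)] at hHC
    have hHp1 : Monotone fun u => H u ^ (p - 1) := fun x y hxy =>
      ENNReal.rpow_le_rpow (hH hxy) (by linarith)
    -- If `H` were infinite at some `u < 1`, it would be infinite on `(u,1)`, where `σ` has positive
    -- mass.
    have hHtop : ∀ u ∈ Ioo (0 : ℝ) 1, H u ≠ ∞ := fun u hu htop => by
      have h1 : ∫⁻ x in Ioo u 1, σ.ext x * H x ^ p ≤ ∫⁻ x in Ioo 0 1, σ.ext x * H x ^ p :=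
        lintegral_mono_set (Ioo_subset_Ioo_left hu.1.le)
      have h2 : ∫⁻ x in Ioo u 1, σ.ext x * H x ^ p = ∫⁻ x in Ioo u 1, σ.ext x * ∞ :=
        setLIntegral_congr_fun measurableSet_Ioo fun x hx => by
          have : H x = ∞ := top_le_iff.1 (htop ▸ hH hx.1.le)
          simp only [this, ENNReal.top_rpow_of_pos hp0]
      rw [h2, lintegral_mul_const _ σ.ext_monotone.measurable, ← σ.S_eq hu.1.le,
        ENNReal.mul_top (σ.S_pos ⟨hu.1.le, hu.2⟩).ne'] at h1
      exact ENNReal.rpow_ne_top_of_nonneg hconj.symm.nonneg hC (top_le_iff.1 (h1.trans hHC))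
    obtain ⟨U, hU⟩ := hP
    have hZm : Measurable fun ω => (H (U ω) ^ (p - 1)).toReal :=
      (hHp1.measurable.comp hU.measurable).ennreal_toReal
    -- The exponent is right for the norm because `(p - 1) q = p`.
    set Z' : Ω →ₘ[P] ℝ := AEEqFun.mk _ hZm.aestronglyMeasurable with hZ'
    have hZ'eq : (Z' : Ω → ℝ) =ᵐ[P] fun ω => (H (U ω) ^ (p - 1)).toReal := AEEqFun.coeFn_mk _ _
    have hZ'H : ∀ᵐ ω ∂P, ‖Z' ω‖ₑ = H (U ω) ^ (p - 1) := by
      filter_upwards [hZ'eq, hU.ae_mem_Ioo] with ω h1 h2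
      rw [h1, Real.enorm_eq_ofReal ENNReal.toReal_nonneg, ENNReal.ofReal_toReal
        (ENNReal.rpow_ne_top_of_nonneg (by linarith) (hHtop _ h2))]
    have hnorm : sigmaNorm σ q.toReal P Z' ≤ C := by
      rw [sigmaNorm_eq_of_comonotone hconj.symm.pos hU hHp1 hZ'H, one_div,
        ENNReal.rpow_inv_le_iff hconj.symm.pos]
      refine le_trans (le_of_eq ?_) hHC
      refine lintegral_congr fun u => ?_
      rw [← ENNReal.rpow_mul, hconj.sub_one_mul_conj]
    refine (iInf₂_le Z' ⟨U, hU, fun a ha => ?_⟩).trans hnorm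
    rw [avar_le_avar_iff ha.2]
    have h1 := hHtail a
    rw [σ.setLIntegral_measure_Ioi hHp1.measurable ha.1, withDensity_apply _ measurableSet_Ioi,
      Measure.restrict_restrict measurableSet_Ioi] at h1
    have hIoo : Ioi a ∩ Ioo 0 1 = Ioo a 1 := by
      ext x; simp only [mem_inter_iff, mem_Ioi, mem_Ioo]
      exact ⟨fun h => ⟨h.1, h.2.2⟩, fun h => ⟨h.1, ha.1.trans_lt h.1, h.2⟩⟩
    rw [hIoo, hγdef, setLIntegral_monoExt _ ha.1] at h1
    refine h1.trans ?_
    have hkm : AEMeasurable (fun ω => σ (U ω) * |Z' ω|) P :=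
      (hU.aemeasurable_distortion σ).mul Z'.aestronglyMeasurable.norm.aemeasurable
    -- The event `{a < U}` has probability `1 - a`, so the integral of `σ(U)|Z'|` over it bounds the
    -- tail of the quantile function from below.
    refine le_trans (le_of_eq ?_) (setLIntegral_le_tail_quantileFn ⟨U, hU⟩ hkm
      (hU.measurableSet_tail a) ha.1 (hU.measure_tail ha.1).le)
    rw [← hU.setLIntegral_comp (f := fun u => σ.ext u * H u ^ (p - 1))
      (σ.ext_monotone.measurable.mul hHp1.measurable) ha.1]
    refine lintegral_congr_ae (ae_restrict_of_ae ?_)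
    filter_upwards [hU.ae_weight_mul_eq σ Z', hZ'H] with ω h1 h2
    rw [h1, h2]

end ScalarDuality

/-! ### The dual pairing -/

/-! ### Almost norming vectors and pairings with bounded functions -/

section Norming

variable {𝕜 : Type*} [RCLike 𝕜] {X : Type*} [NormedAddCommGroup X] [NormedSpace 𝕜 X]
  {Ω : Type*} [MeasurableSpace Ω] {P : Measure Ω}

theorem StrongDual.exists_norming (z : StrongDual 𝕜 X) {ε : ℝ} (hε : 0 < ε) :
    ∃ x : X, ‖x‖ ≤ 1 ∧ ‖z‖ - ε ≤ RCLike.re (z x) := by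
  obtain ⟨x, hx, hzx⟩ := z.exists_lt_apply_of_lt_opNorm (show ‖z‖ - ε < ‖z‖ by linarith)
  obtain ⟨c, hc, hcz⟩ := RCLike.exists_norm_eq_mul_self (z x)
  refine ⟨c • x, by rw [norm_smul, hc, one_mul]; exact hx.le, ?_⟩
  rw [map_smul, smul_eq_mul, ← hcz, RCLike.ofReal_re]
  exact hzx.le

/-- A measurable selection of almost norming vectors. -/
theorem MeasureTheory.StronglyMeasurable.exists_norming {Z : Ω → StrongDual 𝕜 X}
    (hZ : StronglyMeasurable Z) {ε : ℝ} (hε : 0 < ε) :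
    ∃ y : Ω → X, StronglyMeasurable y ∧ (∀ ω, ‖y ω‖ ≤ 1) ∧
      ∀ ω, ‖Z ω‖ - ε ≤ RCLike.re (Z ω (y ω)) := by
  obtain ⟨c, hc, hcZ⟩ := hZ.isSeparable_range
  -- Adding `0` makes the countable set nonempty, so that it is the range of a sequence.
  obtain ⟨u, hu⟩ := (hc.insert 0).exists_eq_range (insert_nonempty 0 c)
  have hε3 : 0 < ε / 3 := by positivity
  have hex : ∀ ω, ∃ n, ‖Z ω - u n‖ < ε / 3 := fun ω => by
    obtain ⟨z, hz, hzd⟩ := Metric.mem_closure_iff.1 (hcZ (mem_range_self ω)) _ hε3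
    obtain ⟨n, hn⟩ : z ∈ range u := hu ▸ mem_insert_of_mem 0 hz
    exact ⟨n, by rwa [hn, ← dist_eq_norm]⟩
  choose x hx1 hx2 using fun n => StrongDual.exists_norming (u n) hε3
  classical
  -- The first index within `ε / 3` depends measurably on `ω`. The three errors come from
  -- approximating the norm, from norming `u n`, and from evaluating `Z ω` in place of `u n`.
  refine ⟨fun ω => x (Nat.find (hex ω)), ?_, fun ω => hx1 _, fun ω => ?_⟩
  · have hm : Measurable fun ω => Nat.find (hex ω) := measurable_find hex fun k =>
      _root_.measurableSet_lt
        (hZ.sub (stronglyMeasurable_const (b := u k))).norm.measurable measurable_const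
    exact (StronglyMeasurable.of_discrete (f := x)).comp_measurable hm
  · have h1 := Nat.find_spec (hex ω)
    set n := Nat.find (hex ω)
    have h2 := hx2 n
    have h3 : RCLike.re (u n (x n)) - RCLike.re (Z ω (x n)) ≤ ε / 3 := by
      rw [← map_sub, ← sub_apply]
      refine (RCLike.re_le_norm _).trans (((u n - Z ω).le_opNorm _).trans ?_)
      rw [norm_sub_rev]
      calc ‖Z ω - u n‖ * ‖x n‖ ≤ ‖Z ω - u n‖ * 1 := by gcongr; exact hx1 n
        _ ≤ ε / 3 := by rw [mul_one]; exact h1.le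
    have h4 : ‖Z ω‖ ≤ ‖Z ω - u n‖ + ‖u n‖ := by
      simpa using norm_add_le (Z ω - u n) (u n)
    linarith

theorem MeasureTheory.AEStronglyMeasurable.dual_apply {Z : Ω → StrongDual 𝕜 X} {Y : Ω → X}
    (hZ : AEStronglyMeasurable Z P) (hY : AEStronglyMeasurable Y P) :
    AEStronglyMeasurable (fun ω => Z ω (Y ω)) P :=
  isBoundedBilinearMap_apply.continuous.comp_aestronglyMeasurable (hZ.prodMk hY)

theorem MeasureTheory.Integrable.dual_apply_of_bound {Z : Ω → StrongDual 𝕜 X} {Y : Ω → X}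
    (hZ : Integrable Z P) (hY : AEStronglyMeasurable Y P) {C : ℝ} (hC : ∀ᵐ ω ∂P, ‖Y ω‖ ≤ C) :
    Integrable (fun ω => Z ω (Y ω)) P := by
  refine (hZ.norm.mul_const C).mono' (hZ.aestronglyMeasurable.dual_apply hY) ?_
  filter_upwards [hC] with ω hω
  exact ((Z ω).le_opNorm _).trans (by gcongr)

/-- The integral of `‖Z‖ f` is tested by vector-valued functions of norm at most `f`. -/
theorem lintegral_enorm_mul_le_of_forall [IsProbabilityMeasure P] {Z : Ω → StrongDual 𝕜 X}
    (hZ : StronglyMeasurable Z) (hZi : Integrable Z P) {f : Ω → ℝ} {n : ℝ} (hf : Measurable f)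
    (hfn : ∀ ω, 0 ≤ f ω ∧ f ω ≤ n) {B : ℝ}
    (h : ∀ Y : Ω → X, StronglyMeasurable Y → (∀ ω, ‖Y ω‖ ≤ f ω) →
      RCLike.re (∫ ω, Z ω (Y ω) ∂P) ≤ B) :
    ∫⁻ ω, ‖Z ω‖ₑ * ‖f ω‖ₑ ∂P ≤ ENNReal.ofReal B := by
  have hn : 0 ≤ n := by
    obtain ⟨ω⟩ := nonempty_of_isProbabilityMeasure P
    exact (hfn ω).1.trans (hfn ω).2
  have hfi : Integrable f P := .of_bound hf.aestronglyMeasurable n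
    (.of_forall fun ω => by rw [Real.norm_of_nonneg (hfn ω).1]; exact (hfn ω).2)
  have hZf : Integrable (fun ω => ‖Z ω‖ * f ω) P :=
    hZi.norm.mul_bdd hf.aestronglyMeasurable
      (.of_forall fun ω => by rw [Real.norm_of_nonneg (hfn ω).1]; exact (hfn ω).2)
  have key : ∀ ε : ℝ, 0 < ε → ∫ ω, ‖Z ω‖ * f ω ∂P ≤ B + ε * n := fun ε hε => by
    obtain ⟨y, hy, hy1, hyZ⟩ := hZ.exists_norming hε
    set Y : Ω → X := fun ω => (f ω : 𝕜) • y ω with hYdef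
    have hYn : ∀ ω, ‖Y ω‖ ≤ f ω := fun ω => by
      rw [hYdef, norm_smul, RCLike.norm_ofReal, abs_of_nonneg (hfn ω).1]
      exact mul_le_of_le_one_right (hfn ω).1 (hy1 ω)
    have hYm : StronglyMeasurable Y :=
      (RCLike.continuous_ofReal.comp_stronglyMeasurable hf.stronglyMeasurable).smul hy
    have hint := hZi.dual_apply_of_bound hYm.aestronglyMeasurable
      (.of_forall fun ω => (hYn ω).trans (hfn ω).2)
    have h1 : ∫ ω, (‖Z ω‖ * f ω - ε * f ω) ∂P ≤ ∫ ω, RCLike.re (Z ω (Y ω)) ∂P := by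
      refine integral_mono (hZf.sub (hfi.const_mul ε)) hint.re fun ω => ?_
      simp only [hYdef, map_smul, smul_eq_mul, RCLike.re_ofReal_mul]
      nlinarith [hyZ ω, (hfn ω).1]
    rw [integral_sub hZf (hfi.const_mul ε), integral_const_mul, integral_re hint] at h1
    have h2 : ∫ ω, f ω ∂P ≤ n := by
      have := integral_mono hfi (integrable_const n) fun ω => (hfn ω).2
      simpa using this
    have h3 := h Y hYm hYn
    nlinarith
  have hle : ∫ ω, ‖Z ω‖ * f ω ∂P ≤ B := by
    -- The error is `ε n`; dividing by `n + 1` covers the case `n = 0`.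
    refine le_of_forall_pos_le_add fun δ hδ => (key (δ / (n + 1)) (by positivity)).trans ?_
    have : δ / (n + 1) * n ≤ δ := by
      rw [div_mul_eq_mul_div, div_le_iff₀ (by positivity)]
      nlinarith
    linarith
  have e : ∫⁻ ω, ‖Z ω‖ₑ * ‖f ω‖ₑ ∂P = ENNReal.ofReal (∫ ω, ‖Z ω‖ * f ω ∂P) := by
    rw [ofReal_integral_eq_lintegral_ofReal hZf
      (.of_forall fun ω => mul_nonneg (norm_nonneg _) (hfn ω).1)]
    refine lintegral_congr fun ω => ?_
    rw [ENNReal.ofReal_mul (norm_nonneg _), ofReal_norm, Real.enorm_eq_ofReal (hfn ω).1]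
  rw [e]
  exact ENNReal.ofReal_le_ofReal hle

end Norming

/-! ### The vector space structure of the star space -/

section StarSpace

variable {Ω : Type*} [MeasurableSpace Ω] {P : Measure Ω}
  {σ : DistortionFunction} {p : ℝ} {q : ℝ≥0∞} {E : Type*} [NormedAddCommGroup E]

theorem sigmaNorm_le_of_bound (hp : 0 < p) {Y : Ω → E} {C : ℝ≥0∞} (h : ∀ᵐ ω ∂P, ‖Y ω‖ₑ ≤ C) :
    sigmaNorm σ p P Y ≤ C := by
  rw [sigmaNorm_le_iff hp]
  intro U hU
  calc ∫⁻ ω, σ.ext (U ω) * ‖Y ω‖ₑ ^ p ∂P ≤ ∫⁻ ω, σ.ext (U ω) * C ^ p ∂P := by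
        refine lintegral_mono_ae ?_
        filter_upwards [h] with ω hω
        exact mul_le_mul_right (ENNReal.rpow_le_rpow hω hp.le) _
    _ = C ^ p := by
        rw [lintegral_mul_const (f := fun ω => σ.ext (U ω)) _
            (σ.ext_monotone.measurable.comp hU.measurable),
          hU.lintegral_comp σ.ext_monotone.measurable, σ.lintegral_ext, one_mul]

theorem sigmaNorm_ne_top_of_bound (hp : 0 < p) {f : Ω → ℝ} {n : ℕ} (h : ∀ ω, 0 ≤ f ω ∧ f ω ≤ n) :
    sigmaNorm σ p P f ≠ ∞ := by
  refine ne_top_of_le_ne_top (ENNReal.natCast_ne_top n)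
    (sigmaNorm_le_of_bound hp (.of_forall fun ω => ?_))
  rw [Real.enorm_eq_ofReal (h ω).1]
  exact ENNReal.ofReal_le_of_le_toReal (by simpa using (h ω).2)

variable [IsProbabilityMeasure P]

/-- Domination transfers to `|·|_{σ,q}^*`. -/
theorem vectorStarNorm_le_of_enorm_le (hP : ∃ U : Ω → ℝ, IsUniform01 P U) (hp : 1 ≤ p)
    (hpq : ENNReal.HolderConjugate (ENNReal.ofReal p) q) {F G : Type*} [NormedAddCommGroup F]
    [NormedAddCommGroup G] {Z : Ω → E} {Z₁ : Ω → F} {Z₂ : Ω → G}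
    (hZ : AEStronglyMeasurable Z P) (hZ₁ : AEStronglyMeasurable Z₁ P)
    (hZ₂ : AEStronglyMeasurable Z₂ P) (h₁ : vectorStarNorm σ q P Z₁ ≠ ∞)
    (h₂ : vectorStarNorm σ q P Z₂ ≠ ∞) {a b : ℝ≥0∞} (ha : a ≠ ∞) (hb : b ≠ ∞)
    (h : ∀ᵐ ω ∂P, ‖Z ω‖ₑ ≤ a * ‖Z₁ ω‖ₑ + b * ‖Z₂ ω‖ₑ) :
    vectorStarNorm σ q P Z ≤ a * vectorStarNorm σ q P Z₁ + b * vectorStarNorm σ q P Z₂ := by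
  -- Subadditivity is not visible from the infimum in the definition; it is obtained by duality,
  -- Hölder's inequality being applied to `Z₁` and `Z₂` separately.
  refine sigmaStarNorm_le_of_forall_lintegral_le hP hp hpq hZ.norm.aemeasurable
    (ENNReal.add_ne_top.2 ⟨ENNReal.mul_ne_top ha h₁, ENNReal.mul_ne_top hb h₂⟩)
    fun f n hf hfn => ?_
  have hfs := sigmaNorm_ne_top_of_bound (σ := σ) (p := p) (P := P) (by linarith) hfn
  have i₁ := lintegral_mul_le_sigmaStarNorm_mul hP hp hpq hZ₁.norm.aemeasurable
    hf.aestronglyMeasurable hfs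
  have i₂ := lintegral_mul_le_sigmaStarNorm_mul hP hp hpq hZ₂.norm.aemeasurable
    hf.aestronglyMeasurable hfs
  simp only [enorm_norm] at i₁ i₂ ⊢
  calc ∫⁻ ω, ‖Z ω‖ₑ * ‖f ω‖ₑ ∂P
      ≤ ∫⁻ ω, (a * (‖Z₁ ω‖ₑ * ‖f ω‖ₑ) + b * (‖Z₂ ω‖ₑ * ‖f ω‖ₑ)) ∂P := by
        refine lintegral_mono_ae ?_
        filter_upwards [h] with ω hω
        rw [← mul_assoc, ← mul_assoc, ← add_mul]
        exact mul_le_mul_left hω _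
    _ = a * ∫⁻ ω, ‖Z₁ ω‖ₑ * ‖f ω‖ₑ ∂P + b * ∫⁻ ω, ‖Z₂ ω‖ₑ * ‖f ω‖ₑ ∂P := by
        rw [lintegral_add_left' (f := fun ω => a * (‖Z₁ ω‖ₑ * ‖f ω‖ₑ))
            ((hZ₁.enorm.mul hf.enorm.aemeasurable).const_mul a),
          lintegral_const_mul' _ _ ha, lintegral_const_mul' _ _ hb]
    _ ≤ a * (vectorStarNorm σ q P Z₁ * sigmaNorm σ p P f)
          + b * (vectorStarNorm σ q P Z₂ * sigmaNorm σ p P f) :=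
        add_le_add (mul_le_mul_right i₁ a) (mul_le_mul_right i₂ b)
    _ = _ := by ring

theorem vectorStarNorm_zero (hP : ∃ U : Ω → ℝ, IsUniform01 P U) (hp : 1 ≤ p)
    (hpq : ENNReal.HolderConjugate (ENNReal.ofReal p) q) {Z : Ω → E} (hZ : Z =ᵐ[P] 0) :
    vectorStarNorm σ q P Z = 0 := by
  have hZm : AEStronglyMeasurable Z P := aestronglyMeasurable_zero.congr hZ.symm
  refine nonpos_iff_eq_zero.1 (sigmaStarNorm_le_of_forall_lintegral_le hP hp hpq
    hZm.norm.aemeasurable ENNReal.zero_ne_top fun f n hf hfn => ?_)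
  rw [zero_mul, ← lintegral_zero (μ := P)]
  refine le_of_eq (lintegral_congr_ae ?_)
  filter_upwards [hZ] with ω hω
  simp [hω]

/-- `L_σ^{q*}(P, E)` as a subspace. -/
def sigmaStarSubmodule (𝕜 : Type*) [RCLike 𝕜] [NormedSpace 𝕜 E]
    (hP : ∃ U : Ω → ℝ, IsUniform01 P U) (σ : DistortionFunction) (hp : 1 ≤ p)
    (hpq : ENNReal.HolderConjugate (ENNReal.ofReal p) q) : Submodule 𝕜 (Ω →ₘ[P] E) where
  carrier := LSigmaStar σ q P E
  zero_mem' := by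
    change vectorStarNorm σ q P _ < ∞
    rw [vectorStarNorm_zero hP hp hpq AEEqFun.coeFn_zero]
    exact ENNReal.zero_lt_top
  add_mem' := fun {Z Z'} h h' => by
    change vectorStarNorm σ q P _ < ∞
    refine (vectorStarNorm_le_of_enorm_le hP hp hpq (Z + Z').aestronglyMeasurable
      Z.aestronglyMeasurable Z'.aestronglyMeasurable (ne_of_lt h) (ne_of_lt h')
      ENNReal.one_ne_top ENNReal.one_ne_top ?_).trans_lt
      (by simpa using! ENNReal.add_lt_top.2 ⟨h, h'⟩)
    filter_upwards [AEEqFun.coeFn_add Z Z'] with ω hω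
    rw [hω, one_mul, one_mul]
    exact enorm_add_le _ _
  smul_mem' := fun c Z h => by
    change vectorStarNorm σ q P _ < ∞
    refine (vectorStarNorm_le_of_enorm_le (b := 0) hP hp hpq (c • Z).aestronglyMeasurable
      Z.aestronglyMeasurable Z.aestronglyMeasurable (ne_of_lt h) (ne_of_lt h)
      (enorm_ne_top (x := c)) ENNReal.zero_ne_top ?_).trans_lt
      (by simpa using! ENNReal.mul_lt_top enorm_lt_top h)
    filter_upwards [AEEqFun.coeFn_smul c Z] with ω hω
    rw [hω, Pi.smul_apply, enorm_smul, zero_mul, add_zero]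

end StarSpace

/-! ### The isometric embedding into the dual -/

section DualPairing

variable {𝕜 : Type*} [RCLike 𝕜] {X : Type*} [NormedAddCommGroup X] [NormedSpace 𝕜 X]
  {Ω : Type*} [MeasurableSpace Ω] {P : Measure Ω} {σ : DistortionFunction} {p : ℝ}
  [hp : Fact (1 ≤ p)] {q : ℝ≥0∞}

namespace LSigma

/-- The class in `L_σ^p(P, X)` of a strongly measurable function of finite norm. -/
noncomputable def mk (𝕜 : Type*) [RCLike 𝕜] [NormedSpace 𝕜 X] {Y : Ω → X}
    (hY : AEStronglyMeasurable Y P) (h : sigmaNorm σ p P Y ≠ ∞) : LSigma 𝕜 σ p P X :=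
  ⟨AEEqFun.mk Y hY, by
    change sigmaNorm σ p P _ < ∞
    rw [sigmaNorm_congr (AEEqFun.coeFn_mk Y hY)]
    exact lt_top_iff_ne_top.2 h⟩

theorem coeFn_mk {Y : Ω → X} (hY : AEStronglyMeasurable Y P) (h : sigmaNorm σ p P Y ≠ ∞) :
    (mk 𝕜 hY h : Ω → X) =ᵐ[P] Y := AEEqFun.coeFn_mk Y hY

theorem enorm_def (Y : LSigma 𝕜 σ p P X) : ‖Y‖ₑ = sigmaNorm σ p P Y := by
  rw [← ofReal_norm, norm_def, ENNReal.ofReal_toReal Y.sigmaNorm_ne_top]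

theorem ext_ae {Y Y' : LSigma 𝕜 σ p P X} (h : (Y : Ω → X) =ᵐ[P] Y') : Y = Y' :=
  Subtype.ext (AEEqFun.ext h)

theorem aestronglyMeasurable (Y : LSigma 𝕜 σ p P X) : AEStronglyMeasurable (Y : Ω → X) P :=
  Y.toAEEqFun.aestronglyMeasurable

theorem coeFn_sub (Y Y' : LSigma 𝕜 σ p P X) :
    ((Y - Y' : LSigma 𝕜 σ p P X) : Ω → X) =ᵐ[P] fun ω => Y ω - Y' ω :=
  AEEqFun.coeFn_sub Y.toAEEqFun Y'.toAEEqFun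

end LSigma

theorem sigmaNorm_ne_top_of_norm_le {E : Type*} [NormedAddCommGroup E] {Y : Ω → E} {n : ℝ}
    (h : ∀ᵐ ω ∂P, ‖Y ω‖ ≤ n) : sigmaNorm σ p P Y ≠ ∞ := by
  refine ne_top_of_le_ne_top (ENNReal.ofReal_ne_top (r := n))
    (sigmaNorm_le_of_bound (zero_lt_one.trans_le hp.out) ?_)
  filter_upwards [h] with ω hω
  rw [← ofReal_norm]
  exact ENNReal.ofReal_le_ofReal hω

variable [IsProbabilityMeasure P]

theorem lintegral_pairing_le (hP : ∃ U : Ω → ℝ, IsUniform01 P U)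
    (hpq : ENNReal.HolderConjugate (ENNReal.ofReal p) q) {Z : Ω → StrongDual 𝕜 X}
    (hZ : AEStronglyMeasurable Z P) (Y : LSigma 𝕜 σ p P X) :
    ∫⁻ ω, ‖Z ω (Y ω)‖ₑ ∂P ≤ vectorStarNorm σ q P Z * ‖Y‖ₑ := by
  have h := lintegral_mul_le_sigmaStarNorm_mul (σ := σ) hP hp.out hpq hZ.norm.aemeasurable
    Y.aestronglyMeasurable Y.sigmaNorm_ne_top
  rw [← LSigma.enorm_def] at h
  refine le_trans (lintegral_mono fun ω => ?_) h
  rw [enorm_norm]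
  exact (Z ω).le_opENorm _

theorem integrable_pairing (hP : ∃ U : Ω → ℝ, IsUniform01 P U)
    (hpq : ENNReal.HolderConjugate (ENNReal.ofReal p) q) {Z : Ω → StrongDual 𝕜 X}
    (hZ : AEStronglyMeasurable Z P) (hZ' : vectorStarNorm σ q P Z ≠ ∞) (Y : LSigma 𝕜 σ p P X) :
    Integrable (fun ω => Z ω (Y ω)) P :=
  ⟨hZ.dual_apply Y.aestronglyMeasurable,
    (lintegral_pairing_le hP hpq hZ Y).trans_lt (ENNReal.mul_lt_top hZ'.lt_top enorm_lt_top)⟩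

/-- Elements of `L_σ^{q*}` are integrable. -/
theorem integrable_of_vectorStarNorm_ne_top {E : Type*} [NormedAddCommGroup E]
    (hP : ∃ U : Ω → ℝ, IsUniform01 P U) (hpq : ENNReal.HolderConjugate (ENNReal.ofReal p) q)
    {Z : Ω → E} (hZ : AEStronglyMeasurable Z P) (hZ' : vectorStarNorm σ q P Z ≠ ∞) :
    Integrable Z P := by
  have hp0 : 0 < p := zero_lt_one.trans_le hp.out
  have h1 : sigmaNorm σ p P (fun _ : Ω => (1 : ℝ)) ≠ ∞ :=
    sigmaNorm_ne_top_of_bound hp0 (n := 1) fun _ => by simp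
  have h := lintegral_mul_le_sigmaStarNorm_mul hP hp.out hpq hZ.norm.aemeasurable
    aestronglyMeasurable_const h1
  simp only [enorm_norm, enorm_one, mul_one] at h
  exact ⟨hZ, h.trans_lt (ENNReal.mul_lt_top hZ'.lt_top h1.lt_top)⟩

theorem norm_integral_pairing_le (hP : ∃ U : Ω → ℝ, IsUniform01 P U)
    (hpq : ENNReal.HolderConjugate (ENNReal.ofReal p) q) {Z : Ω → StrongDual 𝕜 X}
    (hZ : AEStronglyMeasurable Z P) (hZ' : vectorStarNorm σ q P Z ≠ ∞) (Y : LSigma 𝕜 σ p P X) :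
    ‖∫ ω, Z ω (Y ω) ∂P‖ ≤ (vectorStarNorm σ q P Z).toReal * ‖Y‖ := by
  have h1 := (enorm_integral_le_lintegral_enorm _).trans (lintegral_pairing_le hP hpq hZ Y)
  rw [← toReal_enorm, ← toReal_enorm, ← ENNReal.toReal_mul]
  exact ENNReal.toReal_mono (ENNReal.mul_ne_top hZ' enorm_ne_top) h1

/-- The embedding of `L_σ^{q*}(P, X^*)` into the dual of `L_σ^p(P, X)`. -/
noncomputable def dualPairing (hP : ∃ U : Ω → ℝ, IsUniform01 P U)
    (hpq : ENNReal.HolderConjugate (ENNReal.ofReal p) q) :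
    sigmaStarSubmodule (E := StrongDual 𝕜 X) (P := P) 𝕜 hP σ hp.out hpq →ₗ[𝕜]
      StrongDual 𝕜 (LSigma 𝕜 σ p P X) where
  toFun Z := LinearMap.mkContinuous
    { toFun := fun Y => ∫ ω, (Z : Ω →ₘ[P] StrongDual 𝕜 X) ω (Y ω) ∂P
      map_add' := fun Y Y' => by
        rw [← integral_add (integrable_pairing hP hpq Z.1.aestronglyMeasurable (ne_of_lt Z.2) Y)
          (integrable_pairing hP hpq Z.1.aestronglyMeasurable (ne_of_lt Z.2) Y')]
        refine integral_congr_ae ?_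
        filter_upwards [LSigma.coeFn_add Y Y'] with ω hω
        rw [hω, map_add]
      map_smul' := fun c Y => by
        rw [RingHom.id_apply, ← integral_smul]
        refine integral_congr_ae ?_
        filter_upwards [LSigma.coeFn_smul c Y] with ω hω
        rw [hω, map_smul] }
    (vectorStarNorm σ q P (Z : Ω →ₘ[P] StrongDual 𝕜 X)).toReal
    (norm_integral_pairing_le hP hpq Z.1.aestronglyMeasurable (ne_of_lt Z.2))
  map_add' := fun Z Z' => by
    ext Y
    change ∫ ω, (Z + Z').1 ω (Y ω) ∂P = ∫ ω, Z.1 ω (Y ω) ∂P + ∫ ω, Z'.1 ω (Y ω) ∂P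
    rw [← integral_add (integrable_pairing hP hpq Z.1.aestronglyMeasurable (ne_of_lt Z.2) Y)
      (integrable_pairing hP hpq Z'.1.aestronglyMeasurable (ne_of_lt Z'.2) Y)]
    refine integral_congr_ae ?_
    filter_upwards [AEEqFun.coeFn_add Z.1 Z'.1] with ω hω
    change (Z.1 + Z'.1) ω (Y ω) = _
    rw [hω]
    rfl
  map_smul' := fun c Z => by
    ext Y
    change ∫ ω, (c • Z).1 ω (Y ω) ∂P = c • ∫ ω, Z.1 ω (Y ω) ∂P
    rw [← integral_smul]
    refine integral_congr_ae ?_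
    filter_upwards [AEEqFun.coeFn_smul c Z.1] with ω hω
    change (c • Z.1) ω (Y ω) = _
    rw [hω]
    rfl

theorem dualPairing_apply (hP : ∃ U : Ω → ℝ, IsUniform01 P U)
    (hpq : ENNReal.HolderConjugate (ENNReal.ofReal p) q)
    (Z : sigmaStarSubmodule (E := StrongDual 𝕜 X) (P := P) 𝕜 hP σ hp.out hpq)
    (Y : LSigma 𝕜 σ p P X) :
    dualPairing hP hpq Z Y = ∫ ω, (Z : Ω →ₘ[P] StrongDual 𝕜 X) ω (Y ω) ∂P := rfl

/-- A bound for the pairing with bounded functions bounds `|Z|_σ^{q,*}`. -/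
theorem vectorStarNorm_le_of_forall (hP : ∃ U : Ω → ℝ, IsUniform01 P U)
    (hpq : ENNReal.HolderConjugate (ENNReal.ofReal p) q) {Z : Ω → StrongDual 𝕜 X}
    (hZ : StronglyMeasurable Z) (hZi : Integrable Z P) {C : ℝ} (hC : 0 ≤ C)
    (h : ∀ (Y : Ω → X) (n : ℕ), StronglyMeasurable Y → (∀ ω, ‖Y ω‖ ≤ n) →
      RCLike.re (∫ ω, Z ω (Y ω) ∂P) ≤ C * (sigmaNorm σ p P Y).toReal) :
    vectorStarNorm σ q P Z ≤ ENNReal.ofReal C := by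
  have hp0 : 0 < p := zero_lt_one.trans_le hp.out
  refine sigmaStarNorm_le_of_forall_lintegral_le hP hp.out hpq hZ.norm.measurable.aemeasurable
    ENNReal.ofReal_ne_top fun f n hf hfn => ?_
  have hfs := sigmaNorm_ne_top_of_bound (σ := σ) (P := P) hp0 hfn
  rw [← ENNReal.ofReal_toReal hfs, ← ENNReal.ofReal_mul hC]
  simp only [enorm_norm]
  refine lintegral_enorm_mul_le_of_forall hZ hZi hf hfn fun Y hY hYf => ?_
  refine (h Y n hY fun ω => (hYf ω).trans (hfn ω).2).trans ?_
  gcongr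
  refine sigmaNorm_mono hp0 (.of_forall fun ω => ?_)
  rw [← ofReal_norm, Real.enorm_eq_ofReal (hfn ω).1]
  exact ENNReal.ofReal_le_ofReal (hYf ω)

/-- Hölder's inequality gives one direction. The other holds because bounded `Y` already detect the
star norm and belong to the space. -/
theorem enorm_dualPairing (hP : ∃ U : Ω → ℝ, IsUniform01 P U)
    (hpq : ENNReal.HolderConjugate (ENNReal.ofReal p) q)
    (Z : sigmaStarSubmodule (E := StrongDual 𝕜 X) (P := P) 𝕜 hP σ hp.out hpq) :
    ‖dualPairing hP hpq Z‖ₑ = vectorStarNorm σ q P (Z : Ω →ₘ[P] StrongDual 𝕜 X) := by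
  have hfin : vectorStarNorm σ q P (Z : Ω →ₘ[P] StrongDual 𝕜 X) ≠ ∞ := ne_of_lt Z.2
  refine le_antisymm ?_ ?_
  · rw [← ofReal_norm, ← ENNReal.ofReal_toReal hfin]
    exact ENNReal.ofReal_le_ofReal (ContinuousLinearMap.opNorm_le_bound _ ENNReal.toReal_nonneg
      (norm_integral_pairing_le hP hpq Z.1.aestronglyMeasurable hfin))
  · rw [← ofReal_norm]
    refine vectorStarNorm_le_of_forall hP hpq Z.1.stronglyMeasurable
      (integrable_of_vectorStarNorm_ne_top hP hpq Z.1.aestronglyMeasurable hfin) (norm_nonneg _)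
      fun Y n hY hYn => ?_
    have hYs : sigmaNorm σ p P Y ≠ ∞ := sigmaNorm_ne_top_of_norm_le (.of_forall hYn)
    set Y' := LSigma.mk 𝕜 hY.aestronglyMeasurable hYs
    have h1 : dualPairing hP hpq Z Y' = ∫ ω, (Z : Ω →ₘ[P] StrongDual 𝕜 X) ω (Y ω) ∂P := by
      rw [dualPairing_apply]
      refine integral_congr_ae ?_
      filter_upwards [LSigma.coeFn_mk (𝕜 := 𝕜) hY.aestronglyMeasurable hYs] with ω hω
      rw [hω]
    rw [← h1, ← sigmaNorm_congr (LSigma.coeFn_mk (𝕜 := 𝕜) hY.aestronglyMeasurable hYs),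
      ← LSigma.norm_def]
    exact (RCLike.re_le_norm _).trans ((dualPairing hP hpq Z).le_opNorm _)

/-- By the isometry a null functional has star norm zero, and Hölder's inequality against the
constant `1` then gives zero mean of `‖Z‖`. The star norm is not needed as a norm on classes. -/
theorem dualPairing_injective (hP : ∃ U : Ω → ℝ, IsUniform01 P U)
    (hpq : ENNReal.HolderConjugate (ENNReal.ofReal p) q) :
    Function.Injective (dualPairing (𝕜 := 𝕜) (X := X) (P := P) (σ := σ) hP hpq) := by
  rw [injective_iff_map_eq_zero]
  intro Z hZ
  have hp0 : 0 < p := zero_lt_one.trans_le hp.out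
  have h0 : vectorStarNorm σ q P (Z : Ω →ₘ[P] StrongDual 𝕜 X) = 0 := by
    rw [← enorm_dualPairing hP hpq Z, hZ, ← ofReal_norm, ContinuousLinearMap.opNorm_zero,
      ENNReal.ofReal_zero]
  have h1 : sigmaNorm σ p P (fun _ : Ω => (1 : ℝ)) ≠ ∞ :=
    sigmaNorm_ne_top_of_bound hp0 (n := 1) fun _ => by simp
  have h := lintegral_mul_le_sigmaStarNorm_mul hP hp.out hpq
    Z.1.aestronglyMeasurable.norm.aemeasurable aestronglyMeasurable_const h1
  simp only [enorm_norm, enorm_one, mul_one] at h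
  change _ ≤ vectorStarNorm σ q P (Z : Ω →ₘ[P] StrongDual 𝕜 X) * _ at h
  rw [h0, zero_mul, nonpos_iff_eq_zero, lintegral_eq_zero_iff' Z.1.aestronglyMeasurable.enorm] at h
  refine Subtype.ext (AEEqFun.ext ?_)
  filter_upwards [h, AEEqFun.coeFn_zero (α := Ω) (β := StrongDual 𝕜 X) (μ := P)] with ω h1 h2
  rw [Submodule.coe_zero, h2]
  simpa using h1

end DualPairing

/-! ### Order continuity of `‖·‖_{σ,p}` and density of bounded functions -/

section Density

open Filter Topology

variable {Ω : Type*} [MeasurableSpace Ω] {P : Measure Ω}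
  {σ : DistortionFunction} {p : ℝ}

theorem enorm_apply_sub_le {𝕜 : Type*} [RCLike 𝕜] {X : Type*} [NormedAddCommGroup X]
    [NormedSpace 𝕜 X] [Fact (1 ≤ p)] (φ : StrongDual 𝕜 (LSigma 𝕜 σ p P X)) {Y Y' : LSigma 𝕜 σ p P X}
    {f : Ω → X} (hf : ∀ᵐ ω ∂P, Y ω - Y' ω = f ω) :
    ‖φ Y - φ Y'‖ₑ ≤ ‖φ‖ₑ * sigmaNorm σ p P f := by
  rw [← map_sub]
  refine (φ.le_opENorm _).trans (le_of_eq ?_)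
  rw [LSigma.enorm_def]
  congr 1
  refine sigmaNorm_congr ?_
  filter_upwards [LSigma.coeFn_sub Y Y', hf] with ω h1 h2
  rw [h1, h2]

variable [IsProbabilityMeasure P]

/-- The excess of `σ` over a constant depends only on the law of `U`, so its smallness controls all
uniform variables at once. -/
theorem DistortionFunction.tendsto_lintegral_ext_sub (σ : DistortionFunction) :
    Tendsto (fun K : ℕ => ∫⁻ u in Ioo 0 1, (σ.ext u - K)) atTop (𝓝 0) := by
  rw [← lintegral_zero (μ := volume.restrict (Ioo (0 : ℝ) 1))]
  refine tendsto_lintegral_of_dominated_convergence σ.ext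
    (fun K => σ.ext_monotone.measurable.sub_const _) (fun K => .of_forall fun u => tsub_le_self)
    (by rw [σ.lintegral_ext]; exact ENNReal.one_ne_top) ?_
  filter_upwards [ae_restrict_mem measurableSet_Ioo] with u hu
  have hfin : σ.ext u ≠ ∞ := by
    rw [ext, monoExt_of_mem _ hu]; exact ENNReal.ofReal_ne_top
  obtain ⟨N, hN⟩ := ENNReal.exists_nat_gt hfin
  refine tendsto_const_nhds.congr' ?_
  filter_upwards [eventually_ge_atTop N] with K hK
  exact (tsub_eq_zero_of_le (hN.le.trans (by exact_mod_cast hK))).symm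

/-- Bounded convergence in `‖·‖_{σ,p}`. -/
theorem tendsto_sigmaNorm_of_bounded {E : Type*} [NormedAddCommGroup E] (hp : 0 < p)
    {Y : ℕ → Ω → E} (hm : ∀ n, AEStronglyMeasurable (Y n) P) {C : ℝ≥0∞} (hC : C ≠ ∞)
    (hb : ∀ n, ∀ᵐ ω ∂P, ‖Y n ω‖ₑ ≤ C)
    (hlim : ∀ᵐ ω ∂P, Tendsto (fun n => ‖Y n ω‖ₑ) atTop (𝓝 0)) :
    Tendsto (fun n => sigmaNorm σ p P (Y n)) atTop (𝓝 0) := by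
  have hCp : C ^ p ≠ ∞ := ENNReal.rpow_ne_top_of_nonneg hp.le hC
  -- Split the weight at the height `K`: the bounded part sees the plain `p`-th moment, the excess
  -- sees the uniform bound `C`. The result does not depend on `U`.
  have hbound : ∀ K n : ℕ, ∀ U, IsUniform01 P U → ∫⁻ ω, σ.ext (U ω) * ‖Y n ω‖ₑ ^ p ∂P
      ≤ K * ∫⁻ ω, ‖Y n ω‖ₑ ^ p ∂P + (∫⁻ u in Ioo 0 1, (σ.ext u - K)) * C ^ p := by
    intro K n U hU
    have hsub : Measurable fun u => σ.ext u - K := σ.ext_monotone.measurable.sub_const _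
    rw [← lintegral_const_mul' _ _ (ENNReal.natCast_ne_top K), ← hU.lintegral_comp hsub,
      ← lintegral_mul_const' _ _ hCp,
      ← lintegral_add_right' (g := fun ω => (σ.ext (U ω) - K) * C ^ p) _
        ((hsub.comp hU.measurable).mul_const _).aemeasurable]
    refine lintegral_mono_ae ?_
    filter_upwards [hb n] with ω hω
    calc σ.ext (U ω) * ‖Y n ω‖ₑ ^ p ≤ (K + (σ.ext (U ω) - K)) * ‖Y n ω‖ₑ ^ p :=
          mul_le_mul_left le_add_tsub _
      _ = K * ‖Y n ω‖ₑ ^ p + (σ.ext (U ω) - K) * ‖Y n ω‖ₑ ^ p := add_mul _ _ _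
      _ ≤ K * ‖Y n ω‖ₑ ^ p + (σ.ext (U ω) - K) * C ^ p :=
          add_le_add_right (mul_le_mul_right (ENNReal.rpow_le_rpow hω hp.le) _) _
  have hmean : Tendsto (fun n => ∫⁻ ω, ‖Y n ω‖ₑ ^ p ∂P) atTop (𝓝 0) := by
    rw [← lintegral_zero (μ := P)]
    refine tendsto_lintegral_of_dominated_convergence' (fun _ => C ^ p)
      (fun n => (hm n).enorm.pow_const p)
      (fun n => (hb n).mono fun ω hω => ENNReal.rpow_le_rpow hω hp.le) (by simpa using hCp) ?_
    filter_upwards [hlim] with ω hω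
    have := (ENNReal.continuous_rpow_const (y := p)).tendsto 0 |>.comp hω
    rwa [ENNReal.zero_rpow_of_pos hp] at this
  rw [ENNReal.tendsto_nhds_zero]
  intro ε hε
  rcases eq_or_ne ε ∞ with rfl | hεtop
  · exact .of_forall fun _ => le_top
  have hη : 0 < ε ^ p / 2 :=
    ENNReal.half_pos (ENNReal.rpow_pos hε hεtop).ne'
  have h1 : Tendsto (fun K : ℕ => (∫⁻ u in Ioo 0 1, (σ.ext u - K)) * C ^ p) atTop (𝓝 0) := by
    have := ENNReal.Tendsto.mul_const σ.tendsto_lintegral_ext_sub (b := C ^ p) (Or.inr hCp)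
    rwa [zero_mul] at this
  obtain ⟨K, hK⟩ := ((ENNReal.tendsto_nhds_zero.1 h1) _ hη).exists
  have h2 : Tendsto (fun n => (K : ℝ≥0∞) * ∫⁻ ω, ‖Y n ω‖ₑ ^ p ∂P) atTop (𝓝 0) := by
    have := ENNReal.Tendsto.const_mul hmean (a := (K : ℝ≥0∞)) (Or.inr (ENNReal.natCast_ne_top K))
    rwa [mul_zero] at this
  filter_upwards [(ENNReal.tendsto_nhds_zero.1 h2) _ hη] with n hn
  rw [sigmaNorm_le_iff hp]
  intro U hU
  exact (hbound K n U hU).trans ((add_le_add hn hK).trans (ENNReal.add_halves _).le)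

/-- Truncations converge in `‖·‖_{σ,p}`. -/
theorem tendsto_sigmaNorm_truncation {E : Type*} [NormedAddCommGroup E] (hp : 0 < p)
    (hP : ∃ U : Ω → ℝ, IsUniform01 P U) {Y : Ω → E} (hY : AEStronglyMeasurable Y P)
    (hY' : sigmaNorm σ p P Y ≠ ∞) :
    Tendsto (fun n : ℕ => sigmaNorm σ p P (fun ω => if ‖Y ω‖ ≤ n then 0 else Y ω)) atTop
      (𝓝 0) := by
  obtain ⟨V, hV, h, hh, hYh⟩ := exists_comonotone_enorm hP hY
  -- Removing the small values leaves a nondecreasing function of the same `V`, so the norms of all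
  -- remainders are integrals over `(0,1)` with a common majorant.
  set k : ℕ → ℝ → ℝ≥0∞ := fun n u => if h u ≤ n then 0 else h u with hk
  have hkm : ∀ n, Monotone (k n) := fun n x y hxy => by
    simp only [hk]
    split_ifs with h1 h2 h2
    · exact le_rfl
    · exact zero_le
    · exact absurd ((hh hxy).trans h2) h1
    · exact hh hxy
  have hkY : ∀ n : ℕ, ∀ᵐ ω ∂P, ‖(if ‖Y ω‖ ≤ n then 0 else Y ω : E)‖ₑ = k n (V ω) := fun n => by
    filter_upwards [hYh] with ω hω
    have e : ‖Y ω‖ ≤ n ↔ ‖Y ω‖ₑ ≤ n := by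
      rw [← ofReal_norm, ENNReal.ofReal_le_iff_le_toReal (ENNReal.natCast_ne_top n),
        ENNReal.toReal_natCast]
    simp only [hk, ← hω, ← e]
    split_ifs
    · exact enorm_zero
    · rfl
  have hfin : ∫⁻ u in Ioo 0 1, σ.ext u * h u ^ p ≠ ∞ := by
    intro htop
    rw [sigmaNorm_eq_of_comonotone hp hV hh hYh, htop, ENNReal.top_rpow_of_pos (by positivity)]
      at hY'
    exact hY' rfl
  have hlim : Tendsto (fun n : ℕ => ∫⁻ u in Ioo 0 1, σ.ext u * k n u ^ p) atTop (𝓝 0) := by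
    rw [← lintegral_zero (μ := volume.restrict (Ioo (0 : ℝ) 1))]
    refine tendsto_lintegral_of_dominated_convergence (fun u => σ.ext u * h u ^ p)
      (fun n => σ.ext_monotone.measurable.mul ((hkm n).measurable.pow_const p))
      (fun n => .of_forall fun u => mul_le_mul_right (ENNReal.rpow_le_rpow ?_ hp.le) _) hfin ?_
    · simp only [hk]
      split_ifs
      · exact zero_le
      · exact le_rfl
    · filter_upwards [ae_lt_top (σ.ext_monotone.measurable.mul (hh.measurable.pow_const p)) hfin]
        with u hu
      simp only [Pi.mul_apply] at hu
      refine tendsto_const_nhds.congr' ?_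
      -- Up to a null set, `h` can be infinite only where `σ` vanishes, since the product is
      -- integrable.
      rcases eq_or_ne (h u) ∞ with htop | htop
      · rw [htop, ENNReal.top_rpow_of_pos hp] at hu
        have h0 : σ.ext u = 0 := by
          by_contra hne
          rw [ENNReal.mul_top hne] at hu
          exact absurd hu (lt_irrefl _)
        exact .of_forall fun n => by simp only [h0, zero_mul]
      · obtain ⟨N, hN⟩ := ENNReal.exists_nat_gt htop
        filter_upwards [eventually_ge_atTop N] with n hn
        have : h u ≤ n := hN.le.trans (by exact_mod_cast hn)
        simp only [hk, if_pos this, ENNReal.zero_rpow_of_pos hp, mul_zero]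
  have h2 := (ENNReal.continuous_rpow_const (y := 1 / p)).tendsto 0 |>.comp hlim
  rw [ENNReal.zero_rpow_of_pos (by positivity)] at h2
  refine h2.congr fun n => ?_
  rw [sigmaNorm_eq_of_comonotone hp hV (hkm n) (hkY n)]
  rfl

variable {𝕜 : Type*} [RCLike 𝕜] {X : Type*} [NormedAddCommGroup X] [NormedSpace 𝕜 X]
  [hp : Fact (1 ≤ p)]

/-- A continuous functional is determined by its values on bounded functions. -/
theorem StrongDual.ext_of_bounded (hP : ∃ U : Ω → ℝ, IsUniform01 P U)
    {φ ψ : StrongDual 𝕜 (LSigma 𝕜 σ p P X)}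
    (h : ∀ (Y : LSigma 𝕜 σ p P X) (f : Ω → X) (n : ℕ), StronglyMeasurable f →
      (∀ ω, ‖f ω‖ ≤ n) → (Y : Ω → X) =ᵐ[P] f → φ Y = ψ Y) : φ = ψ := by
  have hp0 : 0 < p := zero_lt_one.trans_le hp.out
  rw [← sub_eq_zero]
  ext Y
  set χ := φ - ψ with hχ
  have hYm : StronglyMeasurable (Y : Ω → X) := Y.toAEEqFun.stronglyMeasurable
  have hTm : ∀ n : ℕ, StronglyMeasurable fun ω => if ‖Y ω‖ ≤ n then Y ω else 0 := fun n =>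
    hYm.ite (measurableSet_le hYm.norm.measurable measurable_const) stronglyMeasurable_const
  have hTb : ∀ (n : ℕ) ω, ‖(if ‖Y ω‖ ≤ n then Y ω else 0 : X)‖ ≤ n := fun n ω => by
    split_ifs with h
    · exact h
    · simp
  have hle : ∀ n : ℕ, ‖χ Y‖ₑ ≤ ‖χ‖ₑ *
      sigmaNorm σ p P (fun ω => if ‖Y ω‖ ≤ n then 0 else Y ω) := fun n => by
    have hT := sigmaNorm_ne_top_of_norm_le (σ := σ) (p := p) (P := P) (.of_forall (hTb n))
    have hmk := LSigma.coeFn_mk (𝕜 := 𝕜) (hTm n).aestronglyMeasurable hT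
    have h0 : χ (LSigma.mk 𝕜 (hTm n).aestronglyMeasurable hT) = 0 := by
      rw [hχ, sub_apply, sub_eq_zero]
      exact h _ _ n (hTm n) (hTb n) hmk
    have := enorm_apply_sub_le χ (Y := Y) (Y' := LSigma.mk 𝕜 (hTm n).aestronglyMeasurable hT)
      (f := fun ω => if ‖Y ω‖ ≤ n then 0 else Y ω) (by
        filter_upwards [hmk] with ω hω
        rw [hω]
        split_ifs <;> simp)
    rwa [h0, sub_zero] at this
  have hlim := ENNReal.Tendsto.const_mul (tendsto_sigmaNorm_truncation hp0 hP
    Y.aestronglyMeasurable Y.sigmaNorm_ne_top) (a := ‖χ‖ₑ) (Or.inr enorm_ne_top)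
  rw [mul_zero] at hlim
  have := ge_of_tendsto' hlim hle
  simpa using this

end Density

/-! ### Functionals as vector measures, and surjectivity under the Radon–Nikodým property -/

section RadonNikodym

open Filter Topology

theorem MeasureTheory.VectorMeasure.variation_univ_le {Ω E : Type*} [MeasurableSpace Ω]
    [NormedAddCommGroup E] {μ : VectorMeasure Ω E} {C : ℝ}
    (h : ∀ s : Finset (Set Ω), (∀ t ∈ s, MeasurableSet t) →
      (s : Set (Set Ω)).PairwiseDisjoint id → ∑ t ∈ s, ‖μ t‖ ≤ C) :
    μ.variation univ ≤ ENNReal.ofReal C := by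
  by_contra! hlt
  obtain ⟨s, -, hd, hm, hs⟩ := μ.exists_lt_sum_of_lt_variation MeasurableSet.univ hlt
  refine hs.not_ge ?_
  have := ENNReal.ofReal_le_ofReal (h s hm hd)
  rw [ENNReal.ofReal_sum_of_nonneg fun _ _ => norm_nonneg _] at this
  simpa only [ofReal_norm] using this

variable {𝕜 : Type*} [RCLike 𝕜] {X : Type*} [NormedAddCommGroup X] [NormedSpace 𝕜 X]
  {Ω : Type*} [MeasurableSpace Ω] {P : Measure Ω} {σ : DistortionFunction} {p : ℝ}
  [hp : Fact (1 ≤ p)]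

namespace LSigma

open Classical in
/-- The value of a functional on `L_σ^p(P, X)` at the class of a function (zero if the function
does not belong to the space). -/
noncomputable def applyFun (φ : StrongDual 𝕜 (LSigma 𝕜 σ p P X)) (f : Ω → X) : 𝕜 :=
  if h : AEStronglyMeasurable f P ∧ sigmaNorm σ p P f ≠ ∞ then φ (mk 𝕜 h.1 h.2) else 0

variable {φ : StrongDual 𝕜 (LSigma 𝕜 σ p P X)} {f g : Ω → X}

theorem applyFun_mk (hf : AEStronglyMeasurable f P) (hf' : sigmaNorm σ p P f ≠ ∞) :
    applyFun φ f = φ (mk 𝕜 hf hf') := dif_pos ⟨hf, hf'⟩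

theorem applyFun_eq {Y : LSigma 𝕜 σ p P X} (h : (Y : Ω → X) =ᵐ[P] f) : applyFun φ f = φ Y := by
  have hf : AEStronglyMeasurable f P := Y.aestronglyMeasurable.congr h
  have hf' : sigmaNorm σ p P f ≠ ∞ := by
    rw [← sigmaNorm_congr h]
    exact Y.sigmaNorm_ne_top
  rw [applyFun_mk hf hf', ext_ae ((coeFn_mk hf hf').trans h.symm)]

theorem applyFun_add (hf : AEStronglyMeasurable f P) (hf' : sigmaNorm σ p P f ≠ ∞)
    (hg : AEStronglyMeasurable g P) (hg' : sigmaNorm σ p P g ≠ ∞) :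
    applyFun φ (f + g) = applyFun φ f + applyFun φ g := by
  rw [applyFun_mk hf hf', applyFun_mk hg hg', ← map_add]
  refine applyFun_eq ((coeFn_add _ _).trans ?_)
  filter_upwards [coeFn_mk (𝕜 := 𝕜) hf hf', coeFn_mk (𝕜 := 𝕜) hg hg'] with ω h1 h2
  rw [h1, h2, Pi.add_apply]

theorem applyFun_sub (hf : AEStronglyMeasurable f P) (hf' : sigmaNorm σ p P f ≠ ∞)
    (hg : AEStronglyMeasurable g P) (hg' : sigmaNorm σ p P g ≠ ∞) :
    applyFun φ (f - g) = applyFun φ f - applyFun φ g := by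
  rw [applyFun_mk hf hf', applyFun_mk hg hg', ← map_sub]
  refine applyFun_eq ((coeFn_sub _ _).trans ?_)
  filter_upwards [coeFn_mk (𝕜 := 𝕜) hf hf', coeFn_mk (𝕜 := 𝕜) hg hg'] with ω h1 h2
  rw [h1, h2, Pi.sub_apply]

theorem applyFun_smul (c : 𝕜) (hf : AEStronglyMeasurable f P) (hf' : sigmaNorm σ p P f ≠ ∞) :
    applyFun φ (c • f) = c * applyFun φ f := by
  rw [applyFun_mk hf hf', ← smul_eq_mul, ← map_smul]
  refine applyFun_eq ((coeFn_smul _ _).trans ?_)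
  filter_upwards [coeFn_mk (𝕜 := 𝕜) hf hf'] with ω h1
  rw [h1, Pi.smul_apply]

theorem applyFun_zero : applyFun φ (0 : Ω → X) = 0 := by
  exact (applyFun_eq (Y := 0) coeFn_zero).trans (map_zero φ)

theorem applyFun_congr (h : f =ᵐ[P] g) : applyFun φ f = applyFun φ g := by
  by_cases hf : AEStronglyMeasurable f P ∧ sigmaNorm σ p P f ≠ ∞
  · rw [applyFun_mk hf.1 hf.2, applyFun_eq ((coeFn_mk hf.1 hf.2).trans h)]
  · have hg : ¬ (AEStronglyMeasurable g P ∧ sigmaNorm σ p P g ≠ ∞) := fun hg =>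
      hf ⟨hg.1.congr h.symm, by rw [sigmaNorm_congr h]; exact hg.2⟩
    rw [applyFun, applyFun, dif_neg hf, dif_neg hg]

/-- Off the space `applyFun` is zero, so no hypothesis on `f` is required. -/
theorem enorm_applyFun_le : ‖applyFun φ f‖ₑ ≤ ‖φ‖ₑ * sigmaNorm σ p P f := by
  by_cases hf : AEStronglyMeasurable f P ∧ sigmaNorm σ p P f ≠ ∞
  · rw [applyFun_mk hf.1 hf.2]
    refine (φ.le_opENorm _).trans (le_of_eq ?_)
    rw [enorm_def, sigmaNorm_congr (coeFn_mk (𝕜 := 𝕜) hf.1 hf.2)]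
  · rw [applyFun, dif_neg hf, enorm_zero]
    exact zero_le

theorem norm_applyFun_le {C : ℝ} (hC : 0 ≤ C) (hf : ∀ ω, ‖f ω‖ ≤ C) [IsProbabilityMeasure P] :
    ‖applyFun φ f‖ ≤ ‖φ‖ * C := by
  rw [← ENNReal.ofReal_le_ofReal_iff (by positivity), ENNReal.ofReal_mul (norm_nonneg _),
    ofReal_norm, ofReal_norm]
  refine enorm_applyFun_le.trans (mul_le_mul_right ?_ _)
  refine sigmaNorm_le_of_bound (zero_lt_one.trans_le hp.out) (.of_forall fun ω => ?_)
  rw [← ofReal_norm]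
  exact ENNReal.ofReal_le_ofReal (hf ω)

theorem applyFun_sum {ι : Type*} {s : Finset ι} {F : ι → Ω → X} {C : ι → ℝ}
    (hF : ∀ i ∈ s, StronglyMeasurable (F i)) (hC : ∀ i ∈ s, ∀ ω, ‖F i ω‖ ≤ C i) :
    applyFun φ (∑ i ∈ s, F i) = ∑ i ∈ s, applyFun φ (F i) := by
  classical
  induction s using Finset.induction_on with
  | empty => simpa using applyFun_zero
  | insert i s hi ih =>
    have h1 : ∀ j ∈ s, StronglyMeasurable (F j) := fun j hj => hF j (Finset.mem_insert_of_mem hj)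
    have h2 : ∀ j ∈ s, ∀ ω, ‖F j ω‖ ≤ C j := fun j hj => hC j (Finset.mem_insert_of_mem hj)
    rw [Finset.sum_insert hi, Finset.sum_insert hi, ← ih h1 h2]
    refine applyFun_add (hF i (Finset.mem_insert_self i s)).aestronglyMeasurable
      (sigmaNorm_ne_top_of_norm_le (n := C i)
        (.of_forall (hC i (Finset.mem_insert_self i s))))
      (Finset.stronglyMeasurable_sum s h1).aestronglyMeasurable
      (sigmaNorm_ne_top_of_norm_le (n := ∑ j ∈ s, C j) (.of_forall fun ω => ?_))
    rw [Finset.sum_apply]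
    exact norm_sum_le_of_le s fun j hj => h2 j hj ω

/-- Bounded convergence for functionals on `L_σ^p(P, X)`. -/
theorem tendsto_applyFun [IsProbabilityMeasure P] {F : ℕ → Ω → X} {C : ℝ}
    (hF : ∀ n, StronglyMeasurable (F n)) (hg : StronglyMeasurable g)
    (hFC : ∀ n ω, ‖F n ω‖ ≤ C) (hgC : ∀ ω, ‖g ω‖ ≤ C)
    (hlim : ∀ ω, Tendsto (fun n => F n ω) atTop (𝓝 (g ω))) :
    Tendsto (fun n => applyFun φ (F n)) atTop (𝓝 (applyFun φ g)) := by
  rw [tendsto_iff_edist_tendsto_0]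
  have h1 : Tendsto (fun n => sigmaNorm σ p P (F n - g)) atTop (𝓝 0) := by
    refine tendsto_sigmaNorm_of_bounded (C := ENNReal.ofReal (C + C))
      (zero_lt_one.trans_le hp.out) (fun n => ((hF n).sub hg).aestronglyMeasurable)
      ENNReal.ofReal_ne_top (fun n => .of_forall fun ω => ?_) (.of_forall fun ω => ?_)
    · rw [← ofReal_norm]
      exact ENNReal.ofReal_le_ofReal ((norm_sub_le _ _).trans (add_le_add (hFC n ω) (hgC ω)))
    · have := (tendsto_iff_edist_tendsto_0.1 (hlim ω))
      simpa only [edist_eq_enorm_sub, Pi.sub_apply] using this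
  have h2 := ENNReal.Tendsto.const_mul h1 (a := ‖φ‖ₑ) (Or.inr enorm_ne_top)
  rw [mul_zero] at h2
  refine tendsto_of_tendsto_of_tendsto_of_le_of_le tendsto_const_nhds h2 (fun _ => zero_le)
    fun n => ?_
  change edist (applyFun φ (F n)) (applyFun φ g) ≤ _
  rw [edist_eq_enorm_sub, ← applyFun_sub (hF n).aestronglyMeasurable
    (sigmaNorm_ne_top_of_norm_le (.of_forall (hFC n))) hg.aestronglyMeasurable
    (sigmaNorm_ne_top_of_norm_le (.of_forall hgC))]
  exact enorm_applyFun_le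

variable [IsProbabilityMeasure P]

open Classical in
/-- The set function `A ↦ (x ↦ φ(1_A x))`. -/
noncomputable def setFunction (φ : StrongDual 𝕜 (LSigma 𝕜 σ p P X)) (A : Set Ω) :
    StrongDual 𝕜 X :=
  if hA : MeasurableSet A then
    LinearMap.mkContinuous
      { toFun := fun x => applyFun φ (A.indicator fun _ => x)
        map_add' := fun x y => by
          rw [← applyFun_add (stronglyMeasurable_const.indicator hA).aestronglyMeasurable
            (sigmaNorm_ne_top_of_norm_le (.of_forall fun ω => norm_indicator_le_norm_self _ ω))
            (stronglyMeasurable_const.indicator hA).aestronglyMeasurable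
            (sigmaNorm_ne_top_of_norm_le (.of_forall fun ω => norm_indicator_le_norm_self _ ω)),
            ← indicator_add']
          rfl
        map_smul' := fun c x => by
          rw [RingHom.id_apply, smul_eq_mul,
            ← applyFun_smul c (stronglyMeasurable_const.indicator hA).aestronglyMeasurable
            (sigmaNorm_ne_top_of_norm_le (.of_forall fun ω => norm_indicator_le_norm_self _ ω)),
            show (A.indicator fun _ : Ω => c • x) = c • A.indicator fun _ => x from
              indicator_const_smul A c fun _ => x] }
      ‖φ‖ (fun x => norm_applyFun_le (norm_nonneg x) fun ω => norm_indicator_le_norm_self _ ω)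
  else 0

theorem setFunction_apply {A : Set Ω} (hA : MeasurableSet A) (x : X) :
    setFunction φ A x = applyFun φ (A.indicator fun _ => x) := by
  rw [setFunction, dif_pos hA]
  rfl

theorem setFunction_eq_zero {A : Set Ω} (hA : P A = 0) : setFunction φ A = 0 := by
  by_cases hm : MeasurableSet A
  · ext x
    rw [setFunction_apply hm, applyFun_congr (indicator_meas_zero hA), applyFun_zero]
    rfl
  · rw [setFunction, dif_neg hm]

/-- Choose almost norming `x i` in the unit ball. By disjointness `∑ 1_{A i} x i` is bounded by `1`
pointwise, so `φ` is at most `‖φ‖` on it. -/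
theorem sum_norm_setFunction_le {ι : Type*} (s : Finset ι) {A : ι → Set Ω}
    (hA : ∀ i ∈ s, MeasurableSet (A i)) (hd : (s : Set ι).PairwiseDisjoint A) :
    ∑ i ∈ s, ‖setFunction φ (A i)‖ ≤ ‖φ‖ := by
  have key : ∀ ε : ℝ, 0 < ε → ∑ i ∈ s, ‖setFunction φ (A i)‖ ≤ ‖φ‖ + s.card * ε := by
    intro ε hε
    choose x hx1 hx2 using fun i => StrongDual.exists_norming (setFunction φ (A i)) hε
    have hsum : applyFun φ (∑ i ∈ s, (A i).indicator fun _ => x i)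
        = ∑ i ∈ s, setFunction φ (A i) (x i) := by
      rw [applyFun_sum (C := fun i => ‖x i‖)
        (fun i hi => stronglyMeasurable_const.indicator (hA i hi))
        (fun i _ ω => norm_indicator_le_norm_self _ ω)]
      exact Finset.sum_congr rfl fun i hi => (setFunction_apply (hA i hi) _).symm
    have hb : ‖applyFun φ (∑ i ∈ s, (A i).indicator fun _ => x i)‖ ≤ ‖φ‖ * 1 := by
      refine norm_applyFun_le zero_le_one fun ω => ?_
      rw [Finset.sum_apply]
      by_cases h : ∃ j ∈ s, ω ∈ A j
      · obtain ⟨j, hj, hjω⟩ := h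
        rw [Finset.sum_eq_single_of_mem j hj, indicator_of_mem hjω]
        · exact hx1 j
        · intro i hi hij
          exact indicator_of_notMem (fun hiω => (hd hi hj hij).le_bot ⟨hiω, hjω⟩) _
      · push Not at h
        rw [Finset.sum_eq_zero fun i hi => indicator_of_notMem (h i hi) _, norm_zero]
        exact zero_le_one
    calc ∑ i ∈ s, ‖setFunction φ (A i)‖
        ≤ ∑ i ∈ s, (RCLike.re (setFunction φ (A i) (x i)) + ε) :=
          Finset.sum_le_sum fun i _ => by linarith [hx2 i]
      _ = RCLike.re (∑ i ∈ s, setFunction φ (A i) (x i)) + s.card * ε := by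
          rw [Finset.sum_add_distrib, map_sum, Finset.sum_const, nsmul_eq_mul]
      _ ≤ ‖φ‖ + s.card * ε := by
          rw [← hsum]
          linarith [RCLike.re_le_norm (applyFun φ (∑ i ∈ s, (A i).indicator fun _ => x i))]
  have hlim : Tendsto (fun ε : ℝ => ‖φ‖ + s.card * ε) (𝓝[>] 0) (𝓝 (‖φ‖ + s.card * 0)) :=
    tendsto_nhdsWithin_of_tendsto_nhds (by fun_prop : Continuous _).continuousAt
  rw [mul_zero, add_zero] at hlim
  exact ge_of_tendsto hlim (eventually_mem_nhdsWithin.mono key)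

/-- The vector measure `A ↦ (x ↦ φ(1_A x))`. -/
noncomputable def vectorMeasure (φ : StrongDual 𝕜 (LSigma 𝕜 σ p P X)) :
    VectorMeasure Ω (StrongDual 𝕜 X) where
  measureOf' := setFunction φ
  empty' := setFunction_eq_zero measure_empty
  not_measurable' A hA := by rw [setFunction, dif_neg hA]
  m_iUnion' A hA hd := by
    have hs : Summable fun i => setFunction φ (A i) :=
      Summable.of_norm (summable_of_sum_le (fun _ => norm_nonneg _) fun s =>
        sum_norm_setFunction_le s (fun i _ => hA i) (hd.set_pairwise _))
    -- The series converges absolutely by the variation bound. Its sum is identified on each vector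
    -- `x`, where bounded convergence suffices.
    have heq : ∑' i, setFunction φ (A i) = setFunction φ (⋃ i, A i) := by
      ext x
      have h1 := ((ContinuousLinearMap.apply 𝕜 𝕜 x).hasSum hs.hasSum).tendsto_sum_nat
      simp only [ContinuousLinearMap.apply_apply] at h1
      refine tendsto_nhds_unique h1 ?_
      rw [setFunction_apply (MeasurableSet.iUnion hA)]
      have h2 : ∀ n, ∑ i ∈ Finset.range n, setFunction φ (A i) x
          = applyFun φ ((⋃ i ∈ Finset.range n, A i).indicator fun _ => x) := fun n => by
        rw [Finset.indicator_biUnion _ _ (hd.set_pairwise _)]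
        have h3 := applyFun_sum (φ := φ) (s := Finset.range n)
          (F := fun i => (A i).indicator fun _ => x) (C := fun _ => ‖x‖)
          (fun i _ => stronglyMeasurable_const.indicator (hA i))
          (fun i _ ω => norm_indicator_le_norm_self _ ω)
        rw [Finset.sum_congr rfl fun i _ => setFunction_apply (hA i) x, ← h3]
        congr 1
        ext ω
        rw [Finset.sum_apply]
      simp only [h2]
      refine tendsto_applyFun (C := ‖x‖)
        (fun n => stronglyMeasurable_const.indicator
          (Finset.measurableSet_biUnion _ fun i _ => hA i))
        (stronglyMeasurable_const.indicator (MeasurableSet.iUnion hA))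
        (fun n ω => norm_indicator_le_norm_self _ ω) (fun ω => norm_indicator_le_norm_self _ ω)
        fun ω => ?_
      exact ((tendsto_indicator_biUnion_finset A (fun _ : Ω => x) ω).comp
        tendsto_finset_range).mono_right (pure_le_nhds _)
    rw [← heq]
    exact hs.hasSum

/-- A density of the vector measure of a functional represents the functional. -/
theorem applyFun_eq_integral {Z : Ω → StrongDual 𝕜 X} (hZ : Integrable Z P)
    (h : ∀ A, MeasurableSet A → setFunction φ A = ∫ ω in A, Z ω ∂P) {C : ℝ}
    (hf : StronglyMeasurable f) (hfC : ∀ ω, ‖f ω‖ ≤ C) :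
    applyFun φ f = ∫ ω, Z ω (f ω) ∂P := by
  have hsimple : ∀ g : SimpleFunc Ω X, applyFun φ g = ∫ ω, Z ω (g ω) ∂P := by
    have hmem : ∀ g : SimpleFunc Ω X, ∃ C, ∀ ω, ‖g ω‖ ≤ C := fun g => g.exists_forall_norm_le
    intro g
    induction g using SimpleFunc.induction with
    | const x hA =>
      rename_i A
      have h1 : (SimpleFunc.piecewise A hA (SimpleFunc.const Ω x) (SimpleFunc.const Ω 0) : Ω → X)
          = A.indicator fun _ => x := by
        ext ω
        by_cases hω : ω ∈ A <;> simp [hω]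
      rw [h1, ← setFunction_apply hA, h A hA, ContinuousLinearMap.integral_apply hZ.integrableOn,
        ← integral_indicator hA]
      refine integral_congr_ae (.of_forall fun ω => ?_)
      by_cases hω : ω ∈ A <;> simp [hω]
    | add hd ihg ihg' =>
      rename_i g g'
      obtain ⟨C, hC⟩ := hmem g
      obtain ⟨C', hC'⟩ := hmem g'
      rw [SimpleFunc.coe_add, applyFun_add g.aestronglyMeasurable
        (sigmaNorm_ne_top_of_norm_le (.of_forall hC)) g'.aestronglyMeasurable
        (sigmaNorm_ne_top_of_norm_le (.of_forall hC')), ihg, ihg',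
        ← integral_add (hZ.dual_apply_of_bound g.aestronglyMeasurable (.of_forall hC))
          (hZ.dual_apply_of_bound g'.aestronglyMeasurable (.of_forall hC'))]
      simp only [Pi.add_apply, map_add]
  rcases isEmpty_or_nonempty Ω with hΩ | ⟨⟨ω₀⟩⟩
  · exact absurd (measure_univ (μ := P)) (by simp [univ_eq_empty_iff.2 hΩ])
  let _ : NormedSpace ℝ X := NormedSpace.restrictScalars ℝ 𝕜 X
  have hC0 : 0 ≤ C := (norm_nonneg _).trans (hfC ω₀)
  have hb : ∀ n ω, ‖hf.approxBounded C n ω‖ ≤ C := hf.norm_approxBounded_le hC0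
  have hlim : ∀ ω, Tendsto (fun n => hf.approxBounded C n ω) atTop (𝓝 (f ω)) := fun ω =>
    hf.tendsto_approxBounded_of_norm_le (hfC ω)
  have h1 := tendsto_applyFun (φ := φ) (fun n => (hf.approxBounded C n).stronglyMeasurable) hf hb
    hfC hlim
  -- Both sides are continuous under bounded pointwise convergence and agree on simple functions.
  refine tendsto_nhds_unique h1 ?_
  simp only [hsimple]
  refine tendsto_integral_of_dominated_convergence (fun ω => ‖Z ω‖ * C)
    (fun n => hZ.1.dual_apply (hf.approxBounded C n).aestronglyMeasurable)
    (hZ.norm.mul_const C) (fun n => .of_forall fun ω => ?_) (.of_forall fun ω => ?_)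
  · exact (Z ω).le_opNorm_of_le (hb n ω)
  · exact ((Z ω).continuous.tendsto _).comp (hlim ω)

end LSigma

/-- The Radon–Nikodým density of the measure of `φ` represents `φ` on bounded functions. This alone
puts it into the star space, and density of the bounded functions does the rest. -/
theorem HasRadonNikodymProperty.dualPairing_surjective [IsProbabilityMeasure P]
    (hX : HasRadonNikodymProperty P (StrongDual 𝕜 X)) (hP : ∃ U : Ω → ℝ, IsUniform01 P U)
    {q : ℝ≥0∞} (hpq : ENNReal.HolderConjugate (ENNReal.ofReal p) q) :
    Function.Surjective (dualPairing (𝕜 := 𝕜) (X := X) (P := P) (σ := σ) hP hpq) := by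
  intro φ
  obtain ⟨Z₀, hZ₀, hZ₀'⟩ := hX (LSigma.vectorMeasure φ)
    ((VectorMeasure.variation_univ_le fun s hm hd =>
      LSigma.sum_norm_setFunction_le (φ := φ) s (A := id) hm hd).trans_lt ENNReal.ofReal_lt_top)
    (fun A _ hA => LSigma.setFunction_eq_zero hA)
  set Z := hZ₀.1.mk Z₀
  have hZm : StronglyMeasurable Z := hZ₀.1.stronglyMeasurable_mk
  have hZZ : Z₀ =ᵐ[P] Z := hZ₀.1.ae_eq_mk
  have hZ : Integrable Z P := hZ₀.congr hZZ
  have hν : ∀ A, MeasurableSet A → LSigma.setFunction φ A = ∫ ω in A, Z ω ∂P := fun A hA =>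
    (hZ₀' A hA).trans (integral_congr_ae (ae_restrict_of_ae hZZ))
  have hrep : ∀ (f : Ω → X) (n : ℕ), StronglyMeasurable f → (∀ ω, ‖f ω‖ ≤ n) →
      LSigma.applyFun φ f = ∫ ω, Z ω (f ω) ∂P := fun f n hf hfn =>
    LSigma.applyFun_eq_integral hZ hν hf hfn
  have hnorm : vectorStarNorm σ q P Z ≤ ENNReal.ofReal ‖φ‖ := by
    refine vectorStarNorm_le_of_forall hP hpq hZm hZ (norm_nonneg φ) fun Y n hY hYn => ?_
    rw [← hrep Y n hY hYn]
    have hYs : sigmaNorm σ p P Y ≠ ∞ := sigmaNorm_ne_top_of_norm_le (.of_forall hYn)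
    refine (RCLike.re_le_norm _).trans ?_
    rw [← toReal_enorm, ← toReal_enorm φ, ← ENNReal.toReal_mul]
    exact ENNReal.toReal_mono (ENNReal.mul_ne_top enorm_ne_top hYs) LSigma.enorm_applyFun_le
  have hmk : (AEEqFun.mk Z hZm.aestronglyMeasurable : Ω → StrongDual 𝕜 X) =ᵐ[P] Z :=
    AEEqFun.coeFn_mk _ _
  refine ⟨⟨AEEqFun.mk Z hZm.aestronglyMeasurable, ?_⟩, ?_⟩
  · change vectorStarNorm σ q P _ < ∞
    have hfin : vectorStarNorm σ q P Z ≠ ∞ := ne_top_of_le_ne_top ENNReal.ofReal_ne_top hnorm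
    refine lt_of_le_of_lt (vectorStarNorm_le_of_enorm_le hP hp.out hpq
      (AEEqFun.aestronglyMeasurable _) hZm.aestronglyMeasurable hZm.aestronglyMeasurable hfin hfin
      ENNReal.one_ne_top ENNReal.zero_ne_top ?_) (b := 1 * vectorStarNorm σ q P Z +
        0 * vectorStarNorm σ q P Z) ?_
    · filter_upwards [hmk] with ω hω
      rw [hω, one_mul, zero_mul, add_zero]
    · rw [one_mul, zero_mul, add_zero]
      exact hfin.lt_top
  · refine StrongDual.ext_of_bounded hP fun Y f n hf hfn hYf => ?_
    rw [← LSigma.applyFun_eq (φ := φ) hYf, hrep f n hf hfn, dualPairing_apply]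
    refine integral_congr_ae ?_
    filter_upwards [hmk, hYf] with ω h1 h2
    rw [h1, h2]

end RadonNikodym

/-! ### Necessity of the Radon–Nikodým property -/

section Necessity

open Filter Topology

/-- A dominated finitely additive functional-valued set function extends to a continuous functional
on integrable functions. -/
theorem exists_integral_of_dominated {𝕜 : Type*} [RCLike 𝕜] {X : Type*} [NormedAddCommGroup X]
    [NormedSpace 𝕜 X] {Ω : Type*} [MeasurableSpace Ω] {m : Measure Ω} [IsFiniteMeasure m]
    {T : Set Ω → StrongDual 𝕜 X}
    (hadd : ∀ A B, MeasurableSet A → MeasurableSet B → Disjoint A B → T (A ∪ B) = T A + T B)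
    (hT : ∀ A, MeasurableSet A → ‖T A‖ ≤ m.real A) :
    ∃ I : (Ω → X) → 𝕜,
      (∀ f g, Integrable f m → Integrable g m → I (f + g) = I f + I g) ∧
      (∀ (c : 𝕜) f, I (c • f) = c * I f) ∧
      (∀ f, ‖I f‖ₑ ≤ ∫⁻ ω, ‖f ω‖ₑ ∂m) ∧
      (∀ f g, f =ᵐ[m] g → I f = I g) ∧
      (∀ A x, MeasurableSet A → I (A.indicator fun _ => x) = T A x) ∧
      ∀ (F : ℕ → Ω → X) (f : Ω → X) (C : ℝ), (∀ n, AEStronglyMeasurable (F n) m) →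
        (∀ n ω, ‖F n ω‖ ≤ C) → (∀ ω, Tendsto (fun n => F n ω) atTop (𝓝 (f ω))) →
        Tendsto (fun n => I (F n)) atTop (𝓝 (I f)) := by
  let _ : NormedSpace ℝ X := NormedSpace.restrictScalars ℝ 𝕜 X
  have hst : IsScalarTower ℝ 𝕜 X := ⟨fun r c x => by
    rw [RCLike.real_smul_eq_coe_mul, mul_smul]; rfl⟩
  -- The integral is built over the reals; linearity over `𝕜` is recovered from that of each `T A`.
  have hdom : DominatedFinMeasAdditive m (fun A => (T A).restrictScalars ℝ) 1 := by
    refine ⟨fun A B hA hB _ _ hd => ?_, fun A hA _ => ?_⟩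
    · simp only [hadd A B hA hB hd]
      rfl
    · rw [one_mul, ContinuousLinearMap.norm_restrictScalars]
      exact hT A hA
  refine ⟨setToFun m _ hdom, fun f g hf hg => setToFun_add hdom hf hg,
    fun c f => setToFun_smul hdom (fun c A x => (T A).map_smul c x) c f, fun f => ?_,
    fun f g h => setToFun_congr_ae hdom h,
    fun A x hA => setToFun_indicator_const hdom hA (measure_ne_top m A) x,
    fun F f C hF hC hlim => ?_⟩
  · by_cases hf : Integrable f m
    · rw [setToFun_eq hdom hf, ← ofReal_norm]
      refine (ENNReal.ofReal_le_ofReal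
        (L1.norm_setToL1_le_mul_norm hdom zero_le_one (hf.toL1 f))).trans ?_
      rw [one_mul, Integrable.norm_toL1_eq_lintegral_norm]
      refine ENNReal.ofReal_toReal_le.trans (le_of_eq ?_)
      simp only [ofReal_norm]
    · rw [setToFun_undef hdom hf, enorm_zero]
      exact zero_le
  · exact tendsto_setToFun_of_dominated_convergence hdom (fun _ => C) hF (integrable_const C)
      (fun n => .of_forall fun ω => hC n ω) (.of_forall hlim)

/-- A vector measure of bounded variation is dominated by its variation, which inherits
`P`-continuity because subsets of `P`-null sets are `P`-null. -/
theorem hasRadonNikodymProperty_of_forall {E : Type*} [NormedAddCommGroup E] [NormedSpace ℝ E]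
    {Ω : Type*} [MeasurableSpace Ω] {P : Measure Ω}
    (h : ∀ (m : Measure Ω) (T : Set Ω → E), IsFiniteMeasure m → m ≪ P →
      (∀ A B, MeasurableSet A → MeasurableSet B → Disjoint A B → T (A ∪ B) = T A + T B) →
      (∀ A, MeasurableSet A → ‖T A‖ ≤ m.real A) →
      ∃ Z : Ω → E, Integrable Z P ∧ ∀ A, MeasurableSet A → T A = ∫ ω in A, Z ω ∂P) :
    HasRadonNikodymProperty P E := by
  intro μ hμ hac
  have hfin : IsFiniteMeasure μ.variation := ⟨hμ⟩
  refine h μ.variation μ hfin (Measure.AbsolutelyContinuous.mk fun A hA hPA => ?_)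
    (fun A B hA hB hd => μ.of_union hd hA hB)
    fun A _ => VectorMeasure.norm_measure_le_variation (measure_ne_top _ A)
  rw [VectorMeasure.variation_apply_eq_zero hA]
  exact fun t ht htm => hac t htm (measure_mono_null ht hPA)

variable {𝕜 : Type*} [RCLike 𝕜] {X : Type*} [NormedAddCommGroup X] [NormedSpace 𝕜 X]
  {Ω : Type*} [MeasurableSpace Ω] {P : Measure Ω} [IsProbabilityMeasure P] {σ : DistortionFunction}
  {p : ℝ} [hp : Fact (1 ≤ p)] {q : ℝ≥0∞}

/-- If `g` is the density of `m`, then `(1 + g)⁻¹` maps `L¹(P)` contractively into `L¹(m)`. -/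
theorem lintegral_rnDeriv_weight_le {m : Measure Ω} [IsFiniteMeasure m] (hm : m ≪ P)
    {f : Ω → X} (hf : AEStronglyMeasurable f P) :
    ∫⁻ ω, ‖((((1 + (m.rnDeriv P ω).toReal)⁻¹ : ℝ) : 𝕜)) • f ω‖ₑ ∂m ≤ ∫⁻ ω, ‖f ω‖ₑ ∂P := by
  have hw : Measurable fun ω => (((1 + (m.rnDeriv P ω).toReal)⁻¹ : ℝ) : 𝕜) :=
    RCLike.measurable_ofReal.comp
      (measurable_const.add (Measure.measurable_rnDeriv m P).ennreal_toReal).inv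
  rw [← lintegral_rnDeriv_mul hm
    (f := fun ω => ‖((((1 + (m.rnDeriv P ω).toReal)⁻¹ : ℝ) : 𝕜)) • f ω‖ₑ)
    (hw.aestronglyMeasurable.smul hf).enorm]
  refine lintegral_mono_ae ?_
  filter_upwards [m.rnDeriv_lt_top P] with ω hω
  rw [enorm_smul, ← mul_assoc]
  refine (mul_le_mul_left ?_ ‖f ω‖ₑ).trans (one_mul _).le
  rw [← ofReal_norm, RCLike.norm_ofReal, abs_of_nonneg (by positivity)]
  nth_rewrite 1 [← ENNReal.ofReal_toReal hω.ne]
  rw [← ENNReal.ofReal_mul ENNReal.toReal_nonneg, ENNReal.ofReal_le_one, ← div_eq_mul_inv,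
    div_le_one (by positivity)]
  linarith

/-- If every functional on `L_σ^p(P, X)` is represented by an element of `L_σ^{q*}(P, X^*)`, then
dominated additive set functions have densities. -/
theorem exists_density_of_dualPairing_surjective (hP : ∃ U : Ω → ℝ, IsUniform01 P U)
    (hpq : ENNReal.HolderConjugate (ENNReal.ofReal p) q)
    (hsurj : Function.Surjective (dualPairing (𝕜 := 𝕜) (X := X) (P := P) (σ := σ) hP hpq))
    {m : Measure Ω} [IsFiniteMeasure m] (hm : m ≪ P) {T : Set Ω → StrongDual 𝕜 X}
    (hadd : ∀ A B, MeasurableSet A → MeasurableSet B → Disjoint A B → T (A ∪ B) = T A + T B)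
    (hT : ∀ A, MeasurableSet A → ‖T A‖ ≤ m.real A) :
    ∃ Z : Ω → StrongDual 𝕜 X, Integrable Z P ∧
      ∀ A, MeasurableSet A → T A = ∫ ω in A, Z ω ∂P := by
  obtain ⟨I, I_add, I_smul, I_le, I_congr, I_ind, I_lim⟩ := exists_integral_of_dominated hadd hT
  -- The inverse of this weight makes the integral against `T` continuous for the `L¹(P)`-norm;
  -- multiplication by `G` undoes it at the end.
  set G : Ω → ℝ := fun ω => 1 + (m.rnDeriv P ω).toReal with hG
  have hG1 : ∀ ω, 1 ≤ G ω := fun ω => le_add_of_nonneg_right ENNReal.toReal_nonneg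
  have hG0 : ∀ ω, 0 < G ω := fun ω => one_pos.trans_le (hG1 ω)
  have hGm : Measurable G :=
    measurable_const.add (Measure.measurable_rnDeriv m P).ennreal_toReal
  set w : Ω → 𝕜 := fun ω => (((G ω)⁻¹ : ℝ) : 𝕜) with hw
  have hwm : Measurable w := RCLike.measurable_ofReal.comp hGm.inv
  have hle : ∀ f : Ω → X, AEStronglyMeasurable f P →
      ∫⁻ ω, ‖w ω • f ω‖ₑ ∂m ≤ ∫⁻ ω, ‖f ω‖ₑ ∂P := fun f hf => lintegral_rnDeriv_weight_le hm hf
  have hYle : ∀ Y : LSigma 𝕜 σ p P X, ∫⁻ ω, ‖w ω • Y ω‖ₑ ∂m ≤ ‖Y‖ₑ := fun Y => by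
    rw [LSigma.enorm_def]
    exact (hle Y Y.aestronglyMeasurable).trans
      (lintegral_enorm_le_sigmaNorm hP hp.out Y.aestronglyMeasurable)
  have hwY : ∀ Y : LSigma 𝕜 σ p P X, Integrable (fun ω => w ω • Y ω) m := fun Y =>
    ⟨(hwm.aestronglyMeasurable.smul Y.aestronglyMeasurable).mono_ac hm,
      (hYle Y).trans_lt enorm_lt_top⟩
  let φ : StrongDual 𝕜 (LSigma 𝕜 σ p P X) := LinearMap.mkContinuous
    { toFun := fun Y => I fun ω => w ω • Y ω
      map_add' := fun Y Y' => by
        rw [← I_add _ _ (hwY Y) (hwY Y')]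
        refine I_congr _ _ (hm.ae_le ?_)
        filter_upwards [LSigma.coeFn_add Y Y'] with ω hω
        rw [hω, smul_add, Pi.add_apply]
      map_smul' := fun c Y => by
        rw [RingHom.id_apply, smul_eq_mul, ← I_smul]
        refine I_congr _ _ (hm.ae_le ?_)
        filter_upwards [LSigma.coeFn_smul c Y] with ω hω
        rw [hω, smul_comm, Pi.smul_apply] }
    1 (fun Y => by
      rw [one_mul, ← toReal_enorm, ← toReal_enorm Y]
      exact ENNReal.toReal_mono enorm_ne_top ((I_le _).trans (hYle Y)))
  obtain ⟨W', hW'⟩ := hsurj φ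
  set W : Ω → StrongDual 𝕜 X := ⇑(W' : Ω →ₘ[P] StrongDual 𝕜 X)
  have hWm : StronglyMeasurable W := W'.1.stronglyMeasurable
  have hWi : Integrable W P :=
    integrable_of_vectorStarNorm_ne_top hP hpq hWm.aestronglyMeasurable (ne_of_lt W'.2)
  have hrep : ∀ (f : Ω → X) (n : ℕ), StronglyMeasurable f → (∀ ω, ‖f ω‖ ≤ n) →
      ∫ ω, W ω (f ω) ∂P = I fun ω => w ω • f ω := fun f n hf hfn => by
    have hfs : sigmaNorm σ p P f ≠ ∞ := sigmaNorm_ne_top_of_norm_le (.of_forall hfn)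
    have hmk := LSigma.coeFn_mk (𝕜 := 𝕜) hf.aestronglyMeasurable hfs
    have h1 : dualPairing hP hpq W' (LSigma.mk 𝕜 hf.aestronglyMeasurable hfs)
        = ∫ ω, W ω (f ω) ∂P := by
      rw [dualPairing_apply]
      refine integral_congr_ae ?_
      filter_upwards [hmk] with ω hω
      rw [hω]
    rw [← h1, hW']
    refine I_congr _ _ (hm.ae_le ?_)
    filter_upwards [hmk] with ω hω
    rw [hω]
  have hmin : ∀ (n : ℕ) ω, 0 ≤ min (G ω) n ∧ min (G ω) n ≤ n := fun n ω =>
    ⟨le_min (hG0 ω).le n.cast_nonneg, min_le_right _ _⟩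
  have hminm : ∀ n : ℕ, Measurable fun ω => min (G ω) n := fun n => hGm.min measurable_const
  have hminlim : ∀ ω, ∀ᶠ n : ℕ in atTop, min (G ω) n = G ω := fun ω => by
    obtain ⟨N, hN⟩ := exists_nat_ge (G ω)
    filter_upwards [eventually_ge_atTop N] with n hn
    exact min_eq_left (hN.trans (by exact_mod_cast hn))
  have hwnorm : ∀ ω, ‖w ω‖ = (G ω)⁻¹ := fun ω => by
    rw [hw, RCLike.norm_ofReal, abs_of_nonneg (inv_nonneg.2 (hG0 ω).le)]
  -- For `‖Y‖ ≤ min G n` the function `w Y` is bounded by `1`, whence the total mass of `m`. The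
  -- cutoff at `n` is there because `hrep` covers bounded functions only.
  have hbound : ∀ n : ℕ, ∫⁻ ω, ‖W ω‖ₑ * ‖min (G ω) n‖ₑ ∂P ≤ m univ := fun n => by
    rw [← ENNReal.ofReal_toReal (measure_ne_top m univ)]
    refine lintegral_enorm_mul_le_of_forall hWm hWi (hminm n) (hmin n) fun Y hY hYn => ?_
    rw [hrep Y n hY fun ω => (hYn ω).trans (hmin n ω).2]
    refine (RCLike.re_le_norm _).trans ?_
    rw [← toReal_enorm]
    refine ENNReal.toReal_mono (measure_ne_top m univ) ((I_le _).trans ?_)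
    rw [← lintegral_one]
    refine lintegral_mono fun ω => ?_
    rw [← ofReal_norm, ENNReal.ofReal_le_one, norm_smul, hwnorm, inv_mul_le_one₀ (hG0 ω)]
    exact (hYn ω).trans (min_le_left _ _)
  set Z : Ω → StrongDual 𝕜 X := fun ω => (G ω : 𝕜) • W ω with hZ
  have hGm' : Measurable fun ω => (G ω : 𝕜) := RCLike.measurable_ofReal.comp hGm
  have hZnorm : ∀ ω, ‖Z ω‖ₑ = ‖W ω‖ₑ * ‖G ω‖ₑ := fun ω => by
    have hGn : ‖((G ω : ℝ) : 𝕜)‖ₑ = ‖G ω‖ₑ := by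
      rw [← ofReal_norm, RCLike.norm_ofReal, ← Real.norm_eq_abs, ofReal_norm]
    rw [hZ, enorm_smul, mul_comm, hGn]
  have hZi : Integrable Z P := by
    refine ⟨hGm'.aestronglyMeasurable.smul hWm.aestronglyMeasurable, ?_⟩
    refine lt_of_le_of_lt ?_ (measure_lt_top m univ)
    simp only [hZnorm]
    have hmono : ∀ᵐ ω ∂P, Monotone fun n : ℕ => ‖W ω‖ₑ * ‖min (G ω) n‖ₑ :=
      .of_forall fun ω a b hab => by
        refine mul_le_mul_right ?_ _
        rw [Real.enorm_eq_ofReal (hmin a ω).1, Real.enorm_eq_ofReal (hmin b ω).1]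
        exact ENNReal.ofReal_le_ofReal (min_le_min_left _ (by exact_mod_cast hab))
    refine le_of_tendsto' (lintegral_tendsto_of_tendsto_of_monotone
      (f := fun (n : ℕ) ω => ‖W ω‖ₑ * ‖min (G ω) n‖ₑ) (F := fun ω => ‖W ω‖ₑ * ‖G ω‖ₑ)
      (fun n => (hWm.enorm.mul (hminm n).enorm).aemeasurable) hmono
      (.of_forall fun ω => tendsto_const_nhds.congr' ?_)) hbound
    filter_upwards [hminlim ω] with n hn
    rw [hn]
  refine ⟨Z, hZi, fun A hA => ?_⟩
  ext x
  rw [ContinuousLinearMap.integral_apply hZi.integrableOn, ← integral_indicator hA]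
  -- Bounded approximations of `1_A G x`: against `W` they tend to the integral of `1_A Z x`, while
  -- `w F n` tends boundedly to `1_A x`.
  set F : ℕ → Ω → X := fun n => A.indicator fun ω => ((min (G ω) n : ℝ) : 𝕜) • x with hF
  have hFm : ∀ n, StronglyMeasurable (F n) := fun n =>
    ((RCLike.measurable_ofReal.comp (hminm n)).stronglyMeasurable.smul_const x).indicator hA
  have hsm : ∀ (n : ℕ) ω, ‖((min (G ω) n : ℝ) : 𝕜) • x‖ = min (G ω) n * ‖x‖ := fun n ω => by
    rw [norm_smul, RCLike.norm_ofReal, abs_of_nonneg (hmin n ω).1]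
  have hFG : ∀ n ω, ‖F n ω‖ ≤ G ω * ‖x‖ := fun n ω => by
    refine (norm_indicator_le_norm_self _ ω).trans ?_
    rw [hsm]
    gcongr
    exact min_le_left _ _
  have h1 : Tendsto (fun n => ∫ ω, W ω (F n ω) ∂P) atTop
      (𝓝 (∫ ω, A.indicator (fun ω => Z ω x) ω ∂P)) := by
    refine tendsto_integral_of_dominated_convergence (fun ω => ‖Z ω‖ * ‖x‖)
      (fun n => hWm.aestronglyMeasurable.dual_apply (hFm n).aestronglyMeasurable)
      (hZi.norm.mul_const _) (fun n => .of_forall fun ω => ?_) (.of_forall fun ω => ?_)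
    · refine ((W ω).le_opNorm_of_le (hFG n ω)).trans (le_of_eq ?_)
      rw [hZ, norm_smul, RCLike.norm_ofReal, abs_of_pos (hG0 ω)]
      ring
    · refine tendsto_const_nhds.congr' ?_
      filter_upwards [hminlim ω] with n hn
      by_cases hω : ω ∈ A
      · simp [hF, hZ, hω, hn]
      · simp [hF, hω]
  have h2 : Tendsto (fun n => I fun ω => w ω • F n ω) atTop (𝓝 (I (A.indicator fun _ => x))) := by
    refine I_lim _ _ ‖x‖ (fun n =>
      (hwm.aestronglyMeasurable.smul (hFm n).aestronglyMeasurable)) (fun n ω => ?_) fun ω => ?_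
    · rw [norm_smul, hwnorm, inv_mul_le_iff₀ (hG0 ω)]
      exact hFG n ω
    · refine tendsto_const_nhds.congr' ?_
      filter_upwards [hminlim ω] with n hn
      by_cases hω : ω ∈ A
      · have hGne : ((G ω : ℝ) : 𝕜) ≠ 0 := RCLike.ofReal_ne_zero.2 (hG0 ω).ne'
        simp [hF, hw, hω, hn, smul_smul, hGne]
      · simp [hF, hω]
  rw [← I_ind A x hA]
  refine tendsto_nhds_unique h2 (h1.congr fun n => ?_)
  obtain ⟨k, hk⟩ := exists_nat_ge (n * ‖x‖)
  refine hrep (F n) k (hFm n) fun ω => le_trans ?_ hk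
  refine (norm_indicator_le_norm_self _ ω).trans ?_
  rw [hsm]
  gcongr
  exact min_le_right _ _

theorem hasRadonNikodymProperty_of_dualPairing_surjective (hP : ∃ U : Ω → ℝ, IsUniform01 P U)
    (hpq : ENNReal.HolderConjugate (ENNReal.ofReal p) q)
    (hsurj : Function.Surjective (dualPairing (𝕜 := 𝕜) (X := X) (P := P) (σ := σ) hP hpq)) :
    HasRadonNikodymProperty P (StrongDual 𝕜 X) :=
  hasRadonNikodymProperty_of_forall fun _ _ _ hm hadd hT =>
    exists_density_of_dualPairing_surjective hP hpq hsurj hm hadd hT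

end Necessity

theorem mainTheorem5 {𝕜 : Type*} [RCLike 𝕜] {X : Type*} [NormedAddCommGroup X] [NormedSpace 𝕜 X]
    [CompleteSpace X] {Ω : Type*} [MeasurableSpace Ω] (P : Measure Ω) [IsProbabilityMeasure P]
    (hP : ∃ U : Ω → ℝ, IsUniform01 P U) (σ : DistortionFunction)
    (p : ℝ) [Fact (1 ≤ p)] (q : ℝ≥0∞) (hpq : ENNReal.HolderConjugate (ENNReal.ofReal p) q) :
    ∃ L : Submodule 𝕜 (Ω →ₘ[P] StrongDual 𝕜 X),
      (L : Set (Ω →ₘ[P] StrongDual 𝕜 X)) = LSigmaStar σ q P (StrongDual 𝕜 X) ∧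
      ∃ ι : L →ₗ[𝕜] StrongDual 𝕜 (LSigma 𝕜 σ p P X),
        (∀ (Z : L) (Y : LSigma 𝕜 σ p P X),
          Integrable (fun ω => (Z : Ω →ₘ[P] StrongDual 𝕜 X) ω (Y ω)) P ∧
          ι Z Y = ∫ ω, (Z : Ω →ₘ[P] StrongDual 𝕜 X) ω (Y ω) ∂P) ∧
        (∀ Z : L, ‖ι Z‖ₑ = vectorStarNorm σ q P (Z : Ω →ₘ[P] StrongDual 𝕜 X)) ∧
        Function.Injective ι ∧
        (Function.Bijective ι ↔ HasRadonNikodymProperty P (StrongDual 𝕜 X)) := by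
  refine ⟨sigmaStarSubmodule (E := StrongDual 𝕜 X) (P := P) 𝕜 hP σ Fact.out hpq, rfl,
    dualPairing hP hpq, fun Z Y => ⟨?_, dualPairing_apply hP hpq Z Y⟩,
    enorm_dualPairing hP hpq, dualPairing_injective hP hpq, fun h => ?_, fun h => ?_⟩
  · exact integrable_pairing hP hpq Z.1.aestronglyMeasurable (ne_of_lt Z.2) Y
  · exact hasRadonNikodymProperty_of_dualPairing_surjective hP hpq h.2
  · exact ⟨dualPairing_injective hP hpq, h.dualPairing_surjective hP hpq⟩
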